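/- **Setting.** Let $A$ be a noetherian integral domain with fraction field $K$ of characteristic $0$, and let $\overline K$ be an algebraic closure of $K$. Let $\overline X$ be an integral, smooth, projective surface over $\overline K$ with $\mathrm{Pic}(\overline X)\cong\mathbb Z^r$, whose Cox ring is $\mathrm{Cox}(\overline X)=\overline K[\eta_1,\dots,\eta_N]/I$, where each $\eta_i$ is $\mathrm{Pic}(\overline X)$-homogeneous and $I$ is generated by $g_1,\dots,g_s\in A[\eta_1,\dots,\eta_N]$ with $I\cap A[\eta_1,\dots,\eta_N]=(g_1,\dots,g_s)$. Let $\overline Y$ be the characteristic space of $\overline X$, i.e. the relative spectrum over $\overline X$ of its Cox sheaf, which is an open subset of $\mathrm{Spec}(\mathrm{Cox}(\overline X))$, and let $f_1,\dots,f_m$ be monic monomials in $\eta_1,\dots,\eta_N$ that define the complement of $\overline Y$. Let $R=A[\eta_1,\dots,\eta_N]/(g_1,\dots,g_s)$ with the induced $\mathrm{Pic}(\overline X)$-grading. **Models.** Suppose that for all $i,j$ there is a homogeneous invertible element of $R[f_i^{-1}]$ whose degree is a positive multiple of $\deg f_j$. Then the $A$-model $X$ defined by $(R;f_1,\dots,f_m)$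 is the $A$-scheme obtained by gluing the affine schemes $\mathrm{Spec}(R[f_i^{-1}]_0)$ along their open subschemes $\mathrm{Spec}(R[(f_if_j)^{-1}]_0)$, where the index $0$ denotes the degree-$0$ part. We say that $(R;f_1,\dots,f_m)$ satisfies $(\ast)$ if, for every $i$, every element of the grading group is the degree of a homogeneous invertible element of $R[f_i^{-1}]$; this implies the condition required for gluing. **Contraction.** Assume that the effective divisor on $\overline X$ corresponding to $\eta_i$ is an integral curve $E_i$ for every $i\in\{1,\dots,N\}$, and that $E_N$ is a $(-1)$-curve. Let $b:\overline X\to\overline X'$ be the contraction of $E_N$ given by Castelnuovo's criterion: $\overline X'$ is an integral, smooth, projective surface over $\overline K$, and $b$ is the blowing-up of $\overline X'$ at a closed point $x$, with exceptional curve $b^{-1}(x)=E_N$. Put $E_i'=b(E_i)$ for $i\in\{1,\dots,N-1\}$. Assume that these are curves, that $x\in E_i'$ exactly for $i\in\{1,2\}$, and that $E_1\cap E_2=\emptyset$. Under the canonical identification $\mathrm{Cox}(\overline X')\cong\mathrm{Cox}(\overline X)/(\eta_N-1)$, the element $\eta_i$ for $i<N$ is a section with divisor $E_i'$. Let $f_1',\dots,f'_{m'}$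 be monic monomials in $\eta_1,\dots,\eta_{N-1}$ that define the complement of the characteristic space of $\overline X'$ in $\mathrm{Spec}(\mathrm{Cox}(\overline X'))$. Define the pull-back $b^*$ on polynomials in $\eta_1,\dots,\eta_{N-1}$ by $\eta_i\mapsto\eta_i\eta_N$ for $i\in\{1,2\}$ and $\eta_i\mapsto\eta_i$ otherwise. Let $R'=R/(\eta_N-1)$, with its $\mathrm{Pic}(\overline X')$-grading, in which $\deg\eta_i=[E_i']$ for $i<N$ and $\deg\eta_N=0$. Assume moreover: 1. if $I'$ is the ideal of $\overline K[\eta_1,\dots,\eta_N]$ generated by $g_1,\dots,g_s,\eta_N-1$, then $I'\cap A[\eta_1,\dots,\eta_N]=(g_1,\dots,g_s,\eta_N-1)$; 2. the ideal of $A[\eta_1,\dots,\eta_N]$ generated by $f_1,\dots,f_m,g_1,\dots,g_s$ and the ideal generated by all $b^*(f_j')\eta_1$, $b^*(f_j')\eta_2$ $(1\le j\le m')$ and $g_1,\dots,g_s$ have the same radical; 3. $(R;f_1,\dots,f_m)$ and $(R';f_1',\dots,f'_{m'})$ both satisfy $(\ast)$; 4. $(\eta_1,\eta_2)$ is a prime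 ideal of $\mathrm{Cox}(\overline X')$. Let $X$ and $X'$ be the $A$-models defined by $(R;f_1,\dots,f_m)$ and $(R';f_1',\dots,f'_{m'})$. **Proposition.** There is a morphism $X\to X'$ of $A$-schemes which is the blowing-up of $X'$ with center the closed subscheme defined by $\eta_1,\eta_2$, that is, the closed subscheme whose restriction to $\mathrm{Spec}(R'[{f_j'}^{-1}]_0)$ is defined by the degree-$0$ part of the ideal $(\eta_1,\eta_2)R'[{f_j'}^{-1}]$, for every $j\in\{1,\dots,m'\}$. -/

import Mathlib

open CategoryTheory CategoryTheory.Limits AlgebraicGeometry MvPolynomial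

universe u

namespace CoxModel

section Graded

variable {A R : Type u} {M : Type*} [CommRing A] [CommRing R] [Algebra A R] [AddCommGroup M]

/-- A homogeneous element of a graded ring, together with a degree in which it lies. -/
structure HomogeneousElement (𝒜 : M → Submodule A R) where
  val : R
  deg : M
  mem : val ∈ 𝒜 deg

variable {𝒜 : M → Submodule A R} [SetLike.GradedMonoid 𝒜]

namespace HomogeneousElement

/-- The product of two homogeneous elements. -/
def mul (f g : HomogeneousElement 𝒜) : HomogeneousElement 𝒜 :=
  ⟨f.val * g.val, f.deg + g.deg, SetLike.mul_mem_graded f.mem g.mem⟩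

/-- The degree `e` part of `R[f⁻¹]`: the elements `a / f ^ k` with `a` homogeneous of degree
`e + k • deg f`. -/
def awayPart (f : HomogeneousElement 𝒜) (e : M) : Submodule A (Localization.Away f.val) where
  carrier := {y | ∃ k : ℕ, ∃ a ∈ 𝒜 (e + k • f.deg),
    y * algebraMap R (Localization.Away f.val) (f.val ^ k) =
      algebraMap R (Localization.Away f.val) a}
  zero_mem' := ⟨0, 0, Submodule.zero_mem _, by simp⟩
  add_mem' := by
    rintro x y ⟨k, a, ha, hx⟩ ⟨l, b, hb, hy⟩
    refine ⟨k + l, a * f.val ^ l + b * f.val ^ k, Submodule.add_mem _ ?_ ?_, ?_⟩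
    · have := SetLike.mul_mem_graded ha (SetLike.pow_mem_graded l f.mem)
      rwa [add_assoc, ← add_smul] at this
    · have := SetLike.mul_mem_graded hb (SetLike.pow_mem_graded k f.mem)
      rwa [add_assoc, ← add_smul, add_comm l k] at this
    · rw [map_add, map_mul, map_mul, ← hx, ← hy, pow_add, map_mul]
      ring
  smul_mem' := by
    rintro c x ⟨k, a, ha, hx⟩
    refine ⟨k, c • a, Submodule.smul_mem _ c ha, ?_⟩
    rw [smul_mul_assoc, hx, Algebra.smul_def, Algebra.smul_def, map_mul,
      ← IsScalarTower.algebraMap_apply]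

lemma awayPart_mul {f : HomogeneousElement 𝒜} {d e : M} {x y : Localization.Away f.val}
    (hx : x ∈ f.awayPart d) (hy : y ∈ f.awayPart e) : x * y ∈ f.awayPart (d + e) := by
  obtain ⟨k, a, ha, hx⟩ := hx
  obtain ⟨l, b, hb, hy⟩ := hy
  refine ⟨k + l, a * b, ?_, ?_⟩
  · have := SetLike.mul_mem_graded ha hb
    rwa [add_add_add_comm, ← add_smul] at this
  · rw [map_mul, ← hx, ← hy, pow_add, map_mul]
    ring

lemma awayPart_algebraMap (f : HomogeneousElement 𝒜) {d : M} {a : R} (ha : a ∈ 𝒜 d) :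
    algebraMap R (Localization.Away f.val) a ∈ f.awayPart d :=
  ⟨0, a, by simpa using ha, by simp⟩

lemma awayPart_one (f : HomogeneousElement 𝒜) : (1 : Localization.Away f.val) ∈ f.awayPart 0 := by
  simpa using f.awayPart_algebraMap (SetLike.one_mem_graded 𝒜)

lemma awayPart_pow {f : HomogeneousElement 𝒜} {d : M} {x : Localization.Away f.val}
    (hx : x ∈ f.awayPart d) (k : ℕ) : x ^ k ∈ f.awayPart (k • d) := by
  induction k with
  | zero => simpa using f.awayPart_one
  | succ k ih => rw [pow_succ, succ_nsmul]; exact awayPart_mul ih hx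

/-- The degree zero part `R[f⁻¹]₀` of the ring `R[f⁻¹]`. -/
def degZero (f : HomogeneousElement 𝒜) : Subalgebra A (Localization.Away f.val) where
  carrier := f.awayPart 0
  mul_mem' hx hy := by simpa using awayPart_mul hx hy
  one_mem' := f.awayPart_one
  add_mem' hx hy := Submodule.add_mem _ hx hy
  zero_mem' := Submodule.zero_mem _
  algebraMap_mem' c := by
    have := Submodule.smul_mem _ c f.awayPart_one
    rwa [Algebra.smul_def, mul_one] at this

/-- `f` divides `g` with a homogeneous quotient. -/
def Divides (f g : HomogeneousElement 𝒜) : Prop :=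
  ∃ c : HomogeneousElement 𝒜, g.val = f.val * c.val ∧ g.deg = f.deg + c.deg

lemma Divides.refl (f : HomogeneousElement 𝒜) : f.Divides f :=
  ⟨⟨1, 0, SetLike.one_mem_graded 𝒜⟩, by simp, by simp⟩

lemma Divides.trans {f g h : HomogeneousElement 𝒜} (h₁ : f.Divides g) (h₂ : g.Divides h) :
    f.Divides h := by
  obtain ⟨c, hc, hc'⟩ := h₁
  obtain ⟨d, hd, hd'⟩ := h₂
  exact ⟨c.mul d, by rw [hd, hc, mul_assoc]; rfl, by rw [hd', hc', add_assoc]; rfl⟩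

lemma divides_mul (f g : HomogeneousElement 𝒜) : f.Divides (f.mul g) := ⟨g, rfl, rfl⟩

lemma mul_divides_swap (f g : HomogeneousElement 𝒜) : (f.mul g).Divides (g.mul f) :=
  ⟨⟨1, 0, SetLike.one_mem_graded 𝒜⟩, by simp [mul, mul_comm], by simp [mul, add_comm]⟩

/-- The localization map `R[f⁻¹] → R[g⁻¹]` for `f` dividing `g`. -/
noncomputable def awayHom {f g : HomogeneousElement 𝒜} (h : f.Divides g) :
    Localization.Away f.val →ₐ[R] Localization.Away g.val :=
  IsLocalization.liftAlgHom (M := Submonoid.powers f.val)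
    (f := Algebra.ofId R (Localization.Away g.val)) (by
      obtain ⟨c, hc, -⟩ := h
      rintro ⟨_, k, rfl⟩
      simp only [Algebra.ofId_apply, map_pow]
      exact (IsLocalization.Away.isUnit_of_dvd g.val ⟨c.val, hc⟩).pow k)

lemma awayHom_mem {f g : HomogeneousElement 𝒜} (h : f.Divides g) {d : M}
    {x : Localization.Away f.val} (hx : x ∈ f.awayPart d) : awayHom h x ∈ g.awayPart d := by
  obtain ⟨k, a, ha, hx⟩ := hx
  obtain ⟨c, hc, hc'⟩ := id h
  refine ⟨k, a * c.val ^ k, ?_, ?_⟩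
  · have := SetLike.mul_mem_graded ha (SetLike.pow_mem_graded k c.mem)
    rwa [add_assoc, ← smul_add, ← hc'] at this
  · have := congrArg (awayHom h) hx
    rw [map_mul, AlgHom.commutes, AlgHom.commutes] at this
    have e : g.val ^ k = f.val ^ k * c.val ^ k := by rw [hc, mul_pow]
    rw [e, map_mul, map_mul, ← this]
    ring

/-- The map `R[f⁻¹]₀ → R[g⁻¹]₀` induced by the localization map `R[f⁻¹] → R[g⁻¹]`, for `f`
dividing `g`. -/
noncomputable def degZeroHom {f g : HomogeneousElement 𝒜} (h : f.Divides g) :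
    f.degZero →ₐ[A] g.degZero :=
  (((awayHom h).restrictScalars A).comp f.degZero.val).codRestrict g.degZero
    fun x ↦ awayHom_mem h x.2

@[simp]
lemma degZeroHom_coe {f g : HomogeneousElement 𝒜} (h : f.Divides g) (x : f.degZero) :
    (degZeroHom h x : Localization.Away g.val) = awayHom h x := rfl

lemma degZeroHom_comp {f g k : HomogeneousElement 𝒜} (h₁ : f.Divides g) (h₂ : g.Divides k) :
    (degZeroHom h₂).comp (degZeroHom h₁) = degZeroHom (h₁.trans h₂) := by
  ext x
  have : (awayHom h₂).comp (awayHom h₁) = awayHom (h₁.trans h₂) :=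
    IsLocalization.algHom_ext (Submonoid.powers f.val) (by ext)
  simpa using DFunLike.congr_fun this x.1

lemma degZeroHom_id (f : HomogeneousElement 𝒜) (h : f.Divides f) :
    degZeroHom h = AlgHom.id A _ := by
  ext x
  have : awayHom h = AlgHom.id R _ :=
    IsLocalization.algHom_ext (Submonoid.powers f.val) (by ext)
  simpa using DFunLike.congr_fun this x.1

/-- The ring `R[f⁻¹]` has a homogeneous invertible element of degree `e`. (The inverse of a
homogeneous invertible element of a ring graded by a group is homogeneous of opposite degree.) -/
def HasHomogeneousUnit (f : HomogeneousElement 𝒜) (e : M) : Prop :=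
  ∃ u ∈ f.awayPart e, ∃ v ∈ f.awayPart (-e), u * v = 1

/-- The degree zero element `g ^ n * v` of `R[f⁻¹]`, for `v` of degree `-n • deg g`. -/
noncomputable def locElem (f g : HomogeneousElement 𝒜) (n : ℕ) (v : Localization.Away f.val)
    (hv : v ∈ f.awayPart (-(n • g.deg))) : f.degZero :=
  ⟨algebraMap R _ (g.val ^ n) * v, by
    have := awayPart_mul (f.awayPart_algebraMap (SetLike.pow_mem_graded n g.mem)) hv
    rwa [add_neg_cancel] at this⟩

lemma isLocalization_locElem (f g : HomogeneousElement 𝒜) {n : ℕ} (hn : 0 < n)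
    (u v : Localization.Away f.val) (hu : u ∈ f.awayPart (n • g.deg))
    (hv : v ∈ f.awayPart (-(n • g.deg))) (huv : u * v = 1) :
    letI := (degZeroHom (f.divides_mul g)).toRingHom.toAlgebra
    IsLocalization.Away (locElem f g n v hv) (f.mul g).degZero := by
  let _ := (degZeroHom (f.divides_mul g)).toRingHom.toAlgebra
  set φ := awayHom (f.divides_mul g) with hφ
  set L := Localization.Away (f.mul g).val
  have hφR : ∀ r : R, φ (algebraMap R _ r) = algebraMap R L r := φ.commutes
  have huv' : φ u * φ v = 1 := by rw [← map_mul, huv, map_one]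
  have unitfg : IsUnit (algebraMap R L (f.mul g).val) :=
    IsLocalization.Away.algebraMap_isUnit (f.mul g).val
  have unitf : IsUnit (algebraMap R L f.val) :=
    IsLocalization.Away.isUnit_of_dvd (f.mul g).val ⟨g.val, rfl⟩
  have unitg : IsUnit (algebraMap R L g.val) :=
    IsLocalization.Away.isUnit_of_dvd (f.mul g).val ⟨f.val, mul_comm _ _⟩
  have alg : ∀ y : f.degZero, ((algebraMap f.degZero (f.mul g).degZero y :) : L) = φ y :=
    fun _ ↦ rfl
  have ht : ((locElem f g n v hv : f.degZero) : Localization.Away f.val) =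
    algebraMap R _ (g.val ^ n) * v := rfl
  refine (isLocalization_iff _ _).mpr ⟨?_, ?_, ?_⟩
  · rintro ⟨_, k, rfl⟩
    simp only [map_pow]
    refine IsUnit.pow k ?_
    obtain ⟨w, hw⟩ := (unitg.pow n).exists_right_inv
    refine IsUnit.of_mul_eq_one ⟨w * φ u, ?_⟩ (Subtype.ext ?_)
    · obtain ⟨l, a, ha, hua⟩ := awayHom_mem (f.divides_mul g) hu
      refine ⟨l + n, a * f.val ^ n, ?_, ?_⟩
      · have := SetLike.mul_mem_graded ha (SetLike.pow_mem_graded n f.mem)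
        convert this using 2
        simp only [mul, smul_add, add_smul]
        abel
      · have e : (f.mul g).val ^ (l + n) = (f.mul g).val ^ l * (f.val ^ n * g.val ^ n) := by
          rw [pow_add, ← mul_pow]; rfl
        rw [e, map_mul, map_mul, map_mul _ a, ← hua, map_pow _ g.val,
          map_pow _ f.val]
        linear_combination (φ u * algebraMap R L ((f.mul g).val ^ l) *
          algebraMap R L f.val ^ n) * hw
    · change φ (algebraMap R _ (g.val ^ n) * v) * (w * φ u) = 1
      rw [map_mul, hφR, map_pow]
      linear_combination (φ u * φ v) * hw + huv'
  · rintro ⟨y, k, a, ha, hy⟩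
    -- pass to the denominator `(f g) ^ (n k)`
    have hy' : y * algebraMap R L ((f.mul g).val ^ (n * k)) =
        algebraMap R L (a * (f.mul g).val ^ (n * k - k)) := by
      rw [map_mul, ← hy, mul_assoc, ← map_mul, ← pow_add,
        Nat.add_sub_cancel' (Nat.le_mul_of_pos_left k hn)]
    have ha' : a * (f.mul g).val ^ (n * k - k) ∈ 𝒜 ((n * k) • (f.deg + g.deg)) := by
      have := SetLike.mul_mem_graded ha (SetLike.pow_mem_graded (n * k - k) (f.mul g).mem)
      rwa [zero_add, ← add_smul, Nat.add_sub_cancel' (Nat.le_mul_of_pos_left k hn)] at this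
    set a' := a * (f.mul g).val ^ (n * k - k)
    obtain ⟨w, hw⟩ := (IsLocalization.Away.algebraMap_isUnit (S := Localization.Away f.val)
      f.val).pow (n * k) |>.exists_right_inv
    have hz0 : algebraMap R (Localization.Away f.val) a' * w ∈ f.awayPart ((n * k) • g.deg) := by
      refine ⟨n * k, a', ?_, ?_⟩
      · rwa [smul_add, add_comm] at ha'
      · rw [map_pow]; linear_combination (algebraMap R _ a') * hw
    have hz : algebraMap R (Localization.Away f.val) a' * w * v ^ k ∈ f.awayPart 0 := by
      have := awayPart_mul hz0 (awayPart_pow hv k)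
      rwa [smul_neg, smul_smul, mul_comm k n, add_neg_cancel] at this
    refine ⟨(⟨_, hz⟩, ⟨_, k, rfl⟩), Subtype.ext ?_⟩
    change y * φ ((algebraMap R _ (g.val ^ n) * v) ^ k) = φ (algebraMap R _ a' * w * v ^ k)
    have hw' : algebraMap R L f.val ^ (n * k) * φ w = 1 := by
      rw [← hφR, ← map_pow, ← map_mul, hw, map_one]
    have hfg : algebraMap R L ((f.mul g).val ^ (n * k)) =
        algebraMap R L f.val ^ (n * k) * (algebraMap R L g.val ^ n) ^ k := by
      rw [← pow_mul, ← mul_pow, ← map_mul, ← map_pow]; rfl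
    simp only [map_mul, map_pow, hφR]
    rw [mul_pow, ← hy', hfg]
    linear_combination (-y * (algebraMap R L g.val ^ n) ^ k * φ v ^ k) * hw'
  · intro x y hxy
    have hxy : φ (x : Localization.Away f.val) = φ (y : Localization.Away f.val) :=
      congrArg Subtype.val hxy
    obtain ⟨k, a, ha, hx⟩ := x.2
    obtain ⟨l, b, hb, hy⟩ := y.2
    have h1 : algebraMap R L (a * f.val ^ l) = algebraMap R L (b * f.val ^ k) := by
      have hx' := congrArg φ hx
      have hy' := congrArg φ hy
      rw [map_mul, hφR, hφR] at hx' hy'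
      rw [map_mul, map_mul, ← hx', ← hy', hxy]
      ring
    obtain ⟨c, hc⟩ := IsLocalization.Away.exists_of_eq (f.mul g).val h1
    have hxy2 : algebraMap R (Localization.Away f.val) (g.val ^ c) * x =
        algebraMap R (Localization.Away f.val) (g.val ^ c) * y := by
      have h2 := congrArg (algebraMap R (Localization.Away f.val)) hc
      have hf := (IsLocalization.Away.algebraMap_isUnit (S := Localization.Away f.val)
        f.val).pow (c + k + l)
      rw [← hf.mul_left_inj]
      have e : (f.mul g).val ^ c = f.val ^ c * g.val ^ c := mul_pow _ _ _
      rw [e] at h2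
      simp only [map_mul, map_pow] at h2 hx hy ⊢
      rw [← hx, ← hy] at h2
      rw [pow_add, pow_add]
      linear_combination h2
    have hxy3 : algebraMap R (Localization.Away f.val) (g.val ^ (n * c)) * x =
        algebraMap R (Localization.Away f.val) (g.val ^ (n * c)) * y := by
      rw [← Nat.add_sub_cancel' (Nat.le_mul_of_pos_left c hn), pow_add, map_mul]
      linear_combination (algebraMap R (Localization.Away f.val) (g.val ^ (n * c - c))) * hxy2
    refine ⟨⟨_, c, rfl⟩, Subtype.ext ?_⟩
    simp only [MulMemClass.coe_mul, SubmonoidClass.coe_pow, ht]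
    rw [mul_pow, ← map_pow, ← pow_mul]
    linear_combination v ^ c * hxy3

lemma isOpenImmersion_of_hasHomogeneousUnit (f g : HomogeneousElement 𝒜) {n : ℕ} (hn : 0 < n)
    (h : f.HasHomogeneousUnit (n • g.deg)) :
    IsOpenImmersion (Spec.map (CommRingCat.ofHom
      (degZeroHom (f.divides_mul g)).toRingHom)) := by
  obtain ⟨u, hu, v, hv, huv⟩ := h
  let _ := (degZeroHom (f.divides_mul g)).toRingHom.toAlgebra
  have := isLocalization_locElem f g hn u v hu hv huv
  exact IsOpenImmersion.of_isLocalization (locElem f g n v hv)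

lemma isPullback_of_hasHomogeneousUnit (f g p : HomogeneousElement 𝒜) {n : ℕ} (hn : 0 < n)
    (h : f.HasHomogeneousUnit (n • g.deg)) (hfp : f.Divides p)
    (hfg : (f.mul g).Divides (p.mul g)) :
    IsPullback
      (Spec.map (CommRingCat.ofHom (degZeroHom (p.divides_mul g)).toRingHom))
      (Spec.map (CommRingCat.ofHom (degZeroHom hfg).toRingHom))
      (Spec.map (CommRingCat.ofHom (degZeroHom hfp).toRingHom))
      (Spec.map (CommRingCat.ofHom (degZeroHom (f.divides_mul g)).toRingHom)) := by
  obtain ⟨u, hu, v, hv, huv⟩ := h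
  apply isPullback_SpecMap_of_isPushout
  let _ := (degZeroHom (f.divides_mul g)).toRingHom.toAlgebra
  let _ := (degZeroHom (p.divides_mul g)).toRingHom.toAlgebra
  let _ := (degZeroHom hfp).toRingHom.toAlgebra
  let _ := (degZeroHom hfg).toRingHom.toAlgebra
  let _ := (degZeroHom (hfp.trans (p.divides_mul g))).toRingHom.toAlgebra
  have : IsScalarTower f.degZero p.degZero (p.mul g).degZero :=
    .of_algebraMap_eq fun x ↦
      (DFunLike.congr_fun (degZeroHom_comp hfp (p.divides_mul g)) x).symm
  have : IsScalarTower f.degZero (f.mul g).degZero (p.mul g).degZero :=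
    .of_algebraMap_eq fun x ↦
      (DFunLike.congr_fun (degZeroHom_comp (f.divides_mul g) hfg) x).symm
  have h₁ := isLocalization_locElem f g hn u v hu hv huv
  have h₂ := isLocalization_locElem p g hn (awayHom hfp u) (awayHom hfp v)
    (awayHom_mem hfp hu) (awayHom_mem hfp hv) (by rw [← map_mul, huv, map_one])
  have e : algebraMap f.degZero p.degZero (locElem f g n v hv) =
      locElem p g n (awayHom hfp v) (awayHom_mem hfp hv) := by
    apply Subtype.ext
    change awayHom hfp (algebraMap R _ (g.val ^ n) * v) = algebraMap R _ (g.val ^ n) * _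
    rw [map_mul, AlgHom.commutes]
  have h₃ : IsLocalization (Algebra.algebraMapSubmonoid p.degZero
      (Submonoid.powers (locElem f g n v hv))) (p.mul g).degZero := by
    rw [Algebra.algebraMapSubmonoid_powers, e]
    exact h₂
  have : Algebra.IsPushout f.degZero p.degZero (f.mul g).degZero (p.mul g).degZero :=
    Algebra.isPushout_of_isLocalization (Submonoid.powers (locElem f g n v hv)) _ _ _
  exact CommRingCat.isPushout_of_isPushout f.degZero p.degZero (f.mul g).degZero (p.mul g).degZero

lemma isIso_self (f : HomogeneousElement 𝒜) :
    IsIso (Spec.map (CommRingCat.ofHom (degZeroHom (f.divides_mul f)).toRingHom)) := by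
  obtain ⟨w, hw⟩ := (IsLocalization.Away.algebraMap_isUnit (S := Localization.Away f.val)
      f.val).exists_right_inv
  let _ := (degZeroHom (f.divides_mul f)).toRingHom.toAlgebra
  have hu : algebraMap R _ f.val ∈ f.awayPart (1 • f.deg) := by
    rw [one_smul]; exact f.awayPart_algebraMap f.mem
  have hv : w ∈ f.awayPart (-(1 • f.deg)) :=
    ⟨1, 1, by simpa using SetLike.one_mem_graded 𝒜, by rw [pow_one, mul_comm, hw, map_one]⟩
  have h := isLocalization_locElem f f one_pos _ w hu hv hw
  have e : locElem f f 1 w hv = 1 := Subtype.ext (by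
    change algebraMap R _ (f.val ^ 1) * w = 1
    rw [pow_one, hw])
  rw [e] at h
  have hb : Function.Bijective (algebraMap f.degZero (f.mul f).degZero) :=
    (IsLocalization.atUnit f.degZero (f.mul f).degZero 1 isUnit_one).bijective
  have : IsIso (CommRingCat.ofHom (degZeroHom (f.divides_mul f)).toRingHom) :=
    (ConcreteCategory.isIso_iff_bijective _).mpr hb
  infer_instance

/-- The morphism `Spec R[g⁻¹]₀ ⟶ Spec R[f⁻¹]₀` for `f` dividing `g`. -/
noncomputable def specHom {f g : HomogeneousElement 𝒜} (h : f.Divides g) :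
    Spec (.of g.degZero) ⟶ Spec (.of f.degZero) :=
  Spec.map (CommRingCat.ofHom (degZeroHom h).toRingHom)

lemma specHom_comp {f g k : HomogeneousElement 𝒜} (h₁ : f.Divides g) (h₂ : g.Divides k) :
    specHom h₂ ≫ specHom h₁ = specHom (h₁.trans h₂) := by
  rw [specHom, specHom, specHom, ← Spec.map_comp, ← degZeroHom_comp h₁ h₂]
  rfl

lemma specHom_id {f : HomogeneousElement 𝒜} (h : f.Divides f) : specHom h = 𝟙 _ := by
  rw [specHom, degZeroHom_id, ← Spec.map_id]
  rfl

lemma specHom_comp_algebraMap {f g : HomogeneousElement 𝒜} (h : f.Divides g) :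
    specHom h ≫ Spec.map (CommRingCat.ofHom (algebraMap A f.degZero)) =
      Spec.map (CommRingCat.ofHom (algebraMap A g.degZero)) := by
  rw [specHom, ← Spec.map_comp, ← CommRingCat.ofHom_comp]
  congr 2
  exact (degZeroHom h).comp_algebraMap

lemma mul_divides_mul {f p : HomogeneousElement 𝒜} (h : f.Divides p)
    (g : HomogeneousElement 𝒜) : (f.mul g).Divides (p.mul g) := by
  obtain ⟨c, hc, hc'⟩ := h
  exact ⟨c, by simp only [mul, hc]; ring, by simp only [mul, hc']; abel⟩

lemma rotate_divides (f g k : HomogeneousElement 𝒜) :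
    ((g.mul k).mul f).Divides ((f.mul g).mul k) :=
  ⟨⟨1, 0, SetLike.one_mem_graded 𝒜⟩, by simp only [mul]; ring, by simp only [mul]; abel⟩

/-- For any two members `f, g` of the family, `R[f⁻¹]` has a homogeneous invertible element whose
degree is a (positive) multiple of `deg g`. -/
def HasUnits {ι : Type*} (f : ι → HomogeneousElement 𝒜) : Prop :=
  ∀ i j, ∃ n : ℕ, 0 < n ∧ (f i).HasHomogeneousUnit (n • (f j).deg)

/-- Every degree is the degree of a homogeneous invertible element of `R[f⁻¹]`, for every member
`f` of the family. -/
def HasAllUnits {ι : Type*} (f : ι → HomogeneousElement 𝒜) : Prop :=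
  ∀ i e, (f i).HasHomogeneousUnit e

lemma HasAllUnits.hasUnits {ι : Type*} {f : ι → HomogeneousElement 𝒜} (h : HasAllUnits f) :
    HasUnits f := fun i _ ↦ ⟨1, one_pos, h i _⟩

section Glue

variable {ι : Type} (f : ι → HomogeneousElement 𝒜)

lemma isOpenImmersion_specHom (hf : HasUnits f) (i j : ι) : IsOpenImmersion (specHom ((f i).divides_mul (f j))) := by
  obtain ⟨n, hn, h⟩ := hf i j
  exact isOpenImmersion_of_hasHomogeneousUnit _ _ hn h

lemma isPullback_specHom (hf : HasUnits f) (i j k : ι) :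
    IsPullback (specHom (((f i).mul (f j)).divides_mul (f k)))
      (specHom (mul_divides_mul ((f i).divides_mul (f j)) (f k)))
      (specHom ((f i).divides_mul (f j))) (specHom ((f i).divides_mul (f k))) := by
  obtain ⟨n, hn, h⟩ := hf i k
  exact isPullback_of_hasHomogeneousUnit _ _ _ hn h _ _

/-- The gluing datum with charts `Spec R[fᵢ⁻¹]₀` and overlaps `Spec R[(fᵢ fⱼ)⁻¹]₀`. -/
noncomputable def glueData (hf : HasUnits f) : Scheme.GlueData.{u} where
  J := ULift.{u} ι
  U i := Spec (.of (f i.down).degZero)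
  V ij := Spec (.of ((f ij.1.down).mul (f ij.2.down)).degZero)
  f i j := specHom ((f i.down).divides_mul (f j.down))
  f_mono i j := by
    have := isOpenImmersion_specHom f hf i.down j.down
    infer_instance
  f_hasPullback i j k := (isPullback_specHom f hf i.down j.down k.down).hasPullback
  f_id i := isIso_self (f i.down)
  f_open i j := isOpenImmersion_specHom f hf i.down j.down
  t i j := specHom (mul_divides_swap (f j.down) (f i.down))
  t_id i := specHom_id _
  t' i j k :=
    (isPullback_specHom f hf i.down j.down k.down).isoPullback.inv ≫
      specHom (rotate_divides (f i.down) (f j.down) (f k.down)) ≫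
        (isPullback_specHom f hf j.down k.down i.down).isoPullback.hom
  t_fac i j k := by
    simp only [Category.assoc, IsPullback.isoPullback_hom_snd]
    rw [Iso.inv_comp_eq, IsPullback.isoPullback_hom_fst_assoc, specHom_comp, specHom_comp]
  cocycle i j k := by
    simp only [Category.assoc, Iso.hom_inv_id_assoc]
    rw [← Category.assoc (specHom _), ← Category.assoc (specHom _ ≫ specHom _), specHom_comp,
      specHom_comp, specHom_id, Category.id_comp, Iso.inv_hom_id]

/-- The scheme obtained by gluing the affine schemes `Spec R[fᵢ⁻¹]₀` along their open subschemes
`Spec R[(fᵢ fⱼ)⁻¹]₀`. -/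
noncomputable def glued (hf : HasUnits f) : Scheme.{u} := (glueData f hf).glued

/-- The open chart `Spec R[fᵢ⁻¹]₀` of the glued scheme. -/
noncomputable def chart (hf : HasUnits f) (i : ι) : Spec (.of (f i).degZero) ⟶ glued f hf :=
  (glueData f hf).ι ⟨i⟩

/-- The structure morphism to `Spec A` of the glued scheme. -/
noncomputable def toBase (hf : HasUnits f) : glued f hf ⟶ Spec (.of A) :=
  Multicoequalizer.desc _ _
    (fun i : ULift.{u} ι ↦ Spec.map (CommRingCat.ofHom (algebraMap A (f i.down).degZero))) (by
      rintro ⟨i, j⟩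
      refine (specHom_comp_algebraMap ((f i.down).divides_mul (f j.down))).trans ?_
      refine (specHom_comp_algebraMap ((f j.down).divides_mul (f i.down) |>.trans
        (mul_divides_swap (f j.down) (f i.down)))).symm.trans ?_
      rw [← specHom_comp]
      rfl)

lemma chart_toBase (hf : HasUnits f) (i : ι) : chart f hf i ≫ toBase f hf =
    Spec.map (CommRingCat.ofHom (algebraMap A (f i).degZero)) :=
  Multicoequalizer.π_desc _ _ _ _ _

end Glue

/-- The degree zero part of the ideal of `R[f⁻¹]` generated by a set `S` of homogeneous elements
of `R`. -/
def degZeroIdeal (f : HomogeneousElement 𝒜) (S : Set R) : Ideal f.degZero :=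
  (Ideal.span (algebraMap R (Localization.Away f.val) '' S)).comap f.degZero.val.toRingHom

/-- `I` is the ideal sheaf of the closed subscheme of the glued scheme defined by the set `S` of
homogeneous elements of `R`: on the chart `Spec R[fᵢ⁻¹]₀` this is the closed subscheme
`Spec (R[fᵢ⁻¹]₀ ⧸ J)`, where `J` is the degree zero part of the ideal generated by `S` in
`R[fᵢ⁻¹]`. -/
def IsIdealSheafDefinedBy {ι : Type} (f : ι → HomogeneousElement 𝒜) (hf : HasUnits f) (S : Set R)
    (I : (glued f hf).IdealSheafData) : Prop :=
  ∀ i, I.comap (chart f hf i) =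
    (Spec.map (CommRingCat.ofHom (S := (f i).degZero ⧸ (f i).degZeroIdeal S)
      (Ideal.Quotient.mk ((f i).degZeroIdeal S)))).ker

end HomogeneousElement

end Graded

section Presentation

variable {A : Type u} [CommRing A] {σ : Type} {r : ℕ}

/-- The grading of `A[η] ⧸ G` in which `ηᵢ` has degree `w i`; here `G` is an ideal generated by
homogeneous polynomials. -/
noncomputable def quotGrading (w : σ → Fin r → ℤ) (G : Ideal (MvPolynomial σ A)) (d : Fin r → ℤ) :
    Submodule A (MvPolynomial σ A ⧸ G) :=
  (weightedHomogeneousSubmodule A w d).map (Ideal.Quotient.mkₐ A G).toLinearMap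

instance (w : σ → Fin r → ℤ) (G : Ideal (MvPolynomial σ A)) :
    SetLike.GradedMonoid (quotGrading w G) where
  one_mem := ⟨1, isWeightedHomogeneous_one A w, by simp⟩
  mul_mem := by
    rintro d e _ _ ⟨x, hx, rfl⟩ ⟨y, hy, rfl⟩
    exact ⟨x * y, IsWeightedHomogeneous.mul hx hy, by simp⟩

/-- The class in `A[η] ⧸ G` of the monic monomial with exponent vector `a`. -/
noncomputable def monomialElement (w : σ → Fin r → ℤ) (G : Ideal (MvPolynomial σ A)) (a : σ →₀ ℕ) :
    HomogeneousElement (quotGrading w G) where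
  val := Ideal.Quotient.mk G (monomial a 1)
  deg := Finsupp.weight w a
  mem := ⟨monomial a 1, isWeightedHomogeneous_monomial w a 1 rfl, rfl⟩

/-- The classes in `A[η] ⧸ G` of the monic monomials with exponent vectors `a j`. -/
noncomputable abbrev generators {ι : Type} (w : σ → Fin r → ℤ) (G : Ideal (MvPolynomial σ A))
    (a : ι → σ →₀ ℕ) : ι → HomogeneousElement (quotGrading w G) :=
  fun j ↦ monomialElement w G (a j)

end Presentation

section Blowup

variable {X Y : Scheme.{u}}

/-- An ideal sheaf is the ideal sheaf of an effective Cartier divisor if it is locally generated by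
one nonzerodivisor. -/
def IsEffectiveCartier (J : X.IdealSheafData) : Prop :=
  ∀ x : X, ∃ U : X.affineOpens, x ∈ U.1 ∧ ∃ t ∈ nonZeroDivisors Γ(X, U), J.ideal U = Ideal.span {t}

/-- `β : Y ⟶ X` is the blowing-up of `X` with center the closed subscheme with ideal sheaf `I`:
the inverse image of the center is an effective Cartier divisor, and `β` is universal with this
property. -/
structure IsBlowup (β : Y ⟶ X) (I : X.IdealSheafData) : Prop where
  isEffectiveCartier : IsEffectiveCartier (I.comap β)
  existsUnique_lift : ∀ (T : Scheme.{u}) (g : T ⟶ X), IsEffectiveCartier (I.comap g) →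
    ∃! h : T ⟶ Y, h ≫ β = g

/-- The morphism `b : Y ⟶ X` contracts exactly the curve with generic point `E` to the point `x`,
as in Castelnuovo's criterion: it is the blowing-up of the closed point `x`, with exceptional curve
the closure of `E`. For smooth projective surfaces `X`, `Y` over an algebraically closed field, the
curves `E` which are contracted by such a morphism are precisely the (-1)-curves on `Y`. -/
structure IsContraction (b : Y ⟶ X) (E : Y) (x : X) : Prop where
  isClosed : IsClosed ({x} : Set X)
  isBlowup : IsBlowup b (Scheme.IdealSheafData.vanishingIdeal ⟨{x}, isClosed⟩)
  preimage : b ⁻¹' {x} = closure {E}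

end Blowup

section GluedBlowup

variable {A R R' : Type u} {M M' : Type*} [CommRing A] [CommRing R] [Algebra A R] [AddCommGroup M]
  [CommRing R'] [Algebra A R'] [AddCommGroup M'] {𝒜 : M → Submodule A R} [SetLike.GradedMonoid 𝒜]
  {𝒜' : M' → Submodule A R'} [SetLike.GradedMonoid 𝒜'] {ι ι' : Type}

/-- The `A`-scheme glued from the affine schemes `Spec R[fᵢ⁻¹]₀` is a blowing-up, by a morphism of
`A`-schemes, of the `A`-scheme glued from the affine schemes `Spec R'[f'ᵢ⁻¹]₀`, with center the
closed subscheme defined by the set `S` of homogeneous elements of `R'`. -/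
def IsBlowupAlong {f : ι → HomogeneousElement 𝒜} (hf : HomogeneousElement.HasUnits f)
    {f' : ι' → HomogeneousElement 𝒜'} (hf' : HomogeneousElement.HasUnits f') (S : Set R') : Prop :=
  ∃ (β : HomogeneousElement.glued f hf ⟶ HomogeneousElement.glued f' hf')
    (I : (HomogeneousElement.glued f' hf').IdealSheafData),
    β ≫ HomogeneousElement.toBase f' hf' = HomogeneousElement.toBase f hf ∧
      HomogeneousElement.IsIdealSheafDefinedBy f' hf' S I ∧ IsBlowup β I

end GluedBlowup

section Cox

variable (X : Scheme.{u})

/-- A prime divisor, given by its generic point, a point of codimension one. -/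
def PrimeDivisor : Type u := {z : X // Order.coheight z = 1}

/-- Weil divisors on a noetherian integral scheme. -/
abbrev WeilDivisor : Type u := PrimeDivisor X →₀ ℤ

variable {X} [IsIntegral X] [IsLocallyNoetherian X] {r : ℕ}

/-- The divisors `E` and `F` differ by a principal divisor. -/
def IsLinearlyEquivalent (E F : WeilDivisor X) : Prop :=
  ∃ φ : X.functionField, φ ≠ 0 ∧ ∀ z : PrimeDivisor X, E z - F z = Scheme.ord φ z.1

/-- The divisor `∑ mᵢ Dᵢ`. -/
noncomputable def combination (D : Fin r → WeilDivisor X) (m : Fin r → ℤ) : WeilDivisor X :=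
  ∑ i, m i • D i

/-- The classes of `D₁, …, Dᵣ` form a basis of the group of Weil divisors modulo linear
equivalence, that is, of the Picard group if `X` is regular. -/
def IsPicardBasis (D : Fin r → WeilDivisor X) : Prop :=
  ∀ E : WeilDivisor X, ∃! m : Fin r → ℤ, IsLinearlyEquivalent E (combination D m)

/-- The rational function `φ` is a section over `U` of the sheaf `𝒪(∑ mᵢ Dᵢ)`. -/
def IsSection (D : Fin r → WeilDivisor X) (U : X.Opens) (m : Fin r → ℤ)
    (φ : X.functionField) : Prop :=
  φ ≠ 0 → ∀ z : PrimeDivisor X, z.1 ∈ U → 0 ≤ Scheme.ord φ z.1 + combination D m z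

/-- The ring `⨁ₘ Γ(U, 𝒪(∑ mᵢ Dᵢ))`, as the ring of Laurent polynomials over the function field
generated by the monomials `φ zᵐ` with `φ` in `Γ(U, 𝒪(∑ mᵢ Dᵢ))`. If the classes of the `Dᵢ` form a
basis of the Picard group, then this is the ring of sections over `U` of the Cox sheaf, and the Cox
ring of `X` for `U = X`. (For regular `X` the sections of `𝒪(∑ mᵢ Dᵢ)` are closed under addition, so
that all elements of degree `m` of this ring are of the form `φ zᵐ` with `φ` as above.) -/
noncomputable def coxRing (D : Fin r → WeilDivisor X) (U : X.Opens) :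
    Subring (AddMonoidAlgebra X.functionField (Fin r → ℤ)) :=
  Subring.closure {q | ∃ m φ, IsSection D U m φ ∧ q = AddMonoidAlgebra.single m φ}

lemma coxRing_top_le (D : Fin r → WeilDivisor X) (U : X.Opens) : coxRing D ⊤ ≤ coxRing D U :=
  Subring.closure_mono fun _ ⟨m, φ, h, e⟩ ↦ ⟨m, φ, fun h0 z _ ↦ h h0 z trivial, e⟩

/-- The characteristic space of `X` as a subset of the spectrum of the Cox ring. It is the relative
spectrum over `X` of the Cox sheaf, so it is the union, over the nonempty affine open subsets `U` of
`X`, of the images of the spectra of the rings of sections over `U` of the Cox sheaf. -/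
def characteristicSpace (D : Fin r → WeilDivisor X) : Set (PrimeSpectrum (coxRing D ⊤)) :=
  ⋃ (U : X.Opens) (_ : IsAffineOpen U ∧ (U : Set X).Nonempty),
    Set.range (PrimeSpectrum.comap (Subring.inclusion (coxRing_top_le D U)))

/-- A homogeneous element `φ zᵐ` of the Cox ring, such that the corresponding effective divisor
`div φ + ∑ mᵢ Dᵢ` is a prime divisor, called `curve`. -/
structure PrimeSection (D : Fin r → WeilDivisor X) where
  deg : Fin r → ℤ
  fn : X.functionField
  fn_ne_zero : fn ≠ 0
  curve : PrimeDivisor X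
  div_eq : ∀ z : PrimeDivisor X,
    Scheme.ord fn z.1 + combination D deg z = Finsupp.single curve (1 : ℤ) z

/-- The element `φ zᵐ` of the Cox ring. -/
noncomputable def PrimeSection.toCox {D : Fin r → WeilDivisor X} (s : PrimeSection D) :
    coxRing D ⊤ :=
  ⟨AddMonoidAlgebra.single s.deg s.fn, Subring.subset_closure ⟨s.deg, s.fn, fun _ z _ ↦ by
    classical
    rw [s.div_eq, Finsupp.single_apply]
    split_ifs <;> simp, rfl⟩⟩

/-- The monomial with exponent vector `a` in the given elements of the Cox ring. -/
noncomputable def coxMonomial {σ : Type} {D : Fin r → WeilDivisor X} (s : σ → PrimeSection D)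
    (a : σ →₀ ℕ) : coxRing D ⊤ :=
  a.prod fun i k ↦ (s i).toCox ^ k

/-- The monomials with exponent vectors `a j` define the complement of the characteristic space in
the spectrum of the Cox ring. -/
def DefinesComplement {σ ι : Type} {D : Fin r → WeilDivisor X} (s : σ → PrimeSection D)
    (a : ι → σ →₀ ℕ) : Prop :=
  PrimeSpectrum.zeroLocus (Set.range fun j ↦ coxMonomial s (a j)) = (characteristicSpace D)ᶜ

/-- The inclusion of the constants in the function field of a scheme over `k`. -/
noncomputable def constants {k : Type u} [Field k] (p : X ⟶ Spec (.of k)) :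
    k →+* X.functionField :=
  ((X.presheaf.germ ⊤ (genericPoint X) trivial).hom.comp p.appTop.hom).comp
    (Scheme.ΓSpecIso (.of k)).inv.hom

/-- The homomorphism from the polynomial ring `k[η]` that sends `ηᵢ` to the `i`-th given element of
the Cox ring. -/
noncomputable def coxHom {k : Type u} [Field k] {σ : Type} (p : X ⟶ Spec (.of k))
    {D : Fin r → WeilDivisor X} (s : σ → PrimeSection D) :
    MvPolynomial σ k →+* AddMonoidAlgebra X.functionField (Fin r → ℤ) :=
  eval₂Hom (AddMonoidAlgebra.singleZeroRingHom.comp (constants p)) fun i ↦ (s i).toCox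

/-- The Cox ring of `X` is `k[η] ⧸ I`, where `I` is the ideal generated by the ideal `G` of
`A[η]`, and `I ∩ A[η] = G`. -/
structure IsCoxPresentation {A k : Type u} [CommRing A] [Field k] [Algebra A k] {σ : Type}
    (p : X ⟶ Spec (.of k)) {D : Fin r → WeilDivisor X} (s : σ → PrimeSection D)
    (G : Ideal (MvPolynomial σ A)) : Prop where
  range_eq : (coxHom p s).range = coxRing D ⊤
  ker_eq : RingHom.ker (coxHom p s) = G.map (MvPolynomial.map (algebraMap A k))
  comap_map : (G.map (MvPolynomial.map (algebraMap A k))).comap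
    (MvPolynomial.map (algebraMap A k)) = G

end Cox

section Contraction

variable {A : Type u} [CommRing A] {n : ℕ}

/-- The pull-back of sections, on polynomials in `η₁, …, η_{N-1}` with `N = n + 3`: it sends `ηᵢ` to
`ηᵢ η_N` for `i = 1, 2`, and to `ηᵢ` otherwise. -/
noncomputable def pullbackSections :
    MvPolynomial (Fin (n + 2)) A →ₐ[A] MvPolynomial (Fin (n + 3)) A :=
  aeval fun i ↦ if i = 0 ∨ i = 1 then X i.castSucc * X (Fin.last (n + 2)) else X i.castSucc

/-- The ideal `C_A` generated by the monomials `f₁, …, f_m` with exponent vectors `a j`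
and by `g₁, …, g_s`. -/
noncomputable def idealC {ι κ σ : Type} (a : ι → σ →₀ ℕ) (g : κ → MvPolynomial σ A) :
    Ideal (MvPolynomial σ A) :=
  Ideal.span ((Set.range fun j ↦ monomial (a j) 1) ∪ Set.range g)

/-- The ideal `C'_A` generated by the elements `b^*(f'ⱼ) η₁` and `b^*(f'ⱼ) η₂`, for the
monomials `f'ⱼ` with exponent vectors `a' j`, and by `g₁, …, g_s`. -/
noncomputable def idealC' {ι κ : Type} (a' : ι → Fin (n + 2) →₀ ℕ)
    (g : κ → MvPolynomial (Fin (n + 3)) A) : Ideal (MvPolynomial (Fin (n + 3)) A) :=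
  Ideal.span ((Set.range fun j ↦ pullbackSections (monomial (a' j) 1) * X 0) ∪
    (Set.range fun j ↦ pullbackSections (monomial (a' j) 1) * X 1) ∪ Set.range g)

/-- The ideal of `A[η₁, …, η_N]` generated by `g₁, …, g_s` and `η_N - 1`. -/
noncomputable def contractedIdeal {κ : Type} (g : κ → MvPolynomial (Fin (n + 3)) A) :
    Ideal (MvPolynomial (Fin (n + 3)) A) :=
  Ideal.span (Set.range g ∪ {X (Fin.last (n + 2)) - 1})

/-- The degrees of `η₁, …, η_N` in the ring `R ⧸ (η_N - 1)`: the given ones for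
`η₁, …, η_{N-1}`, and zero for `η_N`. -/
def contractedDegrees {r : ℕ} (w : Fin (n + 2) → Fin r → ℤ) : Fin (n + 3) → Fin r → ℤ :=
  Fin.snoc (α := fun _ ↦ Fin r → ℤ) w 0

end Contraction

end CoxModel

open CoxModel HomogeneousElement

/-! Write η₁, η₂, η_N for `X 0`, `X 1`, `X (Fin.last (n + 2))`, and e_N for the degree of η_N.

Algebra. Sending η_i to η_i η_N for i = 1, 2, fixing the other η_i with i < N, and sending η_N to 1
induces an injective homomorphism R' → R (`pull`). It is graded along a homomorphism τ of degree
groups, the pull-back of divisor classes. By the equality of radicals, X may be glued from the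
charts of the monomials b^*(f'_j) η_k with k = 1, 2 (`isBlowupAlong_of_radical`), and such a chart
maps to the chart of f'_j. It remains to see that R[(b^*(f'_j) η_k)⁻¹]₀ is the k-th affine chart of
the blowing-up of R'[f'_j⁻¹]₀ in the degree zero part J of (η₁, η₂). The point is that an element of
R of degree τ(d) - n e_N becomes, after multiplication by η_N ^ n, the image of an element of degree
d of (η₁, η₂) ^ n. This may be checked on monomials: the degree forces a_N + n = a_1 + a_2 for the
exponents, so that for n > 0 a factor η₁ or η₂ can be split off (`exists_contractionDatum`,
`exists_mem_pow`). Hence all elements of the chart have the form b / x ^ n with b in J ^ n, where x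
is the generator of J given by η_k (`isBlowupChart`), and `isBlowup_of_charts` deduces the universal
property.

Geometry. The equation for the exponents means that a relation ∑ c_i deg η_i = 0 implies c_N = c_1 +
c_2. A relation is the divisor ∑ c_i E_i of a rational function. On the contracted surface this
function has divisor ∑ c_i E'_i over i < N, so that c_N = c_1 v₀ + c_2 v₁, where v₀, v₁ are the
orders along E_N of local equations of E'_1, E'_2 at x (`exists_multiplicities`). That v₀ = v₁ = 1
follows from (∗), without intersection theory: at a point of E_1 ∩ E_N, the degrees of the η_i not
vanishing there generate the degree group; writing e_N in terms of them gives a relation with c_N =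
-1 and c_1 = 0, whence v₁ divides 1, and symmetrically for v₀ (`exists_exceptional_relation`,
`isContractionGrading`). Local equations exist because the local rings in question are factorial
(`uniqueFactorizationMonoid_of_maximalIdeal_eq_span_pair`). -/

set_option linter.unusedSectionVars false

namespace CoxModel

namespace HomogeneousElement

/-! ### Homogeneous units and fractions of degree zero. -/

section Units

variable {A R : Type u} {M : Type*} [CommRing A] [CommRing R] [Algebra A R] [AddCommGroup M]
  {𝒜 : M → Submodule A R} [SetLike.GradedMonoid 𝒜]

lemma ext_val_deg {f g : HomogeneousElement 𝒜} (h : f.val = g.val) (h' : f.deg = g.deg) :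
    f = g := by
  cases f; cases g; congr

/-- The degree zero element `g * v` of `R[f⁻¹]`, for `v` of degree `-deg g`. -/
noncomputable def frac (f g : HomogeneousElement 𝒜) (v : Localization.Away f.val)
    (hv : v ∈ f.awayPart (-g.deg)) : f.degZero :=
  ⟨algebraMap R _ g.val * v, by
    have := awayPart_mul (f.awayPart_algebraMap g.mem) hv
    rwa [add_neg_cancel] at this⟩

lemma frac_eq_locElem (f g : HomogeneousElement 𝒜) (v : Localization.Away f.val)
    (hv : v ∈ f.awayPart (-g.deg)) :
    f.frac g v hv = locElem f g 1 v (by rwa [one_smul]) :=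
  Subtype.ext (by simp [frac, locElem])

lemma awayPart_mul_mem {f : HomogeneousElement 𝒜} {d e k : M} {x y : Localization.Away f.val}
    (hx : x ∈ f.awayPart d) (hy : y ∈ f.awayPart e) (h : d + e = k) : x * y ∈ f.awayPart k :=
  h ▸ awayPart_mul hx hy

lemma HasHomogeneousUnit.zero (f : HomogeneousElement 𝒜) : f.HasHomogeneousUnit 0 :=
  ⟨1, f.awayPart_one, 1, by simpa using f.awayPart_one, one_mul 1⟩

lemma HasHomogeneousUnit.add {f : HomogeneousElement 𝒜} {d e : M} (hd : f.HasHomogeneousUnit d)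
    (he : f.HasHomogeneousUnit e) : f.HasHomogeneousUnit (d + e) := by
  obtain ⟨u, hu, v, hv, huv⟩ := hd
  obtain ⟨u', hu', v', hv', huv'⟩ := he
  exact ⟨u * u', awayPart_mul hu hu', v * v', awayPart_mul_mem hv hv' (by abel),
    by rw [mul_mul_mul_comm, huv, huv', one_mul]⟩

lemma HasHomogeneousUnit.neg {f : HomogeneousElement 𝒜} {d : M} (hd : f.HasHomogeneousUnit d) :
    f.HasHomogeneousUnit (-d) := by
  obtain ⟨u, hu, v, hv, huv⟩ := hd
  exact ⟨v, hv, u, by rwa [neg_neg], by rwa [mul_comm]⟩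

/-- The degrees of the homogeneous invertible elements of `R[f⁻¹]` form a group. -/
def unitDegrees (f : HomogeneousElement 𝒜) : AddSubgroup M where
  carrier := {d | f.HasHomogeneousUnit d}
  zero_mem' := .zero f
  add_mem' := .add
  neg_mem' := .neg

/-- If f = g c, then c / f is an inverse of g of degree -deg g. -/
lemma hasHomogeneousUnit_of_divides {f g : HomogeneousElement 𝒜} (h : g.Divides f) :
    f.HasHomogeneousUnit g.deg := by
  obtain ⟨c, hc, hc'⟩ := h
  obtain ⟨w, hw⟩ := (IsLocalization.Away.algebraMap_isUnit (S := Localization.Away f.val)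
    f.val).exists_right_inv
  refine ⟨algebraMap R _ g.val, f.awayPart_algebraMap g.mem, algebraMap R _ c.val * w,
    ⟨1, c.val, ?_, ?_⟩, ?_⟩
  · simpa [hc'] using c.mem
  · rw [pow_one]; linear_combination (algebraMap R _ c.val) * hw
  · rw [← mul_assoc, ← map_mul, ← hc, hw]

lemma degZeroHom_frac {f g : HomogeneousElement 𝒜} (h : f.Divides g) (k : HomogeneousElement 𝒜)
    {v : Localization.Away f.val} (hv : v ∈ f.awayPart (-k.deg)) :
    degZeroHom h (f.frac k v hv) = g.frac k (awayHom h v) (awayHom_mem h hv) :=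
  Subtype.ext (by simp [frac])

/-- The open subset `Spec R[(f g)⁻¹]₀` of `Spec R[f⁻¹]₀` is the set of points at which `g` does not
vanish. -/
lemma mem_range_specHom_iff {f g : HomogeneousElement 𝒜} (hu : f.HasHomogeneousUnit g.deg)
    (Q : PrimeSpectrum f.degZero) :
    Q ∈ Set.range (specHom (f.divides_mul g)) ↔
      ∃ (c : Localization.Away f.val) (hc : c ∈ f.awayPart (-g.deg)),
        f.frac g c hc ∉ Q.asIdeal := by
  obtain ⟨u, hu, v, hv, huv⟩ := hu
  let _ := (degZeroHom (f.divides_mul g)).toRingHom.toAlgebra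
  have := isLocalization_locElem f g one_pos u v (by rwa [one_smul]) (by rwa [one_smul]) huv
  have hr := PrimeSpectrum.localization_away_comap_range (f.mul g).degZero
    (locElem f g 1 v _)
  rw [← frac_eq_locElem f g v hv] at hr
  have hr' : Q ∈ Set.range (specHom (f.divides_mul g)) ↔ f.frac g v hv ∉ Q.asIdeal := by
    rw [← PrimeSpectrum.mem_basicOpen, ← SetLike.mem_coe, ← hr]
    rfl
  rw [hr']
  refine ⟨fun h ↦ ⟨v, hv, h⟩, ?_⟩
  rintro ⟨c, hc, h⟩ hQ
  apply h
  -- Every fraction g c of degree zero is a multiple of g v, with the factor c u of degree zero; so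
  -- the choice of the inverse v does not matter.
  have hcu : c * u ∈ f.awayPart 0 := awayPart_mul_mem hc hu (by abel)
  have : f.frac g c hc = f.frac g v hv * ⟨c * u, hcu⟩ := Subtype.ext (by
    change _ = algebraMap R _ g.val * v * (c * u)
    simp only [frac]
    linear_combination (-algebraMap R _ g.val * c) * huv)
  rw [this]
  exact Q.asIdeal.mul_mem_right _ hQ

end Units

section Graded

variable {A R : Type u} {M : Type*} [CommRing A] [CommRing R] [Algebra A R] [AddCommGroup M]
  [DecidableEq M] {𝒜 : M → Submodule A R} [GradedAlgebra 𝒜]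

/-- Taking the component of degree D in r = ∑ a_k η_k makes the coefficients a_k homogeneous. Each
summand a_k η_k c is then the product of a_k u_k c, of degree zero, and the fraction η_k v_k. This
transfers membership in a homogeneous ideal of R to the degree zero part of the localization. -/
lemma decompose_mul_mem_span_frac (f : HomogeneousElement 𝒜) {κ : Type*}
    (η : κ → HomogeneousElement 𝒜) {v : κ → Localization.Away f.val}
    (hv : ∀ k, v k ∈ f.awayPart (-(η k).deg)) {u : κ → Localization.Away f.val}
    (hu : ∀ k, u k ∈ f.awayPart (η k).deg) (huv : ∀ k, u k * v k = 1)
    {r : R} (hr : r ∈ Ideal.span (Set.range fun k ↦ (η k).val)) {D : M} (hrD : r ∈ 𝒜 D)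
    {c : Localization.Away f.val} (hc : c ∈ f.awayPart (-D))
    {y : f.degZero} (hy : y.1 = algebraMap R _ r * c) :
    y ∈ Ideal.span (Set.range fun k ↦ f.frac (η k) (v k) (hv k)) := by
  obtain ⟨a, rfl⟩ := Finsupp.mem_ideal_span_range_iff_exists_finsupp.mp hr
  have key : (a.sum fun k b ↦ b * (η k).val) =
      ∑ k ∈ a.support, (DirectSum.decompose 𝒜 (a k) (D - (η k).deg) : R) * (η k).val := by
    conv_lhs => rw [← DirectSum.decompose_of_mem_same 𝒜 hrD, Finsupp.sum, DirectSum.decompose_sum,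
      DFinsupp.finsetSum_apply, AddSubmonoidClass.coe_finsetSum]
    refine Finset.sum_congr rfl fun k _ ↦ ?_
    conv_lhs => rw [← sub_add_cancel D (η k).deg]
    exact DirectSum.coe_decompose_mul_add_of_right_mem 𝒜 (η k).mem
  have hmem (k : κ) : algebraMap R _ (DirectSum.decompose 𝒜 (a k) (D - (η k).deg) : R) * u k * c ∈
      f.awayPart 0 :=
    awayPart_mul_mem (awayPart_mul (f.awayPart_algebraMap (SetLike.coe_mem _)) (hu k)) hc (by abel)
  have : y = ∑ k ∈ a.support, ⟨_, hmem k⟩ * f.frac (η k) (v k) (hv k) := Subtype.ext (by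
    rw [hy, key, map_sum, Finset.sum_mul, AddSubmonoidClass.coe_finsetSum]
    refine Finset.sum_congr rfl fun k _ ↦ ?_
    change _ = algebraMap R _ _ * u k * c * (algebraMap R _ (η k).val * v k)
    rw [map_mul]
    linear_combination -(algebraMap R (Localization.Away f.val)
      (DirectSum.decompose 𝒜 (a k) (D - (η k).deg) : R) * algebraMap R _ (η k).val * c) * huv k)
  rw [this]
  exact Ideal.sum_mem _ fun k _ ↦ Ideal.mul_mem_left _ _ (Ideal.subset_span ⟨k, rfl⟩)

/-- If `f` lies in the radical of the ideal generated by the `g k`, then `Spec R[f⁻¹]₀` is covered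
by the open subsets `Spec R[(f * g k)⁻¹]₀`. -/
lemma exists_mem_range_specHom (f : HomogeneousElement 𝒜) {κ : Type*}
    (g : κ → HomogeneousElement 𝒜) (hu : ∀ k, f.HasHomogeneousUnit (g k).deg)
    (hf : f.val ∈ (Ideal.span (Set.range fun k ↦ (g k).val)).radical)
    (Q : PrimeSpectrum f.degZero) : ∃ k, Q ∈ Set.range (specHom (f.divides_mul (g k))) := by
  by_contra! H
  have H' : ∀ k (c : Localization.Away f.val) (hc : c ∈ f.awayPart (-(g k).deg)),
      f.frac (g k) c hc ∈ Q.asIdeal := by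
    intro k c hc
    by_contra h
    exact H k ((mem_range_specHom_iff (hu k) Q).mpr ⟨c, hc, h⟩)
  choose u hu v hv huv using hu
  obtain ⟨n, hn⟩ := hf
  obtain ⟨w, hw⟩ := (IsLocalization.Away.algebraMap_isUnit (S := Localization.Away f.val)
    f.val).pow n |>.exists_right_inv
  -- A power of f lies in the ideal of the g k; divided by itself it shows that 1 is a combination
  -- of fractions that all lie in Q.
  have h1 := decompose_mul_mem_span_frac f g hv hu huv hn (SetLike.pow_mem_graded n f.mem)
    (c := w) ⟨n, 1, by simpa using SetLike.one_mem_graded 𝒜, by rw [map_pow, mul_comm, hw, map_one]⟩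
    (y := 1) (by rw [map_pow, hw]; rfl)
  refine Q.2.ne_top ((Ideal.eq_top_iff_one _).mpr (Ideal.span_le.mpr ?_ h1))
  rintro _ ⟨k, rfl⟩
  exact H' k _ _

/-- A degree zero element of the extended ideal becomes, after clearing denominators, a homogeneous
element of the ideal generated by the η k in R, to which `decompose_mul_mem_span_frac` applies. -/
lemma degZeroIdeal_eq_span (f : HomogeneousElement 𝒜) {κ : Type*}
    (η : κ → HomogeneousElement 𝒜) {v : κ → Localization.Away f.val}
    (hv : ∀ k, v k ∈ f.awayPart (-(η k).deg)) {u : κ → Localization.Away f.val}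
    (hu : ∀ k, u k ∈ f.awayPart (η k).deg) (huv : ∀ k, u k * v k = 1) :
    f.degZeroIdeal (Set.range fun k ↦ (η k).val) =
      Ideal.span (Set.range fun k ↦ f.frac (η k) (v k) (hv k)) := by
  apply le_antisymm
  · intro y hy
    replace hy : y.1 ∈ Ideal.span (algebraMap R (Localization.Away f.val) ''
      (Set.range fun k ↦ (η k).val)) := hy
    rw [← Ideal.map_span, IsLocalization.mem_map_algebraMap_iff (Submonoid.powers f.val)] at hy
    obtain ⟨⟨⟨r, hr⟩, ⟨_, n, rfl⟩⟩, hn⟩ := hy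
    obtain ⟨k, h, hh, hk⟩ := y.2
    dsimp only at hn
    -- The numerator r lies in the ideal but need not be homogeneous, while h is homogeneous but
    -- need not lie in the ideal. Comparing both, h times a power of f has both properties.
    have e : algebraMap R (Localization.Away f.val) (h * f.val ^ n) = algebraMap R _ (r * f.val ^ k) := by
      rw [map_mul, map_mul, ← hn, ← hk]; ring
    obtain ⟨p, hp⟩ := IsLocalization.Away.exists_of_eq f.val e
    have hr' : h * f.val ^ (n + p) ∈ Ideal.span (Set.range fun k ↦ (η k).val) := by
      have : h * f.val ^ (n + p) = f.val ^ p * f.val ^ k * r := by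
        rw [pow_add]; linear_combination hp
      rw [this]
      exact Ideal.mul_mem_left _ _ hr
    obtain ⟨w, hw⟩ := (IsLocalization.Away.algebraMap_isUnit (S := Localization.Away f.val)
      f.val).pow (k + (n + p)) |>.exists_right_inv
    refine decompose_mul_mem_span_frac f η hv hu huv hr' (D := (k + (n + p)) • f.deg)
      (c := w) ?_ ⟨k + (n + p), 1, by simpa using SetLike.one_mem_graded 𝒜, ?_⟩ ?_
    · have := SetLike.mul_mem_graded hh (SetLike.pow_mem_graded (n + p) f.mem)
      rwa [zero_add, ← add_smul] at this
    · rw [map_pow, mul_comm, hw, map_one]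
    · rw [map_mul, ← hk, mul_assoc, mul_assoc, ← mul_assoc (algebraMap R _ _) _ w, ← map_mul,
        ← pow_add, map_pow, hw, mul_one]
  · rw [Ideal.span_le]
    rintro _ ⟨k, rfl⟩
    exact Ideal.mul_mem_right _ _ (Ideal.subset_span (Set.mem_image_of_mem _ (Set.mem_range_self k)))

/-- The generators from `degZeroIdeal_eq_span` are compatible with localization. This makes the
ideals of the center agree on overlaps. -/
lemma map_degZeroIdeal {f g : HomogeneousElement 𝒜} (h : f.Divides g) {κ : Type*}
    (η : κ → HomogeneousElement 𝒜) (hη : ∀ k, f.HasHomogeneousUnit (η k).deg) :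
    (f.degZeroIdeal (Set.range fun k ↦ (η k).val)).map (degZeroHom h).toRingHom =
      g.degZeroIdeal (Set.range fun k ↦ (η k).val) := by
  choose u hu v hv huv using hη
  rw [degZeroIdeal_eq_span f η hv hu huv, degZeroIdeal_eq_span g η
    (fun k ↦ awayHom_mem h (hv k)) (fun k ↦ awayHom_mem h (hu k))
    (fun k ↦ by rw [← map_mul, huv, map_one]), Ideal.map_span, ← Set.range_comp]
  congr 2
  ext1 k
  exact degZeroHom_frac h (η k) (hv k)

end Graded

/-! ### Homomorphisms of graded algebras and the induced maps of charts. -/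

section Map

variable {A R R' : Type u} {M M' : Type*} [CommRing A] [CommRing R] [Algebra A R] [AddCommGroup M]
  [CommRing R'] [Algebra A R'] [AddCommGroup M'] {𝒜 : M → Submodule A R} [SetLike.GradedMonoid 𝒜]
  {𝒜' : M' → Submodule A R'} [SetLike.GradedMonoid 𝒜']

variable (𝒜 𝒜') in
/-- A homomorphism of graded algebras, along a homomorphism of the grading groups. -/
structure GradedHom where
  toAlgHom : R' →ₐ[A] R
  deg : M' →+ M
  map_mem : ∀ d a, a ∈ 𝒜' d → toAlgHom a ∈ 𝒜 (deg d)

variable (ρ : GradedHom 𝒜 𝒜')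

/-- The image of a homogeneous element. -/
def GradedHom.map (f : HomogeneousElement 𝒜') : HomogeneousElement 𝒜 :=
  ⟨ρ.toAlgHom f.val, ρ.deg f.deg, ρ.map_mem _ _ f.mem⟩

variable {f : HomogeneousElement 𝒜'} {F : HomogeneousElement 𝒜}

/-- The homomorphism `R'[f⁻¹] → R[F⁻¹]` induced by a homomorphism `ρ` such that `ρ f` divides
`F`. -/
noncomputable def awayMap (h : (ρ.map f).Divides F) :
    Localization.Away f.val →ₐ[A] Localization.Away F.val :=
  IsLocalization.liftAlgHom (M := Submonoid.powers f.val)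
    (f := (IsScalarTower.toAlgHom A R (Localization.Away F.val)).comp ρ.toAlgHom) (by
      obtain ⟨c, hc, -⟩ := h
      rintro ⟨_, k, rfl⟩
      simp only [map_pow]
      exact (IsLocalization.Away.isUnit_of_dvd F.val ⟨c.val, hc⟩).pow k)

@[simp]
lemma awayMap_algebraMap (h : (ρ.map f).Divides F) (r : R') :
    awayMap ρ h (algebraMap R' _ r) = algebraMap R _ (ρ.toAlgHom r) := by
  simp [awayMap]

lemma awayMap_mem (h : (ρ.map f).Divides F) {d : M'} {x : Localization.Away f.val}
    (hx : x ∈ f.awayPart d) : awayMap ρ h x ∈ F.awayPart (ρ.deg d) := by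
  obtain ⟨k, a, ha, hx⟩ := hx
  obtain ⟨c, hc, hc'⟩ := id h
  refine ⟨k, ρ.toAlgHom a * c.val ^ k, ?_, ?_⟩
  · have := SetLike.mul_mem_graded (ρ.map_mem _ _ ha) (SetLike.pow_mem_graded k c.mem)
    rw [map_add, map_nsmul] at this
    rwa [hc', smul_add, ← add_assoc]
  · have := congrArg (awayMap ρ h) hx
    rw [map_mul, awayMap_algebraMap, awayMap_algebraMap] at this
    have e : F.val ^ k = ρ.toAlgHom (f.val ^ k) * c.val ^ k := by
      rw [hc, mul_pow, map_pow]; rfl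
    rw [e, map_mul, map_mul, ← this]
    ring

/-- The homomorphism `R'[f⁻¹]₀ → R[F⁻¹]₀` induced by a homomorphism `ρ` such that `ρ f` divides
`F`. -/
noncomputable def degZeroMap (h : (ρ.map f).Divides F) : f.degZero →ₐ[A] F.degZero :=
  ((awayMap ρ h).comp f.degZero.val).codRestrict F.degZero
    fun x ↦ by simpa using! awayMap_mem ρ h x.2

@[simp]
lemma degZeroMap_coe (h : (ρ.map f).Divides F) (x : f.degZero) :
    (degZeroMap ρ h x : Localization.Away F.val) = awayMap ρ h x := rfl

lemma degZeroHom_comp_degZeroMap {F' : HomogeneousElement 𝒜} (h : (ρ.map f).Divides F)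
    (h' : F.Divides F') :
    (degZeroHom h').comp (degZeroMap ρ h) = degZeroMap ρ (h.trans h') := by
  ext x
  have : ((awayHom h').restrictScalars A).comp (awayMap ρ h) = awayMap ρ (h.trans h') :=
    IsLocalization.algHom_ext (Submonoid.powers f.val) (by
      ext r
      change awayHom h' (awayMap ρ h (algebraMap _ _ r)) = awayMap ρ (h.trans h') (algebraMap _ _ r)
      simp)
  simpa using DFunLike.congr_fun this x.1

lemma degZeroMap_comp_degZeroHom {f' : HomogeneousElement 𝒜'} (h : f'.Divides f)
    (h' : (ρ.map f).Divides F) (h'' : (ρ.map f').Divides F) :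
    (degZeroMap ρ h').comp (degZeroHom h) = degZeroMap ρ h'' := by
  ext x
  have : (awayMap ρ h').comp ((awayHom h).restrictScalars A) = awayMap ρ h'' :=
    IsLocalization.algHom_ext (Submonoid.powers f'.val) (by
      ext r
      change awayMap ρ h' (awayHom h (algebraMap _ _ r)) = awayMap ρ h'' (algebraMap _ _ r)
      simp)
  simpa using DFunLike.congr_fun this x.1

lemma HasHomogeneousUnit.awayMap (h : (ρ.map f).Divides F) {d : M'} (hd : f.HasHomogeneousUnit d) :
    F.HasHomogeneousUnit (ρ.deg d) := by
  obtain ⟨u, hu, v, hv, huv⟩ := hd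
  exact ⟨_, awayMap_mem ρ h hu, _, by simpa using awayMap_mem ρ h hv, by
    rw [← map_mul, huv, map_one]⟩

/-- The morphism `Spec R[F⁻¹]₀ ⟶ Spec R'[f⁻¹]₀` induced by a homomorphism `ρ` such that `ρ f`
divides `F`. -/
noncomputable def specMap (h : (ρ.map f).Divides F) : Spec (.of F.degZero) ⟶ Spec (.of f.degZero) :=
  Spec.map (CommRingCat.ofHom (degZeroMap ρ h).toRingHom)

lemma specHom_comp_specMap {F' : HomogeneousElement 𝒜} (h : (ρ.map f).Divides F)
    (h' : F.Divides F') : specHom h' ≫ specMap ρ h = specMap ρ (h.trans h') := by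
  rw [specHom, specMap, specMap, ← Spec.map_comp, ← degZeroHom_comp_degZeroMap ρ h h']
  rfl

lemma specMap_comp_specHom {f' : HomogeneousElement 𝒜'} (h : f'.Divides f)
    (h' : (ρ.map f).Divides F) (h'' : (ρ.map f').Divides F) :
    specMap ρ h' ≫ specHom h = specMap ρ h'' := by
  rw [specHom, specMap, specMap, ← Spec.map_comp, ← degZeroMap_comp_degZeroHom ρ h h' h'']
  rfl

lemma specMap_comp_algebraMap (h : (ρ.map f).Divides F) :
    specMap ρ h ≫ Spec.map (CommRingCat.ofHom (algebraMap A f.degZero)) =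
      Spec.map (CommRingCat.ofHom (algebraMap A F.degZero)) := by
  rw [specMap, ← Spec.map_comp, ← CommRingCat.ofHom_comp]
  congr 2
  exact (degZeroMap ρ h).comp_algebraMap

end Map

end HomogeneousElement

end CoxModel

namespace CoxModel

/-! ### Gluing morphisms along charts. -/

section Cover

variable {X Z : Scheme.{u}} {ι : Type*} {U : ι → Scheme.{u}} (c : ∀ i, U i ⟶ X)
  [∀ i, IsOpenImmersion (c i)]

/-- The open cover of a scheme by a jointly surjective family of open immersions. -/
def openCoverOfCharts (hc : ∀ x : X, ∃ i, x ∈ Set.range (c i)) : X.OpenCover where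
  I₀ := ι
  X := U
  f := c
  mem₀ := by
    rw [Scheme.presieve₀_mem_precoverage_iff]
    exact ⟨hc, inferInstance⟩

lemma hom_ext_of_charts (hc : ∀ x : X, ∃ i, x ∈ Set.range (c i)) {h h' : X ⟶ Z} (H : ∀ i, c i ≫ h = c i ≫ h') : h = h' :=
  (openCoverOfCharts c hc).hom_ext _ _ H

lemma exists_desc_of_charts (hc : ∀ x : X, ∃ i, x ∈ Set.range (c i)) {V : ι → ι → Scheme.{u}} {v : ∀ i j, V i j ⟶ U i}
    {v' : ∀ i j, V i j ⟶ U j} (hv : ∀ i j, IsPullback (v i j) (v' i j) (c i) (c j))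
    (k : ∀ i, U i ⟶ Z) (hk : ∀ i j, v i j ≫ k i = v' i j ≫ k j) :
    ∃ h : X ⟶ Z, ∀ i, c i ≫ h = k i := by
  have H (i j : ι) : pullback.fst (c i) (c j) ≫ k i = pullback.snd (c i) (c j) ≫ k j := by
    rw [← (hv i j).isoPullback_inv_fst, ← (hv i j).isoPullback_inv_snd, Category.assoc,
      Category.assoc, hk]
  exact ⟨(openCoverOfCharts c hc).glueMorphisms k H,
    fun i ↦ (openCoverOfCharts c hc).ι_glueMorphisms k H i⟩

end Cover

namespace HomogeneousElement

/-! ### Charts of the glued schemes and morphisms between glued schemes. -/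

section Charts

variable {A R : Type u} {M : Type*} [CommRing A] [CommRing R] [Algebra A R] [AddCommGroup M]
  {𝒜 : M → Submodule A R} [SetLike.GradedMonoid 𝒜] {ι : Type} {f : ι → HomogeneousElement 𝒜}
  (hf : HasUnits f)

instance (i : ι) : IsOpenImmersion (chart f hf i) :=
  Scheme.GlueData.ι_isOpenImmersion (glueData f hf) ⟨i⟩

lemma exists_chart_eq (x : glued f hf) : ∃ i, x ∈ Set.range (chart f hf i) := by
  obtain ⟨⟨i⟩, y, rfl⟩ := (glueData f hf).ι_jointly_surjective x
  exact ⟨i, y, rfl⟩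

lemma isPullback_chart (i j : ι) :
    IsPullback (specHom ((f i).divides_mul (f j)))
      (specHom (((f j).divides_mul (f i)).trans (mul_divides_swap (f j) (f i))))
      (chart f hf i) (chart f hf j) := by
  have h := IsPullback.of_isLimit ((glueData f hf).vPullbackConeIsLimit ⟨i⟩ ⟨j⟩)
  refine .of_iso h (Iso.refl _) (Iso.refl _) (Iso.refl _) (Iso.refl _) ?_ ?_ ?_ ?_
  · exact (Category.comp_id _).trans (Category.id_comp _).symm
  · refine (Category.comp_id _).trans (.trans ?_ (Category.id_comp _).symm)
    exact specHom_comp ((f j).divides_mul (f i)) (mul_divides_swap (f j) (f i))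
  · exact (Category.comp_id _).trans (Category.id_comp _).symm
  · exact (Category.comp_id _).trans (Category.id_comp _).symm

lemma glued_hom_ext {Z : Scheme.{u}} {h h' : glued f hf ⟶ Z}
    (H : ∀ i, chart f hf i ≫ h = chart f hf i ≫ h') : h = h' :=
  hom_ext_of_charts _ (exists_chart_eq hf) H

lemma exists_glued_desc {Z : Scheme.{u}} (k : ∀ i, Spec (.of (f i).degZero) ⟶ Z)
    (hk : ∀ i j, specHom ((f i).divides_mul (f j)) ≫ k i =
      specHom (((f j).divides_mul (f i)).trans (mul_divides_swap (f j) (f i))) ≫ k j) :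
    ∃ h : glued f hf ⟶ Z, ∀ i, chart f hf i ≫ h = k i :=
  exists_desc_of_charts _ (exists_chart_eq hf) (isPullback_chart hf) k hk

lemma chart_mem_range_chart_iff (i j : ι) (Q : Spec (.of (f i).degZero)) :
    chart f hf i Q ∈ Set.range (chart f hf j) ↔
      Q ∈ Set.range (specHom ((f i).divides_mul (f j))) := by
  constructor
  · rintro ⟨P, hP⟩
    obtain ⟨W, rfl, -⟩ := Scheme.exists_preimage_of_isPullback (isPullback_chart hf i j)
      Q P hP.symm
    exact ⟨W, rfl⟩
  · rintro ⟨W, rfl⟩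
    refine ⟨specHom (((f j).divides_mul (f i)).trans (mul_divides_swap (f j) (f i))) W, ?_⟩
    rw [← Scheme.Hom.comp_apply, ← Scheme.Hom.comp_apply, (isPullback_chart hf i j).w]

/-- Leaving out superfluous charts does not change the glued scheme. -/
lemma exists_iso_glued {κ : Type} {h : κ → HomogeneousElement 𝒜} (hh : HasUnits h) (e : ι → κ)
    (he : HasUnits fun i ↦ h (e i)) (cov : ∀ k (Q : Spec (.of (h k).degZero)), ∃ i,
      Q ∈ Set.range (specHom ((h k).divides_mul (h (e i))))) :
    ∃ φ : glued (fun i ↦ h (e i)) he ≅ glued h hh,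
      ∀ i, chart _ he i ≫ φ.hom = chart h hh (e i) := by
  obtain ⟨φ, hφ⟩ := exists_glued_desc he (fun i ↦ chart h hh (e i))
    fun i j ↦ (isPullback_chart hh (e i) (e j)).w
  have hsurj (x : glued h hh) : ∃ i, x ∈ Set.range (chart h hh (e i)) := by
    obtain ⟨k, Q, rfl⟩ := exists_chart_eq hh x
    obtain ⟨i, hi⟩ := cov k Q
    exact ⟨i, (chart_mem_range_chart_iff hh _ _ Q).mpr hi⟩
  obtain ⟨ψ, hψ⟩ := exists_desc_of_charts _ hsurj (fun i j ↦ isPullback_chart hh (e i) (e j))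
    (chart _ he) fun i j ↦ (isPullback_chart he i j).w
  refine ⟨⟨φ, ψ, glued_hom_ext he fun i ↦ ?_, hom_ext_of_charts _ hsurj fun i ↦ ?_⟩, hφ⟩
  · rw [← Category.assoc, hφ, hψ, Category.comp_id]
  · rw [← Category.assoc, hψ, hφ, Category.comp_id]

end Charts

section Map

variable {A R R' : Type u} {M M' : Type*} [CommRing A] [CommRing R] [Algebra A R] [AddCommGroup M]
  [CommRing R'] [Algebra A R'] [AddCommGroup M'] {𝒜 : M → Submodule A R} [SetLike.GradedMonoid 𝒜]
  {𝒜' : M' → Submodule A R'} [SetLike.GradedMonoid 𝒜'] (ρ : GradedHom 𝒜 𝒜')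
  {ι κ : Type} {f : ι → HomogeneousElement 𝒜'} (hf : HasUnits f) {F : κ → HomogeneousElement 𝒜}
  (hF : HasUnits F)

lemma map_mul_divides_mul {f g : HomogeneousElement 𝒜'} {F G : HomogeneousElement 𝒜}
    (h : (ρ.map f).Divides F) (h' : (ρ.map g).Divides G) : (ρ.map (f.mul g)).Divides (F.mul G) := by
  obtain ⟨c, hc, hc'⟩ := h
  obtain ⟨d, hd, hd'⟩ := h'
  refine ⟨c.mul d, ?_, ?_⟩
  · simp only [GradedHom.map, mul, map_mul] at *
    rw [hc, hd]
    ring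
  · simp only [GradedHom.map, mul, map_add] at *
    rw [hc', hd']
    abel

/-- A homomorphism of graded algebras induces a morphism of glued schemes. -/
lemma exists_gluedMap (p : κ → ι) (hp : ∀ k, (ρ.map (f (p k))).Divides (F k)) :
    ∃ β : glued F hF ⟶ glued f hf, β ≫ toBase f hf = toBase F hF ∧
      ∀ k, chart F hF k ≫ β = specMap ρ (hp k) ≫ chart f hf (p k) := by
  obtain ⟨β, hβ⟩ := exists_glued_desc hF (fun k ↦ specMap ρ (hp k) ≫ chart f hf (p k)) (by
    intro k l
    rw [← Category.assoc, ← Category.assoc, specHom_comp_specMap, specHom_comp_specMap,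
      ← specMap_comp_specHom ρ ((f (p k)).divides_mul (f (p l)))
        (map_mul_divides_mul ρ (hp k) (hp l)),
      ← specMap_comp_specHom ρ (((f (p l)).divides_mul (f (p k))).trans
        (mul_divides_swap (f (p l)) (f (p k)))) (map_mul_divides_mul ρ (hp k) (hp l)),
      Category.assoc, Category.assoc, (isPullback_chart hf (p k) (p l)).w])
  refine ⟨β, glued_hom_ext hF fun k ↦ ?_, hβ⟩
  rw [← Category.assoc, hβ, Category.assoc, chart_toBase, chart_toBase, specMap_comp_algebraMap]

end Map

end HomogeneousElement

end CoxModel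

namespace CoxModel

/-! ### Ideal sheaves on affine schemes. -/

section SpecIdeal

/-- Ideals of `B` correspond to ideal sheaves on `Spec B`. -/
noncomputable def specIdeal (B : CommRingCat.{u}) : Ideal B ≃o (Spec B).IdealSheafData :=
  (Scheme.ΓSpecIso B).commRingCatIsoToRingEquiv.idealComapOrderIso.trans
    Scheme.IdealSheafData.equivOfIsAffine.symm.toOrderIso

lemma specIdeal_apply {B : CommRingCat.{u}} (J : Ideal B) :
    specIdeal B J = .ofIdealTop (J.comap (Scheme.ΓSpecIso B).hom.hom) := rfl

lemma ker_specMap {B C : CommRingCat.{u}} (ψ : B ⟶ C) :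
    (Spec.map ψ).ker = specIdeal B (RingHom.ker ψ.hom) := by
  rw [Scheme.ker_of_isAffine, specIdeal_apply]
  congr 1
  have h : RingHom.ker (Scheme.ΓSpecIso C).hom.hom = ⊥ :=
    RingHom.ker_coe_equiv (Scheme.ΓSpecIso C).commRingCatIsoToRingEquiv
  rw [RingHom.comap_ker, ← CommRingCat.hom_comp, ← Scheme.ΓSpecIso_naturality,
    CommRingCat.hom_comp, ← RingHom.comap_ker, h, RingHom.ker_eq_comap_bot]

lemma ker_specMap_quotient {B : Type u} [CommRing B] (J : Ideal B) :
    (Spec.map (CommRingCat.ofHom (S := B ⧸ J) (Ideal.Quotient.mk J))).ker =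
      specIdeal (.of B) J := by
  rw [ker_specMap]
  exact congrArg _ Ideal.mk_ker

lemma specIdeal_map {B C : CommRingCat.{u}} (ψ : B ⟶ C) (L : Ideal C) :
    (specIdeal C L).map (Spec.map ψ) = specIdeal B (L.comap ψ.hom) := by
  rw [← ker_specMap_quotient, Scheme.IdealSheafData.map_ker]
  change (Spec.map (CommRingCat.ofHom (Ideal.Quotient.mk L)) ≫ Spec.map ψ).ker = _
  rw [← Spec.map_comp, ker_specMap, CommRingCat.hom_comp, ← RingHom.comap_ker]
  congr 2
  exact Ideal.mk_ker

/-- Pull-back of ideal sheaves is left adjoint to direct image, and extension of ideals is left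
adjoint to contraction; so the claim follows from `specIdeal_map`. -/
lemma specIdeal_comap {B C : CommRingCat.{u}} (ψ : B ⟶ C) (J : Ideal B) :
    (specIdeal B J).comap (Spec.map ψ) = specIdeal C (J.map ψ.hom) := by
  obtain ⟨L, hL⟩ := (specIdeal C).surjective ((specIdeal B J).comap (Spec.map ψ))
  have key (L' : Ideal C) : (specIdeal B J).comap (Spec.map ψ) ≤ specIdeal C L' ↔
      J.map ψ.hom ≤ L' := by
    rw [← Scheme.IdealSheafData.le_map_iff_comap_le, specIdeal_map, (specIdeal B).le_iff_le,
      Ideal.map_le_iff_le_comap]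
  rw [← hL] at key ⊢
  simp only [(specIdeal C).le_iff_le] at key
  exact congrArg _ (le_antisymm ((key _).mpr le_rfl) ((key _).mp le_rfl))

/-- Translates the condition on affine open subsets in `IsEffectiveCartier` to open immersions of
spectra, where it can be handled by ring theory. -/
lemma exists_comap_eq_span_iff {T : Scheme.{u}} {C : CommRingCat.{u}} (q : Spec C ⟶ T)
    [IsOpenImmersion q] (K : T.IdealSheafData) :
    (∃ c ∈ nonZeroDivisors C, K.comap q = specIdeal C (Ideal.span {c})) ↔
      ∃ t ∈ nonZeroDivisors Γ(T, q ''ᵁ ⊤),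
        K.ideal ⟨q ''ᵁ ⊤, (isAffineOpen_top _).image_of_isOpenImmersion q⟩ = Ideal.span {t} := by
  let e : Γ(T, q ''ᵁ ⊤) ≃+* C := (q.appIso ⊤ ≪≫ Scheme.ΓSpecIso C).commRingCatIsoToRingEquiv
  have hK : K.comap q = specIdeal C
      ((K.ideal ⟨q ''ᵁ ⊤, (isAffineOpen_top _).image_of_isOpenImmersion q⟩).comap e.symm) := by
    apply (Scheme.IdealSheafData.equivOfIsAffine (X := Spec C)).injective
    change (K.comap q).ideal ⟨⊤, isAffineOpen_top _⟩ = _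
    rw [Scheme.IdealSheafData.ideal_comap_of_isOpenImmersion]
    change _ = Scheme.IdealSheafData.equivOfIsAffine (Scheme.IdealSheafData.equivOfIsAffine.symm _)
    rw [OrderRingIso.apply_symm_apply]
    change _ = Ideal.comap (Scheme.ΓSpecIso C).commRingCatIsoToRingEquiv (Ideal.comap e.symm _)
    refine Ideal.ext fun y ↦ ?_
    have hy : e.symm ((Scheme.ΓSpecIso C).hom y) = (q.appIso ⊤).inv y := by
      change (q.appIso ⊤).inv ((Scheme.ΓSpecIso C).inv ((Scheme.ΓSpecIso C).hom y)) = _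
      simp
    change _ ↔ e.symm ((Scheme.ΓSpecIso C).hom y) ∈ K.ideal ⟨q ''ᵁ ⊤, _⟩
    rw [hy]
    rfl
  constructor
  · rintro ⟨c, hc, h⟩
    rw [hK, (specIdeal C).apply_eq_iff_eq] at h
    refine ⟨e.symm c, ?_, ?_⟩
    · exact (MulEquivClass.map_nonZeroDivisors e.symm) ▸ ⟨c, hc, rfl⟩
    · rw [Ideal.comap_symm] at h
      have := congrArg (Ideal.comap e) h
      rw [Ideal.comap_map_of_bijective _ e.bijective] at this
      rw [this, ← Ideal.map_symm, Ideal.map_span, Set.image_singleton]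
  · rintro ⟨t, ht, h⟩
    refine ⟨e t, ?_, ?_⟩
    · exact (MulEquivClass.map_nonZeroDivisors e) ▸ ⟨t, ht, rfl⟩
    · rw [hK, h, Ideal.comap_symm, Ideal.map_span, Set.image_singleton]

end SpecIdeal

/-! ### Effective Cartier divisors. -/

section Cartier

variable {T : Scheme.{u}} {K : T.IdealSheafData}

lemma isEffectiveCartier_of_charts
    (h : ∀ x : T, ∃ (C : CommRingCat.{u}) (q : Spec C ⟶ T) (_ : IsOpenImmersion q),
      x ∈ Set.range q ∧ ∃ c ∈ nonZeroDivisors C, K.comap q = specIdeal C (Ideal.span {c})) :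
    IsEffectiveCartier K := by
  intro x
  obtain ⟨C, q, _, hx, hc⟩ := h x
  obtain ⟨t, ht, h⟩ := (exists_comap_eq_span_iff q K).mp hc
  refine ⟨⟨q ''ᵁ ⊤, (isAffineOpen_top _).image_of_isOpenImmersion q⟩, ?_, t, ht, h⟩
  obtain ⟨y, rfl⟩ := hx
  exact ⟨y, trivial, rfl⟩

/-- The chart may be shrunk to a basic open subset inside O, since nonzerodivisors stay
nonzerodivisors in localizations. -/
lemma IsEffectiveCartier.exists_chart (hK : IsEffectiveCartier K) (x : T) (O : T.Opens)
    (hx : x ∈ O) :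
    ∃ (C : CommRingCat.{u}) (q : Spec C ⟶ T) (_ : IsOpenImmersion q), x ∈ Set.range q ∧
      Set.range q ⊆ O ∧ ∃ c ∈ nonZeroDivisors C, K.comap q = specIdeal C (Ideal.span {c}) := by
  obtain ⟨U, hxU, t, ht, hU⟩ := hK x
  obtain ⟨s, hsO, hxs⟩ := U.2.exists_basicOpen_le ⟨x, hx⟩ hxU
  have hD : IsAffineOpen (T.basicOpen s) := U.2.basicOpen s
  have := U.2.isLocalization_basicOpen s
  have hloc : ∃ t ∈ nonZeroDivisors Γ(T, T.basicOpen s),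
      K.ideal ⟨T.basicOpen s, hD⟩ = Ideal.span {t} := by
    refine ⟨algebraMap Γ(T, U) _ t, IsLocalization.map_nonZeroDivisors_le (Submonoid.powers s) _
      ⟨t, ht, rfl⟩, ?_⟩
    have := K.map_ideal_basicOpen U s
    rw [hU, Ideal.map_span, Set.image_singleton] at this
    exact this.symm
  -- Stated for every V equal to the basic open subset, since the image of the chart is only
  -- propositionally equal to it.
  have hgen : ∀ V : T.affineOpens, V.1 = T.basicOpen s → ∃ t ∈ nonZeroDivisors Γ(T, V),
      K.ideal V = Ideal.span {t} := by
    rintro ⟨V, hV⟩ rfl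
    exact hloc
  refine ⟨Γ(T, T.basicOpen s), hD.fromSpec, inferInstance, ?_, ?_, ?_⟩
  · rw [hD.range_fromSpec]; exact hxs
  · rw [hD.range_fromSpec]; exact hsO
  · rw [exists_comap_eq_span_iff]
    exact hgen ⟨_, _⟩ ((Scheme.Hom.image_top_eq_opensRange _).trans hD.opensRange_fromSpec)

lemma IsEffectiveCartier.comap (hK : IsEffectiveCartier K) {T' : Scheme.{u}} (w : T' ⟶ T)
    [IsOpenImmersion w] : IsEffectiveCartier (K.comap w) := by
  apply isEffectiveCartier_of_charts
  intro x
  obtain ⟨C, q, _, ⟨y, hy⟩, hq, hc⟩ := hK.exists_chart (w x) w.opensRange ⟨x, rfl⟩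
  have hfac := IsOpenImmersion.lift_fac w q hq
  have : IsOpenImmersion (IsOpenImmersion.lift w q hq ≫ w) := by rw [hfac]; infer_instance
  have := IsOpenImmersion.of_comp (IsOpenImmersion.lift w q hq) w
  refine ⟨C, _, this, ⟨y, ?_⟩, ?_⟩
  · apply w.isOpenEmbedding.injective
    rw [← Scheme.Hom.comp_apply, hfac, hy]
  · rwa [← Scheme.IdealSheafData.comap_comp, hfac]

lemma isEffectiveCartier_top : IsEffectiveCartier (⊤ : T.IdealSheafData) := by
  intro x
  obtain ⟨U, hU, hx, -⟩ := exists_isAffineOpen_mem_and_subset (TopologicalSpace.Opens.mem_top x)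
  exact ⟨⟨U, hU⟩, hx, 1, one_mem _, by simp⟩

lemma IsBlowup.iso_comp {X Y Y' : Scheme.{u}} {β : Y ⟶ X} {I : X.IdealSheafData}
    (h : IsBlowup β I) (e : Y' ≅ Y) : IsBlowup (e.hom ≫ β) I where
  isEffectiveCartier := by
    rw [Scheme.IdealSheafData.comap_comp]
    exact h.isEffectiveCartier.comap _
  existsUnique_lift T g hg := by
    obtain ⟨k, hk, huniq⟩ := h.existsUnique_lift T g hg
    refine ⟨k ≫ e.inv, by simpa using hk, fun k' hk' ↦ ?_⟩
    rw [← huniq (k' ≫ e.hom) (by simpa using hk')]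
    simp

end Cartier

/-! ### Gluing ideal sheaves. -/

section GlueIdeals

variable {X : Scheme.{u}}

/-- The direct image of I is the kernel of the composition of c' with the inclusion of the closed
subscheme of I. Kernels of quasi-compact morphisms commute with restriction to open subschemes, and
the two pull-back squares paste. -/
lemma comap_map_of_isPullback {V U U' : Scheme.{u}} {v : V ⟶ U} {v' : V ⟶ U'} {c : U ⟶ X}
    {c' : U' ⟶ X} (h : IsPullback v v' c c') [IsOpenImmersion c] [QuasiCompact c']
    (I : U'.IdealSheafData) : (I.map c').comap c = (I.comap v').map v := by
  have h' : IsPullback (pullback.fst v' I.subschemeι ≫ v) (pullback.snd v' I.subschemeι) c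
      (I.subschemeι ≫ c') :=
    ((IsPullback.of_hasPullback v' I.subschemeι).flip.paste_vert h.flip).flip
  rw [Scheme.IdealSheafData.comap.eq_def I v', Scheme.IdealSheafData.map_ker]
  ext W : 2
  rw [Scheme.IdealSheafData.ideal_comap_of_isOpenImmersion]
  exact (Scheme.ker_ideal_of_isPullback_of_isOpenImmersion _ _ _ _ h' W).symm

lemma comap_iInf_of_isOpenImmersion {U : Scheme.{u}} (c : U ⟶ X) [IsOpenImmersion c] {ι : Type*}
    [Finite ι] (I : ι → X.IdealSheafData) : (⨅ i, I i).comap c = ⨅ i, (I i).comap c := by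
  ext W : 2
  rw [Scheme.IdealSheafData.ideal_comap_of_isOpenImmersion, Scheme.IdealSheafData.ideal_iInf,
    Scheme.IdealSheafData.ideal_iInf, iInf_apply, iInf_apply, Ideal.comap_iInf]
  simp only [Scheme.IdealSheafData.ideal_comap_of_isOpenImmersion]

/-- Ideal sheaves on the members of a finite open cover that agree on the overlaps glue. -/
lemma exists_idealSheaf_of_charts {ι : Type*} [Finite ι] {U : ι → Scheme.{u}} {c : ∀ i, U i ⟶ X}
    [∀ i, IsOpenImmersion (c i)] [∀ i, QuasiCompact (c i)] {V : ι → ι → Scheme.{u}}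
    {v : ∀ i j, V i j ⟶ U i} {v' : ∀ i j, V i j ⟶ U j}
    (hv : ∀ i j, IsPullback (v i j) (v' i j) (c i) (c j)) (I : ∀ i, (U i).IdealSheafData)
    (hI : ∀ i j, (I i).comap (v i j) = (I j).comap (v' i j)) :
    ∃ K : X.IdealSheafData, ∀ i, K.comap (c i) = I i := by
  -- The glued sheaf is the intersection of the direct images. On chart i, the i-th term already
  -- restricts into I i, and by base change and agreement on the overlaps every other term contains
  -- I i.
  refine ⟨⨅ j, (I j).map (c j), fun i ↦ ?_⟩
  rw [comap_iInf_of_isOpenImmersion]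
  apply le_antisymm
  · exact (iInf_le _ i).trans (Scheme.IdealSheafData.comap_map_le _ _)
  · refine le_iInf fun j ↦ ?_
    rw [comap_map_of_isPullback (hv i j), ← hI]
    exact Scheme.IdealSheafData.le_map_comap _ _

/-- Quasi-compactness is local on the target, and the preimage of a chart is an overlap, which is
affine. -/
lemma quasiCompact_of_charts {ι : Type*} {U : ι → Scheme.{u}} {c : ∀ i, U i ⟶ X}
    [∀ i, IsOpenImmersion (c i)] [∀ i, IsAffine (U i)] (hc : ∀ x : X, ∃ i, x ∈ Set.range (c i))
    {V : ι → ι → Scheme.{u}} (hV : ∀ i j, IsAffine (V i j))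
    {v : ∀ i j, V i j ⟶ U i} {v' : ∀ i j, V i j ⟶ U j}
    (hv : ∀ i j, IsPullback (v i j) (v' i j) (c i) (c j)) (i : ι) : QuasiCompact (c i) := by
  refine @IsZariskiLocalAtTarget.of_openCover @QuasiCompact.{u}
    (@HasAffineProperty.instIsZariskiLocalAtTarget _ _
      instHasAffinePropertyQuasiCompactCompactSpaceCarrierCarrierCommRingCat) _ _ _
    (openCoverOfCharts c hc) fun (j : ι) ↦ ?_
  change QuasiCompact (pullback.snd (c i) (c j))
  have := hV i j
  have : IsAffine (pullback (c i) (c j)) := .of_isIso (hv i j).isoPullback.inv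
  infer_instance

end GlueIdeals

end CoxModel

namespace CoxModel

/-! ### The universal property of an affine chart of a blowing-up. -/

section BlowupChart

variable {B C D : Type*} [CommRing B] [CommRing C] [CommRing D]

/-- `φ : B → C` is the chart of the blowing-up of `Spec B` with center `J` on which the generator
`x` of `J` generates the inverse image of `J`. -/
structure IsBlowupChart (φ : B →+* C) (J : Ideal B) (x : B) : Prop where
  injective : Function.Injective φ
  mem : x ∈ J
  mem_nonZeroDivisors : φ x ∈ nonZeroDivisors C
  dvd : ∀ b ∈ J, φ x ∣ φ b
  exists_pow : ∀ c, ∃ n, ∃ b ∈ J ^ n, φ b = φ x ^ n * c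

variable {φ : B →+* C} {J : Ideal B} {x : B}

lemma IsBlowupChart.map_eq (h : IsBlowupChart φ J x) : J.map φ = Ideal.span {φ x} := by
  apply le_antisymm
  · exact Ideal.map_le_iff_le_comap.mpr fun b hb ↦ Ideal.mem_span_singleton.mpr (h.dvd b hb)
  · rw [Ideal.span_singleton_le_iff_mem]
    exact Ideal.mem_map_of_mem φ h.mem

lemma pow_dvd_of_mem_pow {ψ : B →+* D} (hψ : ∀ b ∈ J, ψ x ∣ ψ b) {n : ℕ} {b : B}
    (hb : b ∈ J ^ n) : ψ x ^ n ∣ ψ b := by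
  have h : J.map ψ ≤ Ideal.span {ψ x} :=
    Ideal.map_le_iff_le_comap.mpr fun b hb ↦ Ideal.mem_span_singleton.mpr (hψ b hb)
  have h' := Ideal.mem_map_of_mem ψ hb
  rw [Ideal.map_pow] at h'
  have := Ideal.pow_right_mono h n h'
  rwa [Ideal.span_singleton_pow, Ideal.mem_span_singleton] at this

/-- Every c is of the form b / x ^ n with b from B, and the image of x is a nonzerodivisor, so the
image of c is determined by that of B. -/
lemma IsBlowupChart.hom_ext (h : IsBlowupChart φ J x) {χ χ' : C →+* D}
    (hx : χ (φ x) ∈ nonZeroDivisors D) (e : χ.comp φ = χ'.comp φ) : χ = χ' := by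
  ext c
  obtain ⟨n, b, -, hb⟩ := h.exists_pow c
  have e' (b : B) : χ (φ b) = χ' (φ b) := RingHom.congr_fun e b
  have h1 := e' b
  rw [hb, map_mul, map_mul, map_pow, map_pow, ← e' x] at h1
  exact (mul_cancel_left_mem_nonZeroDivisors (pow_mem hx n)).mp h1

/-- An element b / x ^ n with b in J ^ n must go to ψ b / ψ x ^ n, and this quotient exists because
ψ x divides the image of J. The relation `r` is the graph of the map to be constructed; its
compatibility with sums and products gives a ring homomorphism. -/
lemma IsBlowupChart.exists_lift (h : IsBlowupChart φ J x) {ψ : B →+* D}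
    (hx : ψ x ∈ nonZeroDivisors D) (hψ : ∀ b ∈ J, ψ x ∣ ψ b) : ∃ χ : C →+* D, χ.comp φ = ψ := by
  let r (c : C) (d : D) : Prop := ∃ n, ∃ b ∈ J ^ n, φ b = φ x ^ n * c ∧ ψ b = ψ x ^ n * d
  have hex (c : C) : ∃ d, r c d := by
    obtain ⟨n, b, hb, e⟩ := h.exists_pow c
    obtain ⟨d, hd⟩ := pow_dvd_of_mem_pow hψ hb
    exact ⟨d, n, b, hb, e, hd⟩
  have huniq {c : C} {d d' : D} (hd : r c d) (hd' : r c d') : d = d' := by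
    obtain ⟨n, b, -, e, e'⟩ := hd
    obtain ⟨n', b', -, e₁, e₁'⟩ := hd'
    -- Two representations of the same c are compared in B, which is where injectivity of φ is
    -- needed.
    have hbb : b * x ^ n' = b' * x ^ n := h.injective (by
      rw [map_mul, map_mul, e, e₁, map_pow, map_pow]; ring)
    have := congrArg ψ hbb
    rw [map_mul, map_mul, e', e₁', map_pow, map_pow] at this
    refine (mul_cancel_left_mem_nonZeroDivisors (pow_mem hx (n + n'))).mp ?_
    rw [pow_add]
    linear_combination this
  have hmul {c c' : C} {d d' : D} (hd : r c d) (hd' : r c' d') : r (c * c') (d * d') := by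
    obtain ⟨n, b, hb, e, e'⟩ := hd
    obtain ⟨n', b', hb', e₁, e₁'⟩ := hd'
    refine ⟨n + n', b * b', ?_, ?_, ?_⟩
    · rw [pow_add]; exact Ideal.mul_mem_mul hb hb'
    · rw [map_mul, e, e₁]; ring
    · rw [map_mul, e', e₁']; ring
  have hadd {c c' : C} {d d' : D} (hd : r c d) (hd' : r c' d') : r (c + c') (d + d') := by
    obtain ⟨n, b, hb, e, e'⟩ := hd
    obtain ⟨n', b', hb', e₁, e₁'⟩ := hd'
    refine ⟨n + n', b * x ^ n' + x ^ n * b', ?_, ?_, ?_⟩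
    · rw [pow_add]
      exact Ideal.add_mem _ (Ideal.mul_mem_mul hb (Ideal.pow_mem_pow h.mem _))
        (Ideal.mul_mem_mul (Ideal.pow_mem_pow h.mem _) hb')
    · rw [map_add, map_mul, map_mul, e, e₁, map_pow, map_pow]; ring
    · rw [map_add, map_mul, map_mul, e', e₁', map_pow, map_pow]; ring
  have hφ (b : B) : r (φ b) (ψ b) := ⟨0, b, by simp, by simp, by simp⟩
  choose χ hχ using hex
  refine ⟨⟨⟨⟨χ, ?_⟩, ?_⟩, ?_, ?_⟩, ?_⟩
  · exact huniq (hχ 1) (by simpa using hφ 1)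
  · exact fun c c' ↦ huniq (hχ _) (hmul (hχ c) (hχ c'))
  · exact huniq (hχ 0) (by simpa using hφ 0)
  · exact fun c c' ↦ huniq (hχ _) (hadd (hχ c) (hχ c'))
  · exact RingHom.ext fun b ↦ huniq (hχ _) (hφ b)

end BlowupChart

/-! ### Recognizing a blowing-up by its charts. -/

section Criterion

lemma exists_spec_lift {B D : CommRingCat.{u}} {X : Scheme.{u}} (w : Spec B ⟶ X)
    [IsOpenImmersion w] (q : Spec D ⟶ X) (h : Set.range q ⊆ Set.range w) :
    ∃ ψ : B ⟶ D, Spec.map ψ ≫ w = q :=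
  ⟨Spec.preimage (IsOpenImmersion.lift w q h), by
    rw [Spec.map_preimage, IsOpenImmersion.lift_fac]⟩

lemma comp_eq_of_specMap_comp_eq {B D : CommRingCat.{u}} {X : Scheme.{u}} {w : Spec B ⟶ X}
    [Mono w] {ψ ψ' : B ⟶ D} (h : Spec.map ψ ≫ w = Spec.map ψ' ≫ w) : ψ = ψ' :=
  Spec.map_injective ((cancel_mono w).mp h)

lemma exists_away_of_mem {D : CommRingCat.{u}} (O : (Spec D).Opens) {P : Spec D} (hP : P ∈ O) :
    ∃ d : D, d ∉ P.asIdeal ∧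
      Set.range (Spec.map (CommRingCat.ofHom (algebraMap D (Localization.Away d)))) ⊆ O := by
  obtain ⟨_, ⟨d, rfl⟩, hd, hdO⟩ :=
    PrimeSpectrum.isTopologicalBasis_basic_opens.exists_subset_of_mem_open hP O.2
  refine ⟨d, hd, ?_⟩
  rintro _ ⟨P', rfl⟩
  apply hdO
  have := PrimeSpectrum.localization_away_comap_range (Localization.Away d) d
  exact this.le ⟨P', rfl⟩

lemma mem_range_away {D : CommRingCat.{u}} {P : Spec D} {d : D} (hd : d ∉ P.asIdeal) :
    P ∈ Set.range (Spec.map (CommRingCat.ofHom (algebraMap D (Localization.Away d)))) := by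
  have := PrimeSpectrum.localization_away_comap_range (Localization.Away d) d
  exact this.ge hd

variable {X Y : Scheme.{u}} {β : Y ⟶ X} {I : X.IdealSheafData} {ι τ : Type*}
  {B : ι → CommRingCat.{u}} {C : ι → τ → CommRingCat.{u}}
  {w : ∀ i, Spec (B i) ⟶ X} [∀ i, IsOpenImmersion (w i)]
  {v : ∀ i t, Spec (C i t) ⟶ Y} [∀ i t, IsOpenImmersion (v i t)]
  {φ : ∀ i t, B i ⟶ C i t} {J : ∀ i, Ideal (B i)} {x : ∀ i, τ → B i}

/-- A criterion for a morphism to be a blowing-up in terms of affine charts. -/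
theorem isBlowup_of_charts
    (hw : ∀ y : X, ∃ i, y ∈ Set.range (w i)) (hv : ∀ y : Y, ∃ i t, y ∈ Set.range (v i t))
    (hφ : ∀ i t, v i t ≫ β = Spec.map (φ i t) ≫ w i)
    (hI : ∀ i, I.comap (w i) = specIdeal (B i) (J i))
    (hJ : ∀ i, J i = Ideal.span (Set.range (x i)))
    (hchart : ∀ i t, IsBlowupChart (φ i t).hom (J i) (x i t))
    (H₁ : ∀ i t i' (Q : Spec (C i t)), β (v i t Q) ∈ Set.range (w i') →
      ∃ t', v i t Q ∈ Set.range (v i' t'))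
    (H₂ : ∀ i t t' (Q : Spec (C i t)) (z : C i t), (φ i t).hom (x i t') = (φ i t).hom (x i t) * z →
      z ∉ Q.asIdeal → v i t Q ∈ Set.range (v i t')) :
    IsBlowup β I := by
  -- morphisms from affine schemes for which the pull-back of some generator divides the others
  have mem_range (D : CommRingCat.{u}) (i : ι) (t : τ) (ψ : B i ⟶ D)
      (hx : ψ.hom (x i t) ∈ nonZeroDivisors D) (hψ : ∀ b ∈ J i, ψ.hom (x i t) ∣ ψ.hom b)
      (h : Spec D ⟶ Y) (hh : h ≫ β = Spec.map ψ ≫ w i) : Set.range h ⊆ Set.range (v i t) := by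
    rintro _ ⟨P, rfl⟩
    obtain ⟨t', Q, hQ⟩ : ∃ t', h P ∈ Set.range (v i t') := by
      obtain ⟨i₀, t₀, Q, hQ⟩ := hv (h P)
      have hP : β (h P) ∈ Set.range (w i) :=
        ⟨Spec.map ψ P, by rw [← Scheme.Hom.comp_apply, ← Scheme.Hom.comp_apply, hh]⟩
      rw [← hQ] at hP ⊢
      exact H₁ i₀ t₀ i Q hP
    rw [← hQ]
    -- Near P the morphism h lands in the chart t', hence is given there by a ring homomorphism χ.
    obtain ⟨d, hd, hdO⟩ := exists_away_of_mem (h ⁻¹ᵁ (v i t').opensRange) (P := P) ⟨Q, hQ⟩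
    obtain ⟨P', hP'⟩ := mem_range_away hd
    set loc := CommRingCat.ofHom (algebraMap D (Localization.Away d))
    obtain ⟨χ, hχ⟩ := exists_spec_lift (v i t') (Spec.map loc ≫ h) (by
      rintro _ ⟨P₁, rfl⟩
      exact hdO ⟨P₁, rfl⟩)
    have hχφ : φ i t' ≫ χ = ψ ≫ loc := by
      apply comp_eq_of_specMap_comp_eq (w := w i)
      rw [Spec.map_comp, Category.assoc, ← hφ, ← Category.assoc, hχ, Category.assoc, hh,
        Spec.map_comp, Category.assoc]
    have hχφ' (b : B i) : χ.hom ((φ i t').hom b) = loc.hom (ψ.hom b) :=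
      congr($(hχφ).hom b)
    obtain ⟨z, hz⟩ := (hchart i t').dvd (x i t) (hchart i t).mem
    obtain ⟨y, hy⟩ := hψ _ (hchart i t').mem
    -- On the chart t', z is the ratio of x_t by x_t'. Its image in the localization of D is inverse
    -- to that of y, the ratio of x_t' by x_t, so z does not vanish at Q.
    refine H₂ i t' t Q z hz fun hzQ ↦ ?_
    have hQP : Spec.map χ P' = Q := by
      apply (v i t').isOpenEmbedding.injective
      rw [hQ, ← Scheme.Hom.comp_apply, hχ, Scheme.Hom.comp_apply, hP']
    have hunit : loc.hom y * χ.hom z = 1 := by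
      have hx' : loc.hom (ψ.hom (x i t)) ∈ nonZeroDivisors (Localization.Away d) :=
        IsLocalization.map_nonZeroDivisors_le (Submonoid.powers d) _ ⟨_, hx, rfl⟩
      have h1 := congrArg χ.hom hz
      rw [map_mul, hχφ', hχφ', hy, map_mul] at h1
      refine (mul_cancel_left_mem_nonZeroDivisors hx').mp ?_
      rw [← mul_assoc, ← h1, mul_one]
    have : χ.hom z ∈ P'.asIdeal := by
      rw [← hQP] at hzQ
      exact hzQ
    exact P'.isPrime.ne_top ((Ideal.eq_top_iff_one _).mpr
      (hunit ▸ Ideal.mul_mem_left _ _ this))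
  have lift_unique (D : CommRingCat.{u}) (i : ι) (t : τ) (ψ : B i ⟶ D)
      (hx : ψ.hom (x i t) ∈ nonZeroDivisors D) (hψ : ∀ b ∈ J i, ψ.hom (x i t) ∣ ψ.hom b)
      (h h' : Spec D ⟶ Y) (hh : h ≫ β = Spec.map ψ ≫ w i) (hh' : h' ≫ β = Spec.map ψ ≫ w i) :
      h = h' := by
    obtain ⟨χ, rfl⟩ := exists_spec_lift _ _ (mem_range D i t ψ hx hψ h hh)
    obtain ⟨χ', rfl⟩ := exists_spec_lift _ _ (mem_range D i t ψ hx hψ h' hh')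
    have e (χ : C i t ⟶ D) (hh : (Spec.map χ ≫ v i t) ≫ β = Spec.map ψ ≫ w i) :
        φ i t ≫ χ = ψ := by
      apply comp_eq_of_specMap_comp_eq (w := w i)
      rw [← hh, Category.assoc, hφ, ← Category.assoc, Spec.map_comp]
    have e₁ := congrArg CommRingCat.Hom.hom (e χ hh)
    have e₂ := congrArg CommRingCat.Hom.hom (e χ' hh')
    rw [CommRingCat.hom_comp] at e₁ e₂
    have : χ.hom = χ'.hom :=
      (hchart i t).hom_ext (by rw [← e₁] at hx; exact hx) (e₁.trans e₂.symm)
    rw [CommRingCat.hom_ext this]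
  have lift_exists (D : CommRingCat.{u}) (i : ι) (t : τ) (ψ : B i ⟶ D)
      (hx : ψ.hom (x i t) ∈ nonZeroDivisors D) (hψ : ∀ b ∈ J i, ψ.hom (x i t) ∣ ψ.hom b) :
      ∃ h : Spec D ⟶ Y, h ≫ β = Spec.map ψ ≫ w i := by
    obtain ⟨χ, hχ⟩ := (hchart i t).exists_lift hx hψ
    refine ⟨Spec.map (CommRingCat.ofHom χ) ≫ v i t, ?_⟩
    rw [Category.assoc, hφ, ← Category.assoc, ← Spec.map_comp]
    congr 2
    exact CommRingCat.hom_ext hχ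
  -- such morphisms exist locally
  have local_chart (T : Scheme.{u}) (g : T ⟶ X) (hg : IsEffectiveCartier (I.comap g)) (P : T) :
      ∃ (D : CommRingCat.{u}) (q : Spec D ⟶ T) (_ : IsOpenImmersion q) (i : ι) (t : τ)
        (ψ : B i ⟶ D), P ∈ Set.range q ∧ q ≫ g = Spec.map ψ ≫ w i ∧
        ψ.hom (x i t) ∈ nonZeroDivisors D ∧ ∀ b ∈ J i, ψ.hom (x i t) ∣ ψ.hom b := by
    obtain ⟨i, hi⟩ := hw (g P)
    obtain ⟨D, q, _, ⟨P₀, rfl⟩, hq, c, hc, hIc⟩ := hg.exists_chart P (g ⁻¹ᵁ (w i).opensRange) hi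
    obtain ⟨ψ, hψ⟩ := exists_spec_lift (w i) (q ≫ g) (by
      rintro _ ⟨P₁, rfl⟩
      exact hq ⟨P₁, rfl⟩)
    have hJc : (J i).map ψ.hom = Ideal.span {c} := by
      apply (specIdeal D).injective
      rw [← hIc, ← Scheme.IdealSheafData.comap_comp, ← hψ, Scheme.IdealSheafData.comap_comp, hI,
        specIdeal_comap]
    have hdvd (b) (hb : b ∈ J i) : c ∣ ψ.hom b := by
      rw [← Ideal.mem_span_singleton, ← hJc]
      exact Ideal.mem_map_of_mem _ hb
    choose y hy using fun t ↦ hdvd (x i t) (hchart i t).mem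
    -- The products c y_t generate the ideal (c). If all y_t vanished at P₀, then c would lie in c
    -- P₀, and cancelling c would give 1 ∈ P₀.
    obtain ⟨t, ht⟩ : ∃ t, y t ∉ P₀.asIdeal := by
      by_contra! hall
      have hle : (J i).map ψ.hom ≤ Ideal.span {c} * P₀.asIdeal := by
        rw [hJ, Ideal.map_span, Ideal.span_le]
        rintro _ ⟨_, ⟨t, rfl⟩, rfl⟩
        rw [hy]
        exact Ideal.mul_mem_mul (Ideal.mem_span_singleton_self c) (hall t)
      rw [hJc, Ideal.span_singleton_le_iff_mem, Ideal.mem_span_singleton_mul] at hle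
      obtain ⟨z, hz, e⟩ := hle
      have hz1 : z = 1 := (mul_cancel_left_mem_nonZeroDivisors hc).mp (by rw [e, mul_one])
      exact P₀.isPrime.ne_top ((Ideal.eq_top_iff_one _).mpr (hz1 ▸ hz))
    -- After inverting y_t, the pull-back of x_t generates the ideal (c).
    obtain ⟨P', hP'⟩ := mem_range_away ht
    set loc := CommRingCat.ofHom (algebraMap D (Localization.Away (y t))) with hloc
    have : IsOpenImmersion (Spec.map loc) := IsOpenImmersion.of_isLocalization (y t)
    have hyu : IsUnit (loc.hom (y t)) := IsLocalization.Away.algebraMap_isUnit (y t)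
    refine ⟨_, Spec.map loc ≫ q, inferInstance, i, t, ψ ≫ loc, ⟨P', ?_⟩, ?_, ?_, ?_⟩
    · rw [Scheme.Hom.comp_apply, hP']
    · rw [Category.assoc, ← hψ, Spec.map_comp, Category.assoc]
    · change loc.hom (ψ.hom (x i t)) ∈ nonZeroDivisors (Localization.Away (y t))
      rw [hy, map_mul]
      exact mul_mem (IsLocalization.map_nonZeroDivisors_le (Submonoid.powers (y t)) _ ⟨_, hc, rfl⟩)
        hyu.mem_nonZeroDivisors
    · intro b hb
      change loc.hom (ψ.hom (x i t)) ∣ loc.hom (ψ.hom b)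
      obtain ⟨e, he⟩ := hdvd b hb
      rw [hy, he, map_mul, map_mul]
      exact mul_dvd_mul_left _ hyu.dvd
  have unique (T : Scheme.{u}) (g : T ⟶ X) (hg : IsEffectiveCartier (I.comap g)) (h h' : T ⟶ Y)
      (hh : h ≫ β = g) (hh' : h' ≫ β = g) : h = h' := by
    choose D q hq i t ψ hP hψ hx hd using local_chart T g hg
    refine hom_ext_of_charts q (fun P ↦ ⟨P, hP P⟩) fun P ↦ ?_
    exact lift_unique _ (i P) (t P) (ψ P) (hx P) (hd P) _ _ (by rw [Category.assoc, hh, hψ])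
      (by rw [Category.assoc, hh', hψ])
  refine ⟨isEffectiveCartier_of_charts fun y ↦ ?_, fun T g hg ↦ ?_⟩
  · obtain ⟨i, t, hy⟩ := hv y
    refine ⟨C i t, v i t, inferInstance, hy, _, (hchart i t).mem_nonZeroDivisors, ?_⟩
    rw [← Scheme.IdealSheafData.comap_comp, hφ, Scheme.IdealSheafData.comap_comp, hI,
      specIdeal_comap, (hchart i t).map_eq]
  · choose D q hq i t ψ hP hψ hx hd using local_chart T g hg
    choose k hk using fun P ↦ lift_exists _ (i P) (t P) (ψ P) (hx P) (hd P)
    -- The local lifts agree on overlaps by uniqueness, which applies there because the pulled-back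
    -- ideal sheaf stays effective Cartier on open subschemes.
    obtain ⟨h, hh⟩ := exists_desc_of_charts q (fun P ↦ ⟨P, hP P⟩)
      (fun P P' ↦ IsPullback.of_hasPullback (q P) (q P')) k (fun P P' ↦ by
        refine unique _ (pullback.fst (q P) (q P') ≫ q P ≫ g) ?_ _ _ ?_ ?_
        · rw [← Category.assoc, Scheme.IdealSheafData.comap_comp]
          exact hg.comap _
        · rw [Category.assoc, hk, hψ]
        · rw [Category.assoc, hk, ← hψ, pullback.condition_assoc])
    have hhg : h ≫ β = g := hom_ext_of_charts q (fun P ↦ ⟨P, hP P⟩) fun P ↦ by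
      rw [← Category.assoc, hh, hk, hψ]
    exact ⟨h, hhg, fun h' hh' ↦ unique T g hg _ _ hh' hhg⟩

end Criterion

end CoxModel

namespace CoxModel.HomogeneousElement

set_option linter.unusedSectionVars false

/-! ### Contraction data and their affine charts. -/

section Inverse

variable {A R : Type u} {M : Type*} [CommRing A] [CommRing R] [Algebra A R] [AddCommGroup M]
  {𝒜 : M → Submodule A R} [SetLike.GradedMonoid 𝒜]

lemma exists_inv_of_divides {f g : HomogeneousElement 𝒜} (h : g.Divides f) :
    ∃ v ∈ f.awayPart (-g.deg), algebraMap R (Localization.Away f.val) g.val * v = 1 := by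
  obtain ⟨c, hc, hc'⟩ := h
  obtain ⟨w, hw⟩ := (IsLocalization.Away.algebraMap_isUnit (S := Localization.Away f.val)
    f.val).exists_right_inv
  refine ⟨algebraMap R _ c.val * w, ⟨1, c.val, ?_, ?_⟩, ?_⟩
  · simpa [hc'] using c.mem
  · rw [pow_one]; linear_combination (algebraMap R _ c.val) * hw
  · rw [← mul_assoc, ← map_mul, ← hc, hw]

lemma isDomain_away [IsDomain R] {f : HomogeneousElement 𝒜} (hf : f.val ≠ 0) :
    IsDomain (Localization.Away f.val) :=
  IsLocalization.isDomain_localization (powers_le_nonZeroDivisors_of_noZeroDivisors hf)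

lemma algebraMap_away_injective [IsDomain R] {f : HomogeneousElement 𝒜} (hf : f.val ≠ 0) :
    Function.Injective (algebraMap R (Localization.Away f.val)) :=
  IsLocalization.injective _ (powers_le_nonZeroDivisors_of_noZeroDivisors hf)

end Inverse

section Datum

variable {A R R' : Type u} {M M' : Type*} [CommRing A] [CommRing R] [Algebra A R] [AddCommGroup M]
  [CommRing R'] [Algebra A R'] [AddCommGroup M'] {𝒜 : M → Submodule A R} [SetLike.GradedMonoid 𝒜]
  {𝒜' : M' → Submodule A R'} [SetLike.GradedMonoid 𝒜']

/-- Homogeneous elements `η k` of `R'` with `ρ (η k) = y k * t` in `R`, such that the elements of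
`R` of degree `ρ d - n • deg t` are, up to the factor `t ^ n`, the images of the elements of degree
`d` of the `n`-th power of the ideal generated by the `η k`. -/
structure IsContractionDatum (ρ : GradedHom 𝒜 𝒜') {κ : Type*} (η : κ → HomogeneousElement 𝒜')
    (y : κ → HomogeneousElement 𝒜) (t : HomogeneousElement 𝒜) : Prop where
  injective : Function.Injective ρ.toAlgHom
  y_ne_zero : ∀ k, (y k).val ≠ 0
  t_ne_zero : t.val ≠ 0
  mul_eq : ∀ k, (y k).mul t = ρ.map (η k)
  surjective : ∀ d, ∀ h ∈ 𝒜 (ρ.deg d), ∃ h' ∈ 𝒜' d, ρ.toAlgHom h' = h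
  mem_span : ∀ d (n : ℕ), ∀ h ∈ 𝒜 (ρ.deg d - (n + 1) • t.deg),
    h ∈ Submodule.span A {z | ∃ k, ∃ h₁ ∈ 𝒜 (ρ.deg (d - (η k).deg) - n • t.deg),
      z = (y k).val * h₁}

namespace IsContractionDatum

variable {ρ : GradedHom 𝒜 𝒜'} {κ : Type*} {η : κ → HomogeneousElement 𝒜'}
    {y : κ → HomogeneousElement 𝒜} {t : HomogeneousElement 𝒜} (H : IsContractionDatum ρ η y t)

include H

lemma val_mul (k : κ) : (y k).val * t.val = ρ.toAlgHom (η k).val :=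
  congrArg HomogeneousElement.val (H.mul_eq k)

lemma deg_add (k : κ) : (y k).deg + t.deg = ρ.deg (η k).deg :=
  congrArg HomogeneousElement.deg (H.mul_eq k)

variable {f : HomogeneousElement 𝒜'} {F : HomogeneousElement 𝒜} (hF : (ρ.map f).Divides F)

/-- By `mem_span`, an element of degree ρ d - (n + 1) deg t is a sum of products y_k h₁. Since y_k t
= ρ η_k, the factor t ^ (n + 1) turns y_k h₁ into ρ(η_k) t ^ n h₁: one factor from the ideal, and n
more by induction. The element c is a denominator that brings everything to degree zero. -/
lemma exists_mem_pow {v : κ → Localization.Away f.val}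
    (hv : ∀ k, v k ∈ f.awayPart (-(η k).deg)) {u : κ → Localization.Away f.val}
    (hu : ∀ k, u k ∈ f.awayPart (η k).deg) (huv : ∀ k, u k * v k = 1) (n : ℕ) :
    ∀ (d : M') (h : R) (_ : h ∈ 𝒜 (ρ.deg d - n • t.deg)) (c : Localization.Away f.val)
      (_ : c ∈ f.awayPart (-d)),
      ∃ b ∈ Ideal.span (Set.range fun k ↦ f.frac (η k) (v k) (hv k)) ^ n,
        (degZeroMap ρ hF b : Localization.Away F.val) =
          algebraMap R _ (t.val ^ n * h) * awayMap ρ hF c := by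
  induction n with
  | zero =>
    intro d h hh c hc
    rw [zero_nsmul, sub_zero] at hh
    obtain ⟨h', hh', rfl⟩ := H.surjective d h hh
    refine ⟨⟨algebraMap R' _ h' * c, ?_⟩, by simp, by simp⟩
    exact awayPart_mul_mem (f.awayPart_algebraMap hh') hc (add_neg_cancel d)
  | succ n ih =>
    intro d h hh c hc
    replace hh := H.mem_span d n h hh
    induction hh using Submodule.span_induction with
    | mem z hz =>
      obtain ⟨k, h₁, hh₁, rfl⟩ := hz
      -- The factor u k compensates for the inverse v k contained in the fraction of η k.
      obtain ⟨b, hb, e⟩ := ih _ h₁ hh₁ (c * u k) (awayPart_mul_mem hc (hu k) (by abel))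
      refine ⟨f.frac (η k) (v k) (hv k) * b, ?_, ?_⟩
      · rw [pow_succ']
        exact Ideal.mul_mem_mul (Ideal.subset_span ⟨k, rfl⟩) hb
      · rw [map_mul, MulMemClass.coe_mul, e, degZeroMap_coe, frac]
        have huv' := congrArg (awayMap ρ hF) (huv k)
        simp only [map_mul, map_one, awayMap_algebraMap, ← H.val_mul, map_pow] at huv' ⊢
        linear_combination (algebraMap R _ (y k).val * algebraMap R _ t.val ^ (n + 1) *
          algebraMap R _ h₁ * awayMap ρ hF c) * huv'
    | zero => exact ⟨0, zero_mem _, by simp⟩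
    | add z z' _ _ hz hz' =>
      obtain ⟨b, hb, e⟩ := hz
      obtain ⟨b', hb', e'⟩ := hz'
      refine ⟨b + b', add_mem hb hb', ?_⟩
      rw [map_add, AddMemClass.coe_add, e, e', mul_add, map_add, add_mul]
    | smul a z _ hz =>
      obtain ⟨b, hb, e⟩ := hz
      refine ⟨a • b, ?_, ?_⟩
      · rw [Algebra.smul_def]
        exact Ideal.mul_mem_left _ _ hb
      · rw [map_smul, SetLike.val_smul, e, mul_smul_comm, Algebra.smul_def, Algebra.smul_def,
          map_mul _ (algebraMap A R a), IsScalarTower.algebraMap_apply A R, mul_assoc]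

variable [IsDomain R]

lemma awayMap_injective (hF0 : F.val ≠ 0) : Function.Injective (awayMap ρ hF) := by
  rw [injective_iff_map_eq_zero]
  intro x hx
  obtain ⟨⟨a, ⟨_, k, rfl⟩⟩, hk⟩ := IsLocalization.surj (Submonoid.powers f.val) x
  have h1 := congrArg (awayMap ρ hF) hk
  rw [map_mul, hx, zero_mul, awayMap_algebraMap] at h1
  have h2 : a = 0 := by
    apply H.injective
    rw [map_zero]
    apply algebraMap_away_injective hF0
    rw [← h1, map_zero]
  rw [h2, map_zero] at hk
  exact (IsLocalization.map_units _ _).mul_left_eq_zero.mp hk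

/-- Where y_k is invertible, ρ η_l / ρ η_k = y_l / y_k, so the k-th generator divides the others. An
element h / F ^ m with F = ρ(f) y_k, multiplied by the m-th power of this generator, has numerator t
^ m h up to units from R', and so comes from the m-th power of the ideal by `exists_mem_pow`. -/
lemma isBlowupChart {v : κ → Localization.Away f.val}
    (hv : ∀ k, v k ∈ f.awayPart (-(η k).deg)) {u : κ → Localization.Away f.val}
    (hu : ∀ k, u k ∈ f.awayPart (η k).deg) (huv : ∀ k, u k * v k = 1)
    (hf : ρ.toAlgHom f.val ≠ 0) (k : κ) :
    IsBlowupChart (degZeroMap ρ ((ρ.map f).divides_mul (y k))).toRingHom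
      (Ideal.span (Set.range fun k ↦ f.frac (η k) (v k) (hv k))) (f.frac (η k) (v k) (hv k)) := by
  set F := (ρ.map f).mul (y k) with hFdef
  set hF : (ρ.map f).Divides F := (ρ.map f).divides_mul (y k)
  have hF0 : F.val ≠ 0 := mul_ne_zero hf (H.y_ne_zero k)
  have := isDomain_away hF0
  have hyF : (y k).Divides F := ((y k).divides_mul (ρ.map f)).trans (mul_divides_swap _ _)
  obtain ⟨yi, hyi, hyi'⟩ := exists_inv_of_divides hyF
  obtain ⟨fi, hfi, hfi'⟩ := exists_inv_of_divides (Divides.refl f)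
  have huv' (l : κ) : awayMap ρ hF (u l) * awayMap ρ hF (v l) = 1 := by
    rw [← map_mul, huv, map_one]
  have hx (l : κ) : (degZeroMap ρ hF (f.frac (η l) (v l) (hv l)) : Localization.Away F.val) =
      algebraMap R _ (y l).val * algebraMap R _ t.val * awayMap ρ hF (v l) := by
    rw [degZeroMap_coe, frac, map_mul, awayMap_algebraMap, ← H.val_mul, map_mul]
  refine ⟨?_, Ideal.subset_span ⟨k, rfl⟩, ?_, ?_, ?_⟩
  · intro a b hab
    exact Subtype.ext (H.awayMap_injective hF hF0 (congrArg Subtype.val hab))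
  · refine mem_nonZeroDivisors_of_ne_zero fun h0 ↦ ?_
    have h0 : (degZeroMap ρ hF (f.frac (η k) (v k) (hv k)) : Localization.Away F.val) = 0 :=
      congrArg Subtype.val h0
    rw [hx] at h0
    have h1 : algebraMap R (Localization.Away F.val) ((y k).val * t.val) = 0 := by
      rw [map_mul]
      linear_combination awayMap ρ hF (u k) * h0 - (algebraMap R _ (y k).val *
        algebraMap R _ t.val) * huv' k
    exact mul_ne_zero (H.y_ne_zero k) H.t_ne_zero
      (algebraMap_away_injective hF0 (h1.trans (map_zero _).symm))
  · intro b hb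
    suffices h : Ideal.span (Set.range fun k ↦ f.frac (η k) (v k) (hv k)) ≤
        (Ideal.span {degZeroMap ρ hF (f.frac (η k) (v k) (hv k))}).comap
          (degZeroMap ρ hF).toRingHom from Ideal.mem_span_singleton.mp (h hb)
    rw [Ideal.span_le]
    rintro _ ⟨l, rfl⟩
    -- The quotient is y_l / y_k, corrected by the units u_k and v_l to have degree zero.
    refine Ideal.mem_span_singleton.mpr ⟨⟨algebraMap R _ (y l).val * yi *
      (awayMap ρ hF (u k) * awayMap ρ hF (v l)), ?_⟩, Subtype.ext ?_⟩
    · refine awayPart_mul_mem (awayPart_mul (F.awayPart_algebraMap (y l).mem) hyi)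
        (awayPart_mul (awayMap_mem ρ hF (hu k)) (awayMap_mem ρ hF (hv l))) ?_
      rw [map_neg, ← H.deg_add, ← H.deg_add]
      abel
    · change (degZeroMap ρ hF (f.frac (η l) (v l) (hv l)) : Localization.Away F.val) =
        degZeroMap ρ hF (f.frac (η k) (v k) (hv k)) * _
      rw [hx, hx]
      linear_combination (-algebraMap R _ (y l).val * algebraMap R _ t.val * awayMap ρ hF (v l)) *
        (hyi' + algebraMap R _ (y k).val * yi * huv' k)
  · intro c
    obtain ⟨m, h, hh, hc⟩ := c.2
    -- Since deg y_k = ρ (deg η_k) - deg t, the degree of the numerator h has the form required by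
    -- `exists_mem_pow` with d = m (deg f + deg η_k).
    have hd : 0 + m • F.deg = ρ.deg (m • (f.deg + (η k).deg)) - m • t.deg := by
      have : F.deg = ρ.deg f.deg + (y k).deg := rfl
      rw [this, map_nsmul, map_add, ← H.deg_add, smul_add, smul_add, smul_add]
      abel
    rw [hd] at hh
    obtain ⟨b, hb, e⟩ := H.exists_mem_pow hF hv hu huv m _ h hh ((fi * v k) ^ m) (by
      have := awayPart_pow (awayPart_mul hfi (hv k)) m
      rwa [← neg_add, smul_neg] at this)
    refine ⟨m, b, hb, Subtype.ext ?_⟩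
    change (degZeroMap ρ hF b : Localization.Away F.val) =
      ((degZeroMap ρ hF (f.frac (η k) (v k) (hv k)) ^ m * c : F.degZero) : Localization.Away F.val)
    have hfi' : algebraMap R _ (ρ.toAlgHom f.val) * awayMap ρ hF fi = 1 := by
      rw [← awayMap_algebraMap ρ hF, ← map_mul, hfi', map_one]
    have hF' : algebraMap R (Localization.Away F.val) F.val =
        algebraMap R _ (ρ.toAlgHom f.val) * algebraMap R _ (y k).val := map_mul _ _ _
    have hfi'' := congrArg (· ^ m) hfi'
    change c.1 * algebraMap R (Localization.Away F.val) (F.val ^ m) = _ at hc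
    simp only [mul_pow, one_pow] at hfi''
    rw [map_pow, hF', mul_pow] at hc
    rw [e, MulMemClass.coe_mul, SubmonoidClass.coe_pow, hx, map_mul, ← hc, map_pow, map_pow,
      map_mul, mul_pow, mul_pow, mul_pow]
    linear_combination (algebraMap R _ t.val ^ m * c * algebraMap R _ (y k).val ^ m *
      awayMap ρ hF (v k) ^ m) * hfi''

end IsContractionDatum

end Datum

/-! ### The blowing-up glued from a contraction datum. -/

section Blowup

variable {A R R' : Type u} {M M' : Type*} [CommRing A] [CommRing R] [Algebra A R] [AddCommGroup M]
  [CommRing R'] [Algebra A R'] [AddCommGroup M'] {𝒜 : M → Submodule A R} [SetLike.GradedMonoid 𝒜]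
  {𝒜' : M' → Submodule A R'} [DecidableEq M'] [GradedAlgebra 𝒜'] [IsDomain R]
  {ρ : GradedHom 𝒜 𝒜'} {ι κ : Type} [Finite ι] {η : κ → HomogeneousElement 𝒜'}
  {y : κ → HomogeneousElement 𝒜} {t : HomogeneousElement 𝒜}

/-- The charts of a contraction datum glue to a blowing-up. -/
theorem IsContractionDatum.isBlowupAlong (H : IsContractionDatum ρ η y t)
    {f : ι → HomogeneousElement 𝒜'} (hf : HasAllUnits f) (hf0 : ∀ i, ρ.toAlgHom (f i).val ≠ 0)
    (hF : HasAllUnits fun i : ι × κ ↦ (ρ.map (f i.1)).mul (y i.2)) :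
    IsBlowupAlong hF.hasUnits hf.hasUnits (Set.range fun k ↦ (η k).val) := by
  obtain ⟨β, hβ, hβ'⟩ := exists_gluedMap ρ hf.hasUnits hF.hasUnits Prod.fst
    fun i ↦ (ρ.map (f i.1)).divides_mul (y i.2)
  -- Needed to glue the ideals of the center to an ideal sheaf.
  have (i : ι) : QuasiCompact (chart f hf.hasUnits i) :=
    quasiCompact_of_charts (exists_chart_eq hf.hasUnits) (fun _ _ ↦ inferInstance)
      (isPullback_chart hf.hasUnits) i
  obtain ⟨I, hI⟩ := exists_idealSheaf_of_charts (isPullback_chart hf.hasUnits)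
    (fun i ↦ specIdeal _ ((f i).degZeroIdeal (Set.range fun k ↦ (η k).val))) (by
      intro i j
      rw [specHom, specHom, specIdeal_comap, specIdeal_comap]
      congr 1
      exact (map_degZeroIdeal _ η fun k ↦ hf i _).trans
        (map_degZeroIdeal _ η fun k ↦ hf j _).symm)
  choose u hu v hv huv using fun i k ↦ hf i (η k).deg
  refine ⟨β, I, hβ, fun i ↦ (hI i).trans (ker_specMap_quotient _).symm, ?_⟩
  refine isBlowup_of_charts (w := chart f hf.hasUnits)
    (v := fun i k ↦ chart _ hF.hasUnits (i, k))
    (φ := fun i k ↦ CommRingCat.ofHom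
      (degZeroMap ρ ((ρ.map (f i)).divides_mul (y k))).toRingHom)
    (J := fun i ↦ (f i).degZeroIdeal (Set.range fun k ↦ (η k).val))
    (x := fun i k ↦ (f i).frac (η k) (v i k) (hv i k))
    (exists_chart_eq _) (fun z ↦ ?_) (fun i k ↦ hβ' (i, k)) hI
    (fun i ↦ degZeroIdeal_eq_span _ η (hv i) (hu i) (huv i)) (fun i k ↦ ?_) ?_ ?_
  · obtain ⟨⟨i, k⟩, h⟩ := exists_chart_eq hF.hasUnits z
    exact ⟨i, k, h⟩
  · rw [degZeroIdeal_eq_span _ η (hv i) (hu i) (huv i)]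
    exact H.isBlowupChart (hv i) (hu i) (huv i) (hf0 i) k
  · intro i k i' Q hQ
    refine ⟨k, (chart_mem_range_chart_iff hF.hasUnits (i, k) (i', k) Q).mpr ?_⟩
    rw [← Scheme.Hom.comp_apply, hβ' (i, k), Scheme.Hom.comp_apply,
      chart_mem_range_chart_iff] at hQ
    obtain ⟨c, hc, hcQ⟩ := (mem_range_specHom_iff (hf i _) _).mp hQ
    have hd : (ρ.map (f i)).Divides ((ρ.map (f i)).mul (y k)) := (ρ.map (f i)).divides_mul (y k)
    have hy : (y k).Divides ((ρ.map (f i)).mul (y k)) :=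
      ((y k).divides_mul _).trans (mul_divides_swap _ _)
    obtain ⟨yi, hyi, hyi'⟩ := exists_inv_of_divides hy
    -- As y_k is invertible on this chart, dividing by it shows that the fraction of ρ(f_i') y_k
    -- formed with c / y_k is the image of f_i' c, which does not vanish at Q.
    refine (mem_range_specHom_iff (hF (i, k) _) _).mpr
      ⟨awayMap ρ hd c * yi, awayPart_mul_mem (awayMap_mem ρ hd hc) hyi ?_, ?_⟩
    · rw [map_neg, ← neg_add]
      rfl
    · intro hmem
      apply hcQ
      change degZeroMap ρ hd (frac _ _ c hc) ∈ Q.asIdeal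
      convert hmem using 1
      apply Subtype.ext
      change awayMap ρ hd (algebraMap _ _ (f i').val * c) =
        algebraMap R _ (ρ.toAlgHom (f i').val * (y k).val) * (awayMap ρ hd c * yi)
      rw [map_mul, map_mul, awayMap_algebraMap]
      linear_combination (-algebraMap R _ (ρ.toAlgHom (f i').val) * awayMap ρ hd c) * hyi'
  · intro i k k' Q z hz hzQ
    let F := (ρ.map (f i)).mul (y k)
    have hd : (ρ.map (f i)).Divides F := (ρ.map (f i)).divides_mul (y k)
    have hy : (y k).Divides F := ((y k).divides_mul _).trans (mul_divides_swap _ _)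
    obtain ⟨yi, hyi, hyi'⟩ := exists_inv_of_divides hy
    obtain ⟨fi, hfi, hfi'⟩ := exists_inv_of_divides hd
    have hF0 : F.val ≠ 0 := mul_ne_zero (hf0 i) (H.y_ne_zero k)
    have := isDomain_away hF0
    refine (chart_mem_range_chart_iff hF.hasUnits (i, k) (i, k') Q).mpr ?_
    -- A denominator for ρ(f_i) y_k' whose fraction is (y_k' v_k') / (y_k v_k). Cancelling t in the
    -- equation for z shows that this is z.
    have hmem : fi * (awayMap ρ hd (v i k') * (awayMap ρ hd (u i k) * yi)) ∈
        F.awayPart (-((ρ.map (f i)).mul (y k')).deg) := by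
      refine awayPart_mul_mem hfi (awayPart_mul (awayMap_mem ρ hd (hv i k'))
        (awayPart_mul (awayMap_mem ρ hd (hu i k)) hyi)) ?_
      change _ = -((ρ.map (f i)).deg + (y k').deg)
      rw [map_neg, ← H.deg_add, ← H.deg_add]
      abel
    refine (mem_range_specHom_iff (hF (i, k) _) _).mpr ⟨_, hmem, fun hQ ↦ hzQ ?_⟩
    convert hQ using 1
    apply Subtype.ext
    change z.1 = algebraMap R _ (ρ.toAlgHom (f i).val * (y k').val) * _
    have hz' : awayMap ρ hd (algebraMap _ _ (η k').val * v i k') =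
      awayMap ρ hd (algebraMap _ _ (η k).val * v i k) * z.1 := congrArg Subtype.val hz
    rw [map_mul, map_mul, awayMap_algebraMap, awayMap_algebraMap, ← H.val_mul, ← H.val_mul,
      map_mul, map_mul] at hz'
    have ht0 : algebraMap R (Localization.Away F.val) t.val ≠ 0 := fun h ↦
      H.t_ne_zero (algebraMap_away_injective hF0 (h.trans (map_zero _).symm))
    have huv' : awayMap ρ hd (u i k) * awayMap ρ hd (v i k) = 1 := by
      rw [← map_mul, huv, map_one]
    have hz'' : algebraMap R _ (y k').val * awayMap ρ hd (v i k') =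
        algebraMap R (Localization.Away F.val) (y k).val * awayMap ρ hd (v i k) * z.1 := by
      apply mul_left_cancel₀ ht0
      linear_combination hz'
    have hfi'' : algebraMap R _ (ρ.toAlgHom (f i).val) * fi = 1 := hfi'
    rw [map_mul]
    linear_combination (-algebraMap R _ (y k').val * awayMap ρ hd (v i k') *
      awayMap ρ hd (u i k) * yi) * hfi'' - (awayMap ρ hd (u i k) * yi) * hz'' -
      z.1 * algebraMap R _ (y k).val * yi * huv' - z.1 * hyi'

end Blowup

end CoxModel.HomogeneousElement

namespace CoxModel

/-! ### Dependence of the glued scheme on the radical only. -/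

namespace HomogeneousElement

variable {A R : Type u} {M : Type*} [CommRing A] [CommRing R] [Algebra A R] [AddCommGroup M]
  {𝒜 : M → Submodule A R} [DecidableEq M] [GradedAlgebra 𝒜] {ι κ : Type}

/-- The charts of the subfamily still cover: each h k lies in the radical of the ideal that the
subfamily generates. -/
lemma exists_iso_glued_of_radical {h : κ → HomogeneousElement 𝒜} (hh : HasAllUnits h) (e : ι → κ)
    (he : HasUnits fun i ↦ h (e i))
    (hr : ∀ k, (h k).val ∈ (Ideal.span (Set.range fun i ↦ (h (e i)).val)).radical) :
    ∃ φ : glued (fun i ↦ h (e i)) he ≅ glued h hh.hasUnits,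
      φ.hom ≫ toBase h hh.hasUnits = toBase (fun i ↦ h (e i)) he := by
  obtain ⟨φ, hφ⟩ := exists_iso_glued hh.hasUnits e he fun k Q ↦
    exists_mem_range_specHom (h k) (fun i ↦ h (e i)) (fun i ↦ hh k _) (hr k) Q
  refine ⟨φ, glued_hom_ext he fun i ↦ ?_⟩
  rw [← Category.assoc, hφ, chart_toBase, chart_toBase]

/-- The glued scheme depends only on the radical of the ideal generated by the family. -/
lemma exists_iso_of_radical {f : ι → HomogeneousElement 𝒜} {F : κ → HomogeneousElement 𝒜}
    (hf : HasAllUnits f) (hF : HasAllUnits F)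
    (h : ∀ i, (f i).val ∈ (Ideal.span (Set.range fun k ↦ (F k).val)).radical)
    (h' : ∀ k, (F k).val ∈ (Ideal.span (Set.range fun i ↦ (f i).val)).radical) :
    ∃ φ : glued f hf.hasUnits ≅ glued F hF.hasUnits,
      φ.hom ≫ toBase F hF.hasUnits = toBase f hf.hasUnits := by
  -- Both families are compared with their disjoint union, in which either of them is superfluous.
  have hH : HasAllUnits (Sum.elim f F) := by
    rintro (i | k) e
    exacts [hf i e, hF k e]
  obtain ⟨φ, hφ⟩ : ∃ φ : glued f hf.hasUnits ≅ glued (Sum.elim f F) hH.hasUnits,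
      φ.hom ≫ toBase _ hH.hasUnits = toBase f hf.hasUnits :=
    exists_iso_glued_of_radical hH Sum.inl hf.hasUnits (by
      rintro (i | k)
      · exact Ideal.le_radical (Ideal.subset_span ⟨i, rfl⟩)
      · exact h' k)
  obtain ⟨ψ, hψ⟩ : ∃ ψ : glued F hF.hasUnits ≅ glued (Sum.elim f F) hH.hasUnits,
      ψ.hom ≫ toBase _ hH.hasUnits = toBase F hF.hasUnits :=
    exists_iso_glued_of_radical hH Sum.inr hF.hasUnits (by
      rintro (i | k)
      · exact h i
      · exact Ideal.le_radical (Ideal.subset_span ⟨k, rfl⟩))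
  refine ⟨φ ≪≫ ψ.symm, ?_⟩
  rw [← hψ, ← hφ, Iso.trans_hom, Iso.symm_hom, Category.assoc, Iso.inv_hom_id_assoc]

/-- Being a blowing-up depends only on the radical of the ideal generated by the family. -/
lemma isBlowupAlong_of_radical {R' : Type u} {M' : Type*} [CommRing R'] [Algebra A R']
    [AddCommGroup M'] {𝒜' : M' → Submodule A R'} [SetLike.GradedMonoid 𝒜'] {ι' : Type}
    {f' : ι' → HomogeneousElement 𝒜'} {hf' : HasUnits f'} {S : Set R'}
    {f : ι → HomogeneousElement 𝒜} {F : κ → HomogeneousElement 𝒜}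
    (hf : HasAllUnits f) (hF : HasAllUnits F)
    (h : ∀ i, (f i).val ∈ (Ideal.span (Set.range fun k ↦ (F k).val)).radical)
    (h' : ∀ k, (F k).val ∈ (Ideal.span (Set.range fun i ↦ (f i).val)).radical)
    (hb : IsBlowupAlong hF.hasUnits hf' S) : IsBlowupAlong hf.hasUnits hf' S := by
  obtain ⟨φ, hφ⟩ := exists_iso_of_radical hf hF h h'
  obtain ⟨β, I, hβ, hI, hb⟩ := hb
  exact ⟨φ.hom ≫ β, I, by rw [Category.assoc, hβ, hφ], hI, hb.iso_comp φ⟩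

end HomogeneousElement

/-! ### The grading of a quotient of a polynomial ring. -/

section QuotGrading

variable {A : Type u} [CommRing A] {σ : Type} {r : ℕ} {w : σ → Fin r → ℤ}
  {G : Ideal (MvPolynomial σ A)}

lemma mem_quotGrading_of_isWeightedHomogeneous {p : MvPolynomial σ A} {d : Fin r → ℤ}
    (hp : IsWeightedHomogeneous w p d) : Ideal.Quotient.mk G p ∈ quotGrading w G d :=
  ⟨p, hp, rfl⟩

lemma mk_monomial_mem_quotGrading (a : σ →₀ ℕ) {d : Fin r → ℤ} (h : Finsupp.weight w a = d) :
    Ideal.Quotient.mk G (monomial a 1) ∈ quotGrading w G d :=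
  mem_quotGrading_of_isWeightedHomogeneous (isWeightedHomogeneous_monomial w a 1 h)

/-- Homogeneous polynomials are combinations of monomials of the same degree. This reduces all later
claims about graded pieces to monomials. -/
lemma quotGrading_le {d : Fin r → ℤ} {N : Submodule A (MvPolynomial σ A ⧸ G)}
    (h : ∀ a : σ →₀ ℕ, Finsupp.weight w a = d → Ideal.Quotient.mk G (monomial a 1) ∈ N) :
    quotGrading w G d ≤ N := by
  rintro _ ⟨p, hp, rfl⟩
  rw [p.as_sum, map_sum]
  refine Submodule.sum_mem _ fun a ha ↦ ?_
  have : monomial a (coeff a p) = coeff a p • monomial a (1 : A) := by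
    rw [smul_monomial, smul_eq_mul, mul_one]
  rw [this, map_smul]
  exact Submodule.smul_mem _ _ (h a (hp (mem_support_iff.mp ha)))

/-- The grading of the quotient by a homogeneous ideal. -/
noncomputable abbrev gradedAlgebraQuotGrading
    (hG : ∀ p ∈ G, ∀ d, weightedHomogeneousComponent w d p ∈ G) :
    GradedAlgebra (quotGrading w G) := by
  let _ := weightedGradedAlgebra A w
  -- The map taking a polynomial to the classes of its homogeneous components; homogeneity of G
  -- makes it depend only on the class modulo G.
  let L : MvPolynomial σ A →+ DirectSum _ fun d ↦ quotGrading w G d :=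
    (DFinsupp.mapRange.addMonoidHom fun d ↦
      ((((Ideal.Quotient.mkₐ A G).toLinearMap.submoduleMap
        (weightedHomogeneousSubmodule A w d))).toAddMonoidHom)).comp
      (DirectSum.decomposeAddEquiv (weightedHomogeneousSubmodule A w)).toAddMonoidHom
  have hL (p : MvPolynomial σ A) (d : Fin r → ℤ) :
      (L p d : MvPolynomial σ A ⧸ G) = Ideal.Quotient.mk G (weightedHomogeneousComponent w d p) := by
    rw [← weightedDecomposition.decompose'_apply]
    rfl
  have hL0 (p q : MvPolynomial σ A) (h : Ideal.Quotient.mk G p = Ideal.Quotient.mk G q) :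
      L p = L q := by
    refine DFinsupp.ext fun d ↦ Subtype.ext ?_
    rw [hL, hL, Ideal.Quotient.eq, ← map_sub]
    exact hG _ (Ideal.Quotient.eq.mp h) d
  have hL1 (d : Fin r → ℤ) (p : MvPolynomial σ A) (hp : IsWeightedHomogeneous w p d) :
      L p = DirectSum.of _ d ⟨Ideal.Quotient.mk G p,
        mem_quotGrading_of_isWeightedHomogeneous hp⟩ := by
    refine DFinsupp.ext fun e ↦ Subtype.ext ?_
    rw [hL, weightedHomogeneousComponent_of_mem hp]
    by_cases h : e = d
    · subst h
      rw [if_pos rfl, DirectSum.of_eq_same]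
    · rw [if_neg h, DirectSum.of_eq_of_ne _ _ _ h, map_zero]
      rfl
  have hcoe (p : MvPolynomial σ A) :
      DirectSum.coeAddMonoidHom (quotGrading w G) (L p) = Ideal.Quotient.mk G p := by
    induction p using DirectSum.Decomposition.inductionOn (weightedHomogeneousSubmodule A w) with
    | zero => rw [map_zero, map_zero, map_zero]
    | homogeneous p =>
      rw [hL1 _ _ p.2, DirectSum.coeAddMonoidHom_of]
    | add p q hp hq => rw [map_add, map_add, hp, hq, map_add]
  exact
    { decompose' := fun x ↦ L (Function.surjInv Ideal.Quotient.mk_surjective x)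
      left_inv := fun x ↦ by
        rw [hcoe, Function.surjInv_eq Ideal.Quotient.mk_surjective]
      right_inv := fun z ↦ by
        obtain ⟨p, rfl⟩ : ∃ p, L p = z := by
          induction z using DirectSum.induction_on with
          | zero => exact ⟨0, map_zero L⟩
          | of d x =>
            obtain ⟨_, p, hp, rfl⟩ := x
            exact ⟨p, hL1 d p hp⟩
          | add x y hx hy =>
            obtain ⟨p, rfl⟩ := hx
            obtain ⟨q, rfl⟩ := hy
            exact ⟨p + q, map_add L p q⟩
        exact hL0 _ _ (by rw [Function.surjInv_eq Ideal.Quotient.mk_surjective, hcoe]) }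

end QuotGrading

end CoxModel

namespace CoxModel

/-! ### The pull-back of sections on monomials. -/

section Polynomials

variable {A : Type u} [CommRing A] {n r : ℕ}

lemma weight_eq_sum {σ : Type} [Fintype σ] (w : σ → Fin r → ℤ) (a : σ →₀ ℕ) :
    Finsupp.weight w a = ∑ i, (a i : ℤ) • w i := by
  rw [Finsupp.weight_apply, Finsupp.sum_fintype _ _ (by simp)]
  simp

lemma sum_image_weightedHomogeneousComponent {σ : Type} (w : σ → Fin r → ℤ)
    (p : MvPolynomial σ A) :
    ∑ d ∈ p.support.image (Finsupp.weight w), weightedHomogeneousComponent w d p = p := by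
  classical
  ext a
  simp only [coeff_sum, coeff_weightedHomogeneousComponent, Finset.sum_ite_eq]
  split_ifs with h
  · rfl
  · by_contra ha
    exact h (Finset.mem_image_of_mem _ (mem_support_iff.mpr (Ne.symm ha)))

/-- The pull-back of sections, with `η_N` sent to `1`. -/
noncomputable def extendedPullback :
    MvPolynomial (Fin (n + 3)) A →ₐ[A] MvPolynomial (Fin (n + 3)) A :=
  pullbackSections.comp (aeval (Fin.snoc (α := fun _ ↦ MvPolynomial (Fin (n + 2)) A) X 1))

/-- The exponent vector of the pull-back of a monomial. -/
noncomputable def shiftExponent (a : Fin (n + 3) →₀ ℕ) : Fin (n + 3) →₀ ℕ :=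
  a.update (Fin.last (n + 2)) (a 0 + a 1)

lemma shiftExponent_castSucc (a : Fin (n + 3) →₀ ℕ) (i : Fin (n + 2)) :
    shiftExponent a i.castSucc = a i.castSucc := by
  simp [shiftExponent, Finsupp.update_apply, (Fin.castSucc_lt_last i).ne]

lemma shiftExponent_last (a : Fin (n + 3) →₀ ℕ) :
    shiftExponent a (Fin.last (n + 2)) = a 0 + a 1 := by
  simp [shiftExponent]

lemma monomial_eq_prod_castSucc (a : Fin (n + 3) →₀ ℕ) : monomial a (1 : A) =
    (∏ i : Fin (n + 2), X i.castSucc ^ a i.castSucc) * X (Fin.last (n + 2)) ^ a (Fin.last (n + 2)) := by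
  rw [monomial_eq, Finsupp.prod_fintype _ _ (fun _ ↦ pow_zero _), Fin.prod_univ_castSucc, C_1,
    one_mul]

lemma extendedPullback_X_castSucc (i : Fin (n + 2)) :
    extendedPullback (X i.castSucc : MvPolynomial (Fin (n + 3)) A) = pullbackSections (X i) := by
  simp [extendedPullback, Fin.snoc_castSucc]

lemma extendedPullback_X_last :
    extendedPullback (X (Fin.last (n + 2)) : MvPolynomial (Fin (n + 3)) A) = 1 := by
  simp [extendedPullback, Fin.snoc_last]

lemma pullbackSections_X (i : Fin (n + 2)) : pullbackSections (X i : MvPolynomial (Fin (n + 2)) A) =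
    X i.castSucc * if i = 0 ∨ i = 1 then X (Fin.last (n + 2)) else 1 := by
  rw [pullbackSections, aeval_X]
  split_ifs <;> simp

lemma extendedPullback_monomial (a : Fin (n + 3) →₀ ℕ) (c : A) :
    extendedPullback (monomial a c) = monomial (shiftExponent a) c := by
  have h (b : Fin (n + 3) →₀ ℕ) : monomial b c = C c * monomial b 1 := by
    rw [C_mul_monomial, mul_one]
  rw [h a, h (shiftExponent a), map_mul, ← algebraMap_eq, AlgHom.commutes]
  congr 1
  simp only [monomial_eq_prod_castSucc, shiftExponent_castSucc, shiftExponent_last, map_mul,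
    map_prod, map_pow, extendedPullback_X_castSucc, extendedPullback_X_last, pullbackSections_X,
    one_pow, mul_one, mul_pow, Finset.prod_mul_distrib]
  congr 1
  rw [Fin.prod_univ_succ, Fin.prod_univ_succ, Finset.prod_eq_one]
  · simp [pow_add]
  · intro i _
    have h0 : i.succ.succ ≠ 0 := Fin.succ_ne_zero _
    have h1 : i.succ.succ ≠ 1 := fun h ↦ Fin.succ_ne_zero i (Fin.succ_injective _ h)
    simp [h0, h1]

lemma extendedPullback_rename (p : MvPolynomial (Fin (n + 2)) A) :
    extendedPullback (rename Fin.castSucc p) = pullbackSections p := by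
  have : (extendedPullback (A := A)).comp (rename Fin.castSucc) = pullbackSections (n := n) := by
    ext1 i
    rw [AlgHom.comp_apply, rename_X, extendedPullback_X_castSucc]
  exact DFunLike.congr_fun this p

end Polynomials

/-! ### The pull-back homomorphism under the relations between the degrees. -/

section Contraction

variable {A : Type u} [CommRing A] {n r r' l : ℕ}

/-- The relations between the degrees on a surface and on its contraction, and the properties of
the ideal of relations, in terms of which the blowing-up is described. -/
structure IsContractionGrading (w : Fin (n + 3) → Fin r → ℤ) (w' : Fin (n + 2) → Fin r' → ℤ)
    (g : Fin l → MvPolynomial (Fin (n + 3)) A) : Prop where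
  isPrime : (Ideal.span (Set.range g)).IsPrime
  component_mem : ∀ p ∈ Ideal.span (Set.range g), ∀ d,
    weightedHomogeneousComponent w d p ∈ Ideal.span (Set.range g)
  X_notMem : ∀ i, X i ∉ Ideal.span (Set.range g)
  relation : ∀ c : Fin (n + 3) → ℤ, ∑ i, c i • w i = 0 →
    c (Fin.last (n + 2)) = c 0 + c 1 ∧ ∑ i : Fin (n + 2), c i.castSucc • w' i = 0
  relation' : ∀ c : Fin (n + 2) → ℤ, ∑ i, c i • w' i = 0 →
    ∑ i : Fin (n + 2), c i • w i.castSucc + (c 0 + c 1) • w (Fin.last (n + 2)) = 0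
  exists_sum_eq : ∀ e, ∃ c : Fin (n + 3) → ℤ, ∑ i, c i • w i = e

lemma weight_contractedDegrees (w' : Fin (n + 2) → Fin r' → ℤ) (a : Fin (n + 3) →₀ ℕ) :
    Finsupp.weight (contractedDegrees w') a = ∑ i : Fin (n + 2), (a i.castSucc : ℤ) • w' i := by
  simp [weight_eq_sum, Fin.sum_univ_castSucc, contractedDegrees, Fin.snoc_castSucc, Fin.snoc_last]

namespace IsContractionGrading

variable {w : Fin (n + 3) → Fin r → ℤ} {w' : Fin (n + 2) → Fin r' → ℤ}
  {g : Fin l → MvPolynomial (Fin (n + 3)) A} (H : IsContractionGrading w w' g)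

include H

lemma monomial_notMem (a : Fin (n + 3) →₀ ℕ) : monomial a 1 ∉ Ideal.span (Set.range g) := by
  have := H.isPrime
  rw [monomial_eq, C_1, one_mul, Finsupp.prod, Ideal.IsPrime.prod_mem_iff]
  rintro ⟨i, -, hi⟩
  exact H.X_notMem i (H.isPrime.mem_of_pow_mem _ hi)

/-- The relations between degrees, applied to the difference of both sides of `h`. Here ∑ c_i w'_i
is a degree d on the contracted surface, and the right hand side of `h` represents its pull-back
minus k e_N. -/
lemma exponent_eq (a : Fin (n + 3) →₀ ℕ) (c : Fin (n + 2) → ℤ) (k : ℤ)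
    (h : Finsupp.weight w a = ∑ i : Fin (n + 2), c i • w i.castSucc +
      (c 0 + c 1 - k) • w (Fin.last (n + 2))) :
    (a (Fin.last (n + 2)) : ℤ) + k = a 0 + a 1 ∧
      Finsupp.weight (contractedDegrees w') a = ∑ i, c i • w' i := by
  obtain ⟨h1, h2⟩ := H.relation
    (Fin.snoc (α := fun _ ↦ ℤ) (fun i ↦ a i.castSucc - c i) (a (Fin.last (n + 2)) - (c 0 + c 1 - k))) (by
      rw [weight_eq_sum, Fin.sum_univ_castSucc] at h
      simp only [Fin.sum_univ_castSucc, Fin.snoc_castSucc, Fin.snoc_last, sub_smul,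
        Finset.sum_sub_distrib] at h ⊢
      linear_combination (exp := 1) h)
  replace h1 := h1.trans (congrArg₂ (· + ·) (Fin.snoc_castSucc (α := fun _ ↦ ℤ) _ _ 0)
    (Fin.snoc_castSucc (α := fun _ ↦ ℤ) _ _ 1))
  rw [Fin.snoc_last, Fin.castSucc_zero, Fin.castSucc_one] at h1
  refine ⟨by linarith, ?_⟩
  simp only [Fin.snoc_castSucc, sub_smul, Finset.sum_sub_distrib] at h2
  rw [weight_contractedDegrees]
  exact sub_eq_zero.mp h2

lemma exponent_sub (a b : Fin (n + 3) →₀ ℕ) (h : Finsupp.weight w a = Finsupp.weight w b) :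
    a (Fin.last (n + 2)) + (b 0 + b 1) = b (Fin.last (n + 2)) + (a 0 + a 1) ∧
      Finsupp.weight (contractedDegrees w') a = Finsupp.weight (contractedDegrees w') b := by
  -- This k makes the coefficient of e_N equal to the exponent of η_N in b.
  obtain ⟨h1, h2⟩ := H.exponent_eq a (fun i ↦ b i.castSucc)
    (b 0 + b 1 - b (Fin.last (n + 2))) (by
      rw [h, weight_eq_sum, Fin.sum_univ_castSucc]
      simp)
  rw [weight_contractedDegrees w' b]
  exact ⟨by omega, h2⟩

/-- On the monomials of a w-homogeneous q the number a_N - a_1 - a_2 is constant, so q and its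
pull-back agree up to powers of η_N. Since (g) is prime and does not contain η_N, the pull-back of q
lies in (g) if q does. The remaining generator η_N - 1 is sent to zero. -/
lemma extendedPullback_mem {p : MvPolynomial (Fin (n + 3)) A} (hp : p ∈ contractedIdeal g) :
    extendedPullback p ∈ Ideal.span (Set.range g) := by
  have key (q : MvPolynomial (Fin (n + 3)) A) (d) (hq : IsWeightedHomogeneous w q d)
      (hqG : q ∈ Ideal.span (Set.range g)) : extendedPullback q ∈ Ideal.span (Set.range g) := by
    by_cases h0 : q = 0
    · rw [h0, map_zero]; exact zero_mem _
    obtain ⟨b, hb⟩ := MvPolynomial.ne_zero_iff.mp h0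
    -- The monomial b is a reference: multiplying by powers of η_N taken from b avoids negative
    -- exponents.
    have e : X (Fin.last (n + 2)) ^ b (Fin.last (n + 2)) * extendedPullback q =
        X (Fin.last (n + 2)) ^ (b 0 + b 1) * q := by
      conv_lhs => rw [q.as_sum]
      conv_rhs => rw [q.as_sum]
      rw [map_sum, Finset.mul_sum, Finset.mul_sum]
      refine Finset.sum_congr rfl fun a ha ↦ ?_
      obtain ⟨h1, -⟩ := H.exponent_sub a b ((hq (mem_support_iff.mp ha)).trans (hq hb).symm)
      rw [extendedPullback_monomial, X_pow_eq_monomial, X_pow_eq_monomial, monomial_mul,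
        monomial_mul, one_mul]
      refine congrArg (fun s ↦ monomial s (coeff a q)) (Finsupp.ext fun i ↦ ?_)
      refine Fin.lastCases ?_ (fun i ↦ ?_) i
      · simp only [Finsupp.add_apply, Finsupp.single_eq_same, shiftExponent_last]
        omega
      · simp only [Finsupp.add_apply, shiftExponent_castSucc]
        rw [Finsupp.single_eq_of_ne (Fin.castSucc_lt_last i).ne,
          Finsupp.single_eq_of_ne (Fin.castSucc_lt_last i).ne]
    have := Ideal.mul_mem_left _ (X (Fin.last (n + 2)) ^ (b 0 + b 1)) hqG
    rw [← e] at this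
    exact (H.isPrime.mem_or_mem this).resolve_left fun h ↦
      H.X_notMem _ (H.isPrime.mem_of_pow_mem _ h)
  suffices h : contractedIdeal g ≤ (Ideal.span (Set.range g)).comap extendedPullback from h hp
  rw [contractedIdeal, Ideal.span_le]
  rintro q (hq | rfl)
  · rw [SetLike.mem_coe, Ideal.mem_comap]
    have hq' := Ideal.subset_span hq
    rw [← sum_image_weightedHomogeneousComponent w q, map_sum]
    exact Ideal.sum_mem _ fun d _ ↦ key _ d
      (weightedHomogeneousComponent_isWeightedHomogeneous d q) (H.component_mem _ hq' d)
  · rw [SetLike.mem_coe, Ideal.mem_comap, map_sub, extendedPullback_X_last, map_one, sub_self]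
    exact zero_mem _

/-- The ideal is generated by w-homogeneous elements of (g) and by η_N - 1. The former are
homogeneous for the contracted degrees too, by `exponent_sub`, and the latter has degree zero. -/
lemma contractedIdeal_component_mem {p : MvPolynomial (Fin (n + 3)) A} (hp : p ∈ contractedIdeal g)
    (d : Fin r' → ℤ) : weightedHomogeneousComponent (contractedDegrees w') d p ∈ contractedIdeal g := by
  classical
  let _ := weightedGradedAlgebra A (contractedDegrees w')
  let T : Set (MvPolynomial (Fin (n + 3)) A) :=
    {q | q ∈ Ideal.span (Set.range g) ∧ ∃ d, IsWeightedHomogeneous w q d} ∪ {X (Fin.last (n + 2)) - 1}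
  have hT : contractedIdeal g = Ideal.span T := by
    apply le_antisymm
    · rw [contractedIdeal, Ideal.span_le]
      rintro q (hq | rfl)
      · rw [← sum_image_weightedHomogeneousComponent w q]
        exact Ideal.sum_mem _ fun d _ ↦ Ideal.subset_span (Or.inl
          ⟨H.component_mem _ (Ideal.subset_span hq) d, d,
            weightedHomogeneousComponent_isWeightedHomogeneous d q⟩)
      · exact Ideal.subset_span (Or.inr rfl)
    · rw [Ideal.span_le]
      rintro q (⟨hq, -⟩ | rfl)
      · exact Ideal.span_mono Set.subset_union_left hq
      · exact Ideal.subset_span (Or.inr rfl)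
  have hhom : (contractedIdeal g).IsHomogeneous
      (weightedHomogeneousSubmodule A (contractedDegrees w')) := by
    rw [hT]
    refine Ideal.homogeneous_span _ _ ?_
    rintro q (⟨-, d, hq⟩ | rfl)
    · by_cases h0 : q = 0
      · exact ⟨0, h0 ▸ Submodule.zero_mem _⟩
      obtain ⟨b, hb⟩ := MvPolynomial.ne_zero_iff.mp h0
      exact ⟨Finsupp.weight (contractedDegrees w') b, fun a ha ↦
        (H.exponent_sub a b ((hq ha).trans (hq hb).symm)).2⟩
    · refine ⟨0, Submodule.sub_mem _ ?_ (isWeightedHomogeneous_one A _)⟩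
      have := isWeightedHomogeneous_X A (contractedDegrees w') (Fin.last (n + 2))
      rwa [contractedDegrees, Fin.snoc_last] at this
  exact weightedHomogeneousComponent_mem_of_mem A _ hhom hp d

end IsContractionGrading

end Contraction

end CoxModel

namespace CoxModel

/-- A unit of the localization, which is not the zero ring, has a nonzero numerator, so the graded
piece containing this numerator must contain a monomial. -/
lemma exists_weight_eq_of_hasHomogeneousUnit {A : Type u} [CommRing A] {σ : Type} {r : ℕ}
    {w : σ → Fin r → ℤ} {G : Ideal (MvPolynomial σ A)} {a : σ →₀ ℕ}
    (ha : ¬ IsNilpotent (monomialElement w G a).val) {e : Fin r → ℤ}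
    (he : (monomialElement w G a).HasHomogeneousUnit e) :
    ∃ (b : σ →₀ ℕ) (k : ℕ), Finsupp.weight w b = e + k • Finsupp.weight w a := by
  set f := monomialElement w G a
  obtain ⟨u, ⟨k, c, hc, hu⟩, v, -, huv⟩ := he
  by_contra! hcon
  have h0 : quotGrading w G (e + k • Finsupp.weight w a) ≤ ⊥ :=
    quotGrading_le fun b hb ↦ absurd hb (hcon b k)
  have hc0 : c = 0 := (Submodule.mem_bot A).mp (h0 hc)
  have hf : IsUnit (algebraMap _ (Localization.Away f.val) (f.val ^ k)) := by
    rw [map_pow]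
    exact (IsLocalization.Away.algebraMap_isUnit f.val).pow k
  rw [hc0, map_zero] at hu
  have hu0 : u = 0 := hf.mul_left_eq_zero.mp hu
  rw [hu0, zero_mul] at huv
  have hs : Subsingleton (Localization.Away f.val) := subsingleton_of_zero_eq_one huv
  obtain ⟨N, hN⟩ := (IsLocalization.subsingleton_iff (M := Submonoid.powers f.val)
    (S := Localization.Away f.val)).mp hs
  exact ha ⟨N, hN⟩

namespace IsContractionGrading

variable {A : Type u} [CommRing A] {n r r' l : ℕ}
  {w : Fin (n + 3) → Fin r → ℤ} {w' : Fin (n + 2) → Fin r' → ℤ}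
  {g : Fin l → MvPolynomial (Fin (n + 3)) A} (H : IsContractionGrading w w' g)

/-- The pull-back of sections as a homomorphism from `R ⧸ (η_N - 1)` to `R`. -/
noncomputable def pull : (MvPolynomial (Fin (n + 3)) A ⧸ contractedIdeal g) →ₐ[A]
    MvPolynomial (Fin (n + 3)) A ⧸ Ideal.span (Set.range g) :=
  Ideal.Quotient.liftₐ _ ((Ideal.Quotient.mkₐ A _).comp extendedPullback) fun _ hp ↦
    Ideal.Quotient.eq_zero_iff_mem.mpr (H.extendedPullback_mem hp)

lemma pull_mk (p : MvPolynomial (Fin (n + 3)) A) :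
    H.pull (Ideal.Quotient.mk _ p) = Ideal.Quotient.mk _ (extendedPullback p) := rfl

lemma pull_mk_monomial (b : Fin (n + 3) →₀ ℕ) :
    H.pull (Ideal.Quotient.mk _ (monomial b 1)) =
      Ideal.Quotient.mk _ (monomial (shiftExponent b) 1) := by
  rw [pull_mk, extendedPullback_monomial]

lemma pull_mk_monomial_ne_zero (b : Fin (n + 3) →₀ ℕ) :
    H.pull (Ideal.Quotient.mk _ (monomial b 1)) ≠ 0 := by
  rw [pull_mk_monomial, Ne, Ideal.Quotient.eq_zero_iff_mem]
  exact H.monomial_notMem _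

/-- Followed by the projection from R to R ⧸ (η_N - 1) = R', the pull-back is the identity. -/
lemma pull_injective : Function.Injective H.pull := by
  have hle : Ideal.span (Set.range g) ≤ contractedIdeal g :=
    Ideal.span_mono Set.subset_union_left
  have hlast : Ideal.Quotient.mk (contractedIdeal g) (X (Fin.last (n + 2))) = 1 := by
    rw [← map_one (Ideal.Quotient.mk (contractedIdeal g)), Ideal.Quotient.eq]
    exact Ideal.subset_span (Or.inr rfl)
  have h : ((Ideal.Quotient.factorₐ A hle).comp H.pull).comp (Ideal.Quotient.mkₐ A _) =
      Ideal.Quotient.mkₐ A _ := by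
    ext i
    change Ideal.Quotient.mk (contractedIdeal g) (extendedPullback (X i)) =
      Ideal.Quotient.mk (contractedIdeal g) (X i)
    refine Fin.lastCases ?_ (fun i ↦ ?_) i
    · rw [extendedPullback_X_last, hlast, map_one]
    · rw [extendedPullback_X_castSucc, pullbackSections_X, map_mul]
      split_ifs
      · rw [hlast, mul_one]
      · rw [map_one, mul_one]
  intro x y hxy
  obtain ⟨x, rfl⟩ := Ideal.Quotient.mk_surjective x
  obtain ⟨y, rfl⟩ := Ideal.Quotient.mk_surjective y
  have hx := DFunLike.congr_fun h x
  have hy := DFunLike.congr_fun h y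
  change Ideal.Quotient.factorₐ A hle (H.pull (Ideal.Quotient.mk _ x)) = Ideal.Quotient.mk _ x at hx
  change Ideal.Quotient.factorₐ A hle (H.pull (Ideal.Quotient.mk _ y)) = Ideal.Quotient.mk _ y at hy
  rw [← hx, hxy, hy]

include H

lemma not_isNilpotent (b : Fin (n + 3) →₀ ℕ) :
    ¬ IsNilpotent (monomialElement (contractedDegrees w') (contractedIdeal g) b).val := by
  rintro ⟨N, hN⟩
  have := H.isPrime
  exact pow_ne_zero N (H.pull_mk_monomial_ne_zero b)
    ((map_pow H.pull _ N).symm.trans ((congrArg H.pull hN).trans (map_zero _)))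

/-- By (∗) for R', every degree is a difference of degrees of monomials, and η_N contributes
nothing. -/
lemma exists_sum_eq' {ι : Type} [Nonempty ι] {a' : ι → Fin (n + 3) →₀ ℕ}
    (h : HasAllUnits (generators (contractedDegrees w') (contractedIdeal g) a'))
    (e : Fin r' → ℤ) : ∃ c : Fin (n + 2) → ℤ, ∑ i, c i • w' i = e := by
  obtain ⟨j⟩ := ‹Nonempty ι›
  obtain ⟨b, k, hb⟩ := exists_weight_eq_of_hasHomogeneousUnit (H.not_isNilpotent (a' j)) (h j e)
  refine ⟨fun i ↦ b i.castSucc - k * a' j i.castSucc, ?_⟩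
  rw [weight_contractedDegrees, weight_contractedDegrees] at hb
  simp only [sub_smul, mul_smul, Finset.sum_sub_distrib, ← Finset.smul_sum, hb]
  simp

/-- The pull-back of divisor classes: prescribed on the generators w', it is well defined because
relations between them pull back to relations. -/
lemma exists_degreeHom (hw' : ∀ e, ∃ c : Fin (n + 2) → ℤ, ∑ i, c i • w' i = e) :
    ∃ τ : (Fin r' → ℤ) →+ (Fin r → ℤ), ∀ c : Fin (n + 2) → ℤ, τ (∑ i, c i • w' i) =
      ∑ i : Fin (n + 2), c i • w i.castSucc + (c 0 + c 1) • w (Fin.last (n + 2)) := by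
  let Φ : (Fin (n + 2) → ℤ) →+ (Fin r → ℤ) :=
    AddMonoidHom.mk' (fun c ↦ ∑ i : Fin (n + 2), c i • w i.castSucc +
      (c 0 + c 1) • w (Fin.last (n + 2))) fun c d ↦ by
        simp only [Pi.add_apply, add_smul, Finset.sum_add_distrib]
        abel
  let Φ' : (Fin (n + 2) → ℤ) →+ (Fin r' → ℤ) :=
    AddMonoidHom.mk' (fun c ↦ ∑ i, c i • w' i) fun c d ↦ by
      simp only [Pi.add_apply, add_smul, Finset.sum_add_distrib]
  have hs : Function.RightInverse (Function.surjInv hw') Φ' :=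
    Function.rightInverse_surjInv hw'
  exact ⟨Φ'.liftOfRightInverse _ hs ⟨Φ, fun c hc ↦ H.relation' c hc⟩,
    fun c ↦ Φ'.liftOfRightInverse_comp_apply _ hs _ c⟩

/-- All conditions are checked on monomials, where `exponent_eq` turns conditions on degrees into
equations between the exponents of η₁, η₂ and η_N. -/
lemma exists_contractionDatum (hw' : ∀ e, ∃ c : Fin (n + 2) → ℤ, ∑ i, c i • w' i = e) :
    ∃ ρ : GradedHom (quotGrading w (Ideal.span (Set.range g)))
        (quotGrading (contractedDegrees w') (contractedIdeal g)),
      ρ.toAlgHom = H.pull ∧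
      (∀ i : Fin (n + 2), ρ.deg (w' i) = w i.castSucc + if i = 0 ∨ i = 1 then w (Fin.last (n + 2)) else 0) ∧
      IsContractionDatum ρ
        (fun k : Fin 2 ↦ monomialElement _ _ (Finsupp.single ((![0, 1] : Fin 2 → Fin (n + 2)) k).castSucc 1))
        (fun k : Fin 2 ↦ monomialElement _ _ (Finsupp.single ((![0, 1] : Fin 2 → Fin (n + 2)) k).castSucc 1))
        (monomialElement _ _ (Finsupp.single (Fin.last (n + 2)) 1)) := by
  obtain ⟨τ, hτ⟩ := H.exists_degreeHom hw'
  have hτw (i : Fin (n + 2)) : τ (w' i) =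
      w i.castSucc + if i = 0 ∨ i = 1 then w (Fin.last (n + 2)) else 0 := by
    have := hτ (Pi.single i 1)
    simp only [Pi.single_apply, ite_smul, one_smul, zero_smul, Finset.sum_ite_eq',
      Finset.mem_univ, if_true] at this
    rw [this]
    congr 1
    by_cases h0 : i = 0
    · subst h0
      simp
    · by_cases h1 : i = 1
      · subst h1
        simp
      · simp [h0, h1, Ne.symm h0, Ne.symm h1]
  have hk (k : Fin 2) : (![0, 1] : Fin 2 → Fin (n + 2)) k = 0 ∨ (![0, 1] : Fin 2 → Fin (n + 2)) k = 1 := by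
    fin_cases k <;> simp
  have hshift (b : Fin (n + 3) →₀ ℕ) : Finsupp.weight w (shiftExponent b) =
      τ (Finsupp.weight (contractedDegrees w') b) := by
    rw [weight_contractedDegrees, hτ, weight_eq_sum, Fin.sum_univ_castSucc]
    simp [shiftExponent_castSucc, shiftExponent_last]
  refine ⟨⟨H.pull, τ, fun d x hx ↦ ?_⟩, rfl, hτw, ⟨H.pull_injective, ?_, ?_, ?_, ?_, ?_⟩⟩
  · have : quotGrading (contractedDegrees w') (contractedIdeal g) d ≤
        (quotGrading w (Ideal.span (Set.range g)) (τ d)).comap H.pull.toLinearMap :=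
      quotGrading_le fun b hb ↦ by
        rw [Submodule.mem_comap]
        change H.pull (Ideal.Quotient.mk _ (monomial b 1)) ∈ quotGrading w _ (τ d)
        rw [pull_mk_monomial]
        exact mk_monomial_mem_quotGrading _ (by rw [hshift, hb])
    exact this hx
  · exact fun k h ↦ H.monomial_notMem _ (Ideal.Quotient.eq_zero_iff_mem.mp h)
  · exact fun h ↦ H.monomial_notMem _ (Ideal.Quotient.eq_zero_iff_mem.mp h)
  · intro k
    refine ext_val_deg ?_ ?_
    · change Ideal.Quotient.mk _ (X _) * Ideal.Quotient.mk _ (X _) =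
        Ideal.Quotient.mk _ (extendedPullback (X _))
      rw [extendedPullback_X_castSucc, pullbackSections_X, if_pos (hk k), map_mul]
    · change Finsupp.weight w _ + Finsupp.weight w _ = τ (Finsupp.weight (contractedDegrees w') _)
      rw [Finsupp.weight_single, Finsupp.weight_single, Finsupp.weight_single, one_smul, one_smul,
        one_smul, contractedDegrees, Fin.snoc_castSucc, hτw, if_pos (hk k)]
  · intro d h hh
    obtain ⟨c, rfl⟩ := hw' d
    suffices hle : quotGrading w (Ideal.span (Set.range g)) (τ (∑ i, c i • w' i)) ≤
        (quotGrading (contractedDegrees w') (contractedIdeal g) (∑ i, c i • w' i)).map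
          H.pull.toLinearMap from hle hh
    refine quotGrading_le fun b hb ↦ ⟨Ideal.Quotient.mk _ (monomial b 1), ?_, ?_⟩
    · exact mk_monomial_mem_quotGrading _ (H.exponent_eq b c 0 (by rw [hb, hτ, sub_zero])).2
    · refine (H.pull_mk_monomial b).trans ?_
      -- For k = 0 the exponent of η_N is the sum of those of η₁ and η₂, so the monomial is its own
      -- pull-back.
      have h1 := (H.exponent_eq b c 0 (by rw [hb, hτ, sub_zero])).1
      refine congrArg (fun s ↦ Ideal.Quotient.mk _ (monomial s 1)) (Finsupp.ext fun i ↦ ?_)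
      refine Fin.lastCases ?_ (fun i ↦ ?_) i
      · rw [shiftExponent_last]; omega
      · rw [shiftExponent_castSucc]
  · intro d N h hh
    obtain ⟨c, rfl⟩ := hw' d
    have htd : (monomialElement w (Ideal.span (Set.range g))
        (Finsupp.single (Fin.last (n + 2)) 1)).deg = w (Fin.last (n + 2)) := by
      change Finsupp.weight w _ = _
      rw [Finsupp.weight_single, one_smul]
    rw [htd] at hh ⊢
    refine quotGrading_le (fun b hb ↦ ?_) hh
    change _ = τ _ - _ at hb
    -- Now b_N + N + 1 = b_1 + b_2, so η₁ or η₂ divides the monomial. The quotient has the degree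
    -- required by `mem_span`, as deg η_k = τ (deg' η_k) - e_N.
    have h1 := (H.exponent_eq b c (N + 1) (by
      rw [hb, hτ, sub_smul]
      have : ((N : ℤ) + 1) • w (Fin.last (n + 2)) = (N + 1) • w (Fin.last (n + 2)) := by
        rw [← natCast_zsmul]; push_cast; rfl
      rw [this]
      abel)).1
    obtain ⟨k, hbk⟩ : ∃ k, b ((![0, 1] : Fin 2 → Fin (n + 2)) k).castSucc ≠ 0 := by
      by_contra! h0
      have e0 := h0 0
      have e1 := h0 1
      simp only [Matrix.cons_val_zero, Matrix.cons_val_one, Fin.castSucc_zero, Fin.castSucc_one] at e0 e1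
      omega
    set i := ((![0, 1] : Fin 2 → Fin (n + 2)) k).castSucc with hi
    have hbi : Finsupp.single i 1 + (b - Finsupp.single i 1) = b :=
      add_tsub_cancel_of_le (Finsupp.single_le_iff.mpr (Nat.one_le_iff_ne_zero.mpr hbk))
    have hmem : Ideal.Quotient.mk (Ideal.span (Set.range g)) (monomial (b - Finsupp.single i 1) 1) ∈
        quotGrading w (Ideal.span (Set.range g)) (τ (∑ i, c i • w' i -
          (monomialElement (contractedDegrees w') (contractedIdeal g) (Finsupp.single i 1)).deg) -
            N • w (Fin.last (n + 2))) := by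
      refine mk_monomial_mem_quotGrading _ ?_
      have h2 := congrArg (Finsupp.weight w) hbi
      rw [map_add, Finsupp.weight_single, one_smul, hb] at h2
      change _ = τ (_ - Finsupp.weight (contractedDegrees w') _) - _
      rw [Finsupp.weight_single, one_smul, hi, contractedDegrees, Fin.snoc_castSucc, map_sub, hτw,
        if_pos (hk k), ← hi, eq_sub_of_add_eq' h2, succ_nsmul]
      abel
    refine Submodule.subset_span ⟨k, _, hmem, ?_⟩
    change _ = Ideal.Quotient.mk _ (monomial (Finsupp.single i 1) 1) * _
    rw [← map_mul, monomial_mul, one_mul, hbi]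

/-- The model of a surface is a blowing-up of the model of its contraction. -/
theorem isBlowupAlong {ι ι' : Type} [Nonempty ι] [Finite ι'] {a : ι → Fin (n + 3) →₀ ℕ}
    {a' : ι' → Fin (n + 2) →₀ ℕ} (hrad : (idealC a g).radical = (idealC' a' g).radical)
    (hunits : HasAllUnits (generators w (Ideal.span (Set.range g)) a))
    (hunits' : HasAllUnits (generators (contractedDegrees w') (contractedIdeal g)
      fun j ↦ (a' j).mapDomain Fin.castSucc)) :
    IsBlowupAlong hunits.hasUnits hunits'.hasUnits
      {Ideal.Quotient.mk (contractedIdeal g) (MvPolynomial.X 0),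
        Ideal.Quotient.mk (contractedIdeal g) (MvPolynomial.X 1)} := by
  have := H.isPrime
  -- Otherwise the second ideal is the prime ideal (g), whose radical would contain a monomial.
  -- Nonemptiness is needed to extract information from (∗) for R'.
  have : Nonempty ι' := by
    by_contra hι'
    rw [not_nonempty_iff] at hι'
    have hC' : idealC' a' g = Ideal.span (Set.range g) := by
      simp only [idealC', Set.range_eq_empty, Set.empty_union]
    obtain ⟨j⟩ := ‹Nonempty ι›
    have : monomial (a j) 1 ∈ (idealC a g).radical :=
      Ideal.le_radical (Ideal.subset_span (Or.inl ⟨j, rfl⟩))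
    rw [hrad, hC', H.isPrime.radical] at this
    exact H.monomial_notMem _ this
  have hw' := H.exists_sum_eq' hunits'
  obtain ⟨ρ, hρ, hρw, hD⟩ := H.exists_contractionDatum hw'
  let _ := gradedAlgebraQuotGrading H.component_mem
  let _ := gradedAlgebraQuotGrading (w := contractedDegrees w')
    fun p hp d ↦ H.contractedIdeal_component_mem hp d
  set η : Fin 2 → HomogeneousElement (quotGrading (contractedDegrees w') (contractedIdeal g)) :=
    fun k ↦ monomialElement _ _ (Finsupp.single ((![0, 1] : Fin 2 → Fin (n + 2)) k).castSucc 1)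
  set y : Fin 2 → HomogeneousElement (quotGrading w (Ideal.span (Set.range g))) :=
    fun k ↦ monomialElement _ _ (Finsupp.single ((![0, 1] : Fin 2 → Fin (n + 2)) k).castSucc 1)
  set f' := generators (contractedDegrees w') (contractedIdeal g) fun j ↦ (a' j).mapDomain Fin.castSucc
  have hdeg (k : Fin 2) : (y k).deg = w ((![0, 1] : Fin 2 → Fin (n + 2)) k).castSucc := by
    change Finsupp.weight w _ = _
    rw [Finsupp.weight_single, one_smul]
  have hk (k : Fin 2) : (![0, 1] : Fin 2 → Fin (n + 2)) k = 0 ∨ (![0, 1] : Fin 2 → Fin (n + 2)) k = 1 := by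
    fin_cases k <;> simp
  -- The degrees of units on this chart form a group containing the image of ρ and deg η_k, hence
  -- e_N = ρ (deg' η_k) - deg η_k, and therefore the degrees of all the variables.
  have hF : HasAllUnits fun i : ι' × Fin 2 ↦ (ρ.map (f' i.1)).mul (y i.2) := by
    rintro ⟨j, k⟩ e
    set F := (ρ.map (f' j)).mul (y k)
    have hρF : (ρ.map (f' j)).Divides F := (ρ.map (f' j)).divides_mul (y k)
    have hyF : (y k).Divides F := ((y k).divides_mul _).trans (mul_divides_swap _ _)
    have h1 (d) : ρ.deg d ∈ F.unitDegrees := (hunits' j d).awayMap ρ hρF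
    have h2 : w ((![0, 1] : Fin 2 → Fin (n + 2)) k).castSucc ∈ F.unitDegrees :=
      hdeg k ▸ hasHomogeneousUnit_of_divides hyF
    have h3 : w (Fin.last (n + 2)) ∈ F.unitDegrees := by
      have := h1 (w' ((![0, 1] : Fin 2 → Fin (n + 2)) k))
      rw [hρw, if_pos (hk k)] at this
      exact (F.unitDegrees.add_mem_cancel_left h2).mp this
    have h4 (i : Fin (n + 2)) : w i.castSucc ∈ F.unitDegrees := by
      have := h1 (w' i)
      rw [hρw] at this
      refine (F.unitDegrees.add_mem_cancel_right ?_).mp this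
      split_ifs
      exacts [h3, zero_mem _]
    obtain ⟨c, rfl⟩ := H.exists_sum_eq e
    exact F.unitDegrees.sum_mem fun i _ ↦ F.unitDegrees.zsmul_mem
      (Fin.lastCases (motive := fun i ↦ w i ∈ F.unitDegrees) h3 h4 i) _
  have hblow := hD.isBlowupAlong hunits'
    (fun j ↦ by rw [hρ]; exact H.pull_mk_monomial_ne_zero _) hF
  have hset : (Set.range fun k ↦ (η k).val) = {Ideal.Quotient.mk (contractedIdeal g) (X 0),
      Ideal.Quotient.mk (contractedIdeal g) (X 1)} := by
    ext z
    simp only [Set.mem_range, Fin.exists_fin_two, Set.mem_insert_iff, Set.mem_singleton_iff]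
    exact or_congr eq_comm eq_comm
  rw [hset] at hblow
  have hFval (j : ι') (k : Fin 2) : ((ρ.map (f' j)).mul (y k)).val =
      Ideal.Quotient.mk _ (pullbackSections (monomial (a' j) 1) *
        X ((![0, 1] : Fin 2 → Fin (n + 2)) k).castSucc) := by
    change ρ.toAlgHom (Ideal.Quotient.mk _ (monomial ((a' j).mapDomain Fin.castSucc) 1)) *
      Ideal.Quotient.mk _ (X _) = _
    rw [hρ, pull_mk, ← rename_monomial, extendedPullback_rename, map_mul]
  refine isBlowupAlong_of_radical hunits hF (fun i ↦ ?_) ?_ hblow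
  · have h1 : monomial (a i) 1 ∈ (idealC' a' g).radical :=
      hrad ▸ Ideal.le_radical (Ideal.subset_span (Or.inl ⟨i, rfl⟩))
    have h2 : idealC' a' g ≤ (Ideal.span (Set.range fun j : ι' × Fin 2 ↦
        ((ρ.map (f' j.1)).mul (y j.2)).val)).comap (Ideal.Quotient.mk _) := by
      rw [idealC', Ideal.span_le]
      rintro p ((⟨j, rfl⟩ | ⟨j, rfl⟩) | hp)
      · exact Ideal.subset_span ⟨(j, 0), hFval j 0⟩
      · exact Ideal.subset_span ⟨(j, 1), hFval j 1⟩
      · rw [SetLike.mem_coe, Ideal.mem_comap,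
          Ideal.Quotient.eq_zero_iff_mem.mpr (Ideal.subset_span hp)]
        exact zero_mem _
    have h3 := Ideal.radical_mono h2 h1
    rw [← Ideal.comap_radical] at h3
    exact h3
  · rintro ⟨j, k⟩
    have h1 : pullbackSections (monomial (a' j) 1) *
        X ((![0, 1] : Fin 2 → Fin (n + 2)) k).castSucc ∈ (idealC a g).radical := by
      rw [hrad]
      refine Ideal.le_radical (Ideal.subset_span (Or.inl ?_))
      fin_cases k
      exacts [Or.inl ⟨j, rfl⟩, Or.inr ⟨j, rfl⟩]
    have h2 : idealC a g ≤ (Ideal.span (Set.range fun i ↦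
        (generators w (Ideal.span (Set.range g)) a i).val)).comap (Ideal.Quotient.mk _) := by
      rw [idealC, Ideal.span_le]
      rintro p (⟨j, rfl⟩ | hp)
      · exact Ideal.subset_span ⟨j, rfl⟩
      · rw [SetLike.mem_coe, Ideal.mem_comap,
          Ideal.Quotient.eq_zero_iff_mem.mpr (Ideal.subset_span hp)]
        exact zero_mem _
    have h3 := Ideal.radical_mono h2 h1
    rw [← Ideal.comap_radical] at h3
    exact (hFval j k) ▸ h3

end IsContractionGrading

end CoxModel

namespace CoxModel

/-! ### Factoriality of local rings with a maximal ideal generated by two elements. -/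

section LocalRings

open IsLocalRing

/-- In a noetherian local ring whose maximal ideal is generated by `X` and `Y`, every ideal not
contained in `(X)` is, modulo `X`, generated by a power of `Y`. -/
lemma exists_sup_span_eq_span_pow_sup {O : Type*} [CommRing O] [IsNoetherianRing O] [IsLocalRing O]
    {X Y : O} (h : maximalIdeal O = Ideal.span {X, Y}) {p : Ideal O}
    (hp : ¬ p ≤ Ideal.span {X}) :
    ∃ k : ℕ, p ⊔ Ideal.span {X} = Ideal.span {Y ^ k} ⊔ Ideal.span {X} := by
  have hX : X ∈ maximalIdeal O := h ▸ Ideal.subset_span (by simp)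
  have : Nontrivial (O ⧸ Ideal.span {X}) :=
    Ideal.Quotient.nontrivial_iff.mpr fun e ↦ (Ideal.span_singleton_le_iff_mem _).mpr hX |>.not_gt
      (e ▸ (maximalIdeal.isMaximal O).ne_top.lt_top)
  set φ := Ideal.Quotient.mk (Ideal.span {X})
  have : IsLocalRing (O ⧸ Ideal.span {X}) :=
    .of_surjective' φ Ideal.Quotient.mk_surjective
  -- Krull's intersection theorem in O ⧸ (X): an ideal contained in (Y ^ k, X) for all k is
  -- contained in (X).
  have key : ⨅ i : ℕ, (Ideal.span {φ Y}) ^ i = ⊥ := by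
    refine Ideal.iInf_pow_eq_bot_of_isLocalRing _ fun e ↦ ?_
    have h1 : IsUnit (φ Y) := Ideal.span_singleton_eq_top.mp e
    have h2 : IsLocalHom φ := IsLocalHom.of_surjective φ Ideal.Quotient.mk_surjective
    have h3 : Y ∈ maximalIdeal O := h ▸ Ideal.subset_span (by simp)
    exact (mem_maximalIdeal _).mp h3 (isUnit_of_map_unit φ Y h1)
  have hmem : ∀ (k : ℕ) (b : O), φ b ∈ Ideal.span {φ Y} ^ k ↔
      b ∈ Ideal.span {Y ^ k} ⊔ Ideal.span {X} := by
    intro k b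
    rw [Ideal.span_singleton_pow, ← map_pow, ← Set.image_singleton, ← Ideal.map_span,
      ← Ideal.mem_comap, Ideal.comap_map_of_surjective' _ Ideal.Quotient.mk_surjective,
      Ideal.mk_ker]
  have hex : ∃ k : ℕ, ¬ p ≤ Ideal.span {Y ^ k} ⊔ Ideal.span {X} := by
    by_contra! hc
    refine hp fun b hb ↦ Ideal.Quotient.eq_zero_iff_mem.mp ?_
    rw [← Ideal.mem_bot, ← key]
    exact (Submodule.mem_iInf _).mpr fun k ↦ (hmem k b).mpr (hc k hb)
  classical
  -- The least exponent for which the inclusion fails is positive, and the desired k is its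
  -- predecessor.
  obtain ⟨k, hk⟩ : ∃ k, Nat.find hex = k + 1 := by
    refine Nat.exists_eq_succ_of_ne_zero fun h0 ↦ ?_
    have := Nat.find_spec hex
    rw [h0, pow_zero, Ideal.span_singleton_one, top_sup_eq] at this
    exact this le_top
  have hle : p ≤ Ideal.span {Y ^ k} ⊔ Ideal.span {X} := by
    by_contra hc
    exact Nat.find_min hex (by omega) hc
  refine ⟨k, le_antisymm (sup_le hle le_sup_right) (sup_le ?_ le_sup_right)⟩
  have hlt := Nat.find_spec hex
  rw [hk] at hlt
  obtain ⟨b, hb, hb'⟩ := Set.not_subset.mp hlt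
  obtain ⟨_, hy, x, hx, rfl⟩ := Submodule.mem_sup.mp (hle hb)
  obtain ⟨c, rfl⟩ := Ideal.mem_span_singleton'.mp hy
  -- If c were in (X, Y), then b would lie in (Y ^ (k + 1), X), contrary to its choice.
  have hc : IsUnit c := by
    by_contra hc
    have : c ∈ Ideal.span {X, Y} := h ▸ (mem_maximalIdeal _).mpr hc
    obtain ⟨u, v, rfl⟩ := Ideal.mem_span_pair.mp this
    refine hb' ?_
    have e : (u * X + v * Y) * Y ^ k + x = v * Y ^ (k + 1) + (u * Y ^ k * X + x) := by ring
    rw [e]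
    exact Submodule.add_mem_sup (Ideal.mul_mem_left _ _ (Ideal.mem_span_singleton_self _))
      (add_mem (Ideal.mul_mem_left _ _ (Ideal.mem_span_singleton_self _)) hx)
  rw [Ideal.span_singleton_le_iff_mem, ← Ideal.unit_mul_mem_iff_mem _ hc]
  have : c * Y ^ k = (c * Y ^ k + x) - x := by ring
  rw [this]
  exact sub_mem (Ideal.mem_sup_left hb) (Ideal.mem_sup_right hx)

/-- Modulo X, the ideal p is zero or generated by a power of Y; lift this generator to a ∈ p. As p
is prime and X ∉ p, a multiple of X in p lies in X p, so p = (a) + X p, and Nakayama's lemma gives p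
= (a). -/
lemma isPrincipal_of_maximalIdeal_eq_span_pair {O : Type*} [CommRing O] [IsNoetherianRing O]
    [IsLocalRing O] {X Y : O} (h : maximalIdeal O = Ideal.span {X, Y}) {p : Ideal O} [p.IsPrime]
    (hX : X ∉ p) : ∃ a, p = Ideal.span {a} := by
  have hXm : X ∈ maximalIdeal O := h ▸ Ideal.subset_span (by simp)
  have nak : ∀ I : Ideal O, p ≤ I ⊔ Ideal.span {X} * p → p ≤ I := fun I hI ↦ by
    refine Submodule.le_of_le_smul_of_le_jacobson_bot (I := Ideal.span {X})
      (IsNoetherian.noetherian p) ?_ hI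
    rw [jacobson_eq_maximalIdeal _ bot_ne_top]
    exact (Ideal.span_singleton_le_iff_mem _).mpr hXm
  by_cases hp : p ≤ Ideal.span {X}
  · refine ⟨0, le_antisymm (nak _ fun b hb ↦ ?_) (by simp)⟩
    obtain ⟨c, rfl⟩ := Ideal.mem_span_singleton'.mp (hp hb)
    have hc := (Ideal.IsPrime.mem_or_mem ‹_› hb).resolve_right hX
    rw [mul_comm c]
    exact Ideal.mem_sup_right (Ideal.mul_mem_mul (Ideal.mem_span_singleton_self _) hc)
  · obtain ⟨k, hk⟩ := exists_sup_span_eq_span_pow_sup h hp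
    have hY : Y ^ k ∈ p ⊔ Ideal.span {X} :=
      hk ▸ Ideal.mem_sup_left (Ideal.mem_span_singleton_self _)
    obtain ⟨a, ha, x, hx, hax⟩ := Submodule.mem_sup.mp hY
    have ha' : Ideal.span {a} ≤ p := (Ideal.span_singleton_le_iff_mem _).mpr ha
    refine ⟨a, le_antisymm (nak _ fun b hb ↦ ?_) ha'⟩
    have hb' : b ∈ Ideal.span {Y ^ k} ⊔ Ideal.span {X} := hk ▸ Ideal.mem_sup_left hb
    obtain ⟨_, hy, x', hx', rfl⟩ := Submodule.mem_sup.mp hb'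
    obtain ⟨c, rfl⟩ := Ideal.mem_span_singleton'.mp hy
    have e : c * Y ^ k + x' = c * a + (c * x + x') := by rw [← hax]; ring
    have hx'' : c * x + x' ∈ Ideal.span {X} := add_mem (Ideal.mul_mem_left _ _ hx) hx'
    obtain ⟨d, hd⟩ := Ideal.mem_span_singleton'.mp hx''
    have hdp : d * X ∈ p := by
      rw [e] at hb
      rw [hd]
      exact (Ideal.add_mem_iff_right _ (Ideal.mul_mem_left _ _ ha)).mp hb
    rw [e, ← hd, mul_comm d]
    exact Submodule.add_mem_sup (Ideal.mul_mem_left _ _ (Ideal.mem_span_singleton_self _))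
      (Ideal.mul_mem_mul (Ideal.mem_span_singleton_self _)
        ((Ideal.IsPrime.mem_or_mem ‹_› hdp).resolve_right hX))

/-- A noetherian local domain of dimension at least two whose maximal ideal is generated by two
elements is factorial. -/
theorem uniqueFactorizationMonoid_of_maximalIdeal_eq_span_pair {O : Type*} [CommRing O] [IsDomain O]
    [IsNoetherianRing O] [IsLocalRing O] {X Y : O} (h : maximalIdeal O = Ideal.span {X, Y})
    (hd : ¬ Ring.KrullDimLE 1 O) : UniqueFactorizationMonoid O := by
  have key : ∀ p : Ideal O, p ≠ ⊥ → p.IsPrime → p ≠ maximalIdeal O → ∃ x ∈ p, Prime x := by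
    intro p hp hpp hpm
    have : X ∉ p ∨ Y ∉ p := by
      by_contra! hc
      refine hpm (le_antisymm (le_maximalIdeal hpp.ne_top) ?_)
      rw [h, Ideal.span_le]
      rintro _ (rfl | rfl)
      exacts [hc.1, hc.2]
    obtain ⟨a, ha⟩ : ∃ a, p = Ideal.span {a} := by
      rcases this with hX | hY
      · exact isPrincipal_of_maximalIdeal_eq_span_pair h hX
      · exact isPrincipal_of_maximalIdeal_eq_span_pair (h.trans (by rw [Set.pair_comm])) hY
    subst ha
    refine ⟨a, Ideal.mem_span_singleton_self a, (Ideal.span_singleton_prime ?_).mp hpp⟩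
    rintro rfl
    simp at hp
  -- Kaplansky's criterion: every nonzero prime ideal contains a prime element. For a nonmaximal
  -- prime ideal it is a generator; the maximal ideal contains a smaller nonzero prime ideal, since
  -- the dimension is at least two.
  rw [UniqueFactorizationMonoid.iff_exists_prime_mem_of_isPrime]
  intro p hp hpp
  by_cases hpm : p = maximalIdeal O
  · rw [Ring.krullDimLE_one_iff_of_noZeroDivisors] at hd
    push Not at hd
    obtain ⟨q, hq, hqp, hqm⟩ := hd
    obtain ⟨x, hx, hx'⟩ := key q hq hqp fun e ↦ hqm (e ▸ maximalIdeal.isMaximal O)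
    exact ⟨x, hpm ▸ le_maximalIdeal hqp.ne_top hx, hx'⟩
  · exact key p hp hpp hpm

lemma exists_maximalIdeal_eq_span_pair_of_spanFinrank_le {O : Type*} [CommRing O]
    [IsNoetherianRing O] [IsLocalRing O] (h : (maximalIdeal O).spanFinrank ≤ 2) :
    ∃ x y : O, maximalIdeal O = Ideal.span {x, y} := by
  have hfg : (maximalIdeal O).FG := IsNoetherian.noetherian _
  have hfin := Submodule.FG.finite_generators hfg
  have hs : Ideal.span (maximalIdeal O).generators = maximalIdeal O :=
    Submodule.span_generators (maximalIdeal O)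
  rw [← Submodule.FG.generators_ncard hfg] at h
  rcases Nat.lt_or_ge (Submodule.generators (maximalIdeal O)).ncard 2 with h1 | h2
  · rcases (Set.ncard_le_one_iff_eq hfin).mp (Nat.le_of_lt_succ h1) with h0 | ⟨x, hx⟩
    · exact ⟨0, 0, by rw [← hs, h0]; simp⟩
    · exact ⟨x, x, by rw [← hs, hx]; simp⟩
  · obtain ⟨x, y, -, hxy⟩ := Set.ncard_eq_two.mp (le_antisymm h h2)
    exact ⟨x, y, by rw [← hxy, hs]⟩

/-- Étale homomorphisms are unramified, so the maximal ideal is generated by that of a local ring of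
the affine plane, which is regular of dimension at most two. -/
lemma exists_maximalIdeal_eq_span_pair_of_etale {k R O : Type*} [Field k] [CommRing R]
    [CommRing O] [IsLocalRing O] [Algebra R O] (q : Ideal R) [q.IsPrime]
    [IsLocalization.AtPrime O q] (f : MvPolynomial (Fin 2) k →+* R) (hf : f.Etale) :
    ∃ x y : O, maximalIdeal O = Ideal.span {x, y} := by
  algebraize [f]
  let p := q.comap f
  have : q.LiesOver p := ⟨rfl⟩
  let _ := Localization.AtPrime.algebraOfLiesOver p q
  have h1 := ((Algebra.isUnramifiedAt_iff_map_eq (MvPolynomial (Fin 2) k) p q).mp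
    inferInstance).2
  obtain ⟨x, y, hxy⟩ : ∃ x y : Localization.AtPrime p,
      maximalIdeal (Localization.AtPrime p) = Ideal.span {x, y} := by
    apply exists_maximalIdeal_eq_span_pair_of_spanFinrank_le
    have : IsRegularLocalRing (Localization.AtPrime p) := inferInstance
    have h := this.spanFinrank_maximalIdeal
    have h2 : ringKrullDim (Localization.AtPrime p) ≤ 2 := by
      rw [IsLocalization.AtPrime.ringKrullDim_eq_height p]
      refine (Ideal.height_le_ringKrullDim_of_ne_top Ideal.IsPrime.ne_top').trans ?_
      rw [MvPolynomial.ringKrullDim_of_isNoetherianRing, ringKrullDim_eq_zero_of_field]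
      simp
    rw [← h] at h2
    exact_mod_cast h2
  let e := (IsLocalization.algEquiv q.primeCompl (Localization.AtPrime q) O).toRingEquiv
  let φ : Localization.AtPrime p →+* O :=
    e.toRingHom.comp (algebraMap (Localization.AtPrime p) (Localization.AtPrime q))
  refine ⟨φ x, φ y, ?_⟩
  rw [← Set.image_pair, ← Ideal.map_span, ← hxy, ← Localization.AtPrime.map_eq_maximalIdeal,
    Ideal.map_map]
  have h3 : φ.comp (algebraMap (MvPolynomial (Fin 2) k) (Localization.AtPrime p)) =
      e.toRingHom.comp (algebraMap _ (Localization.AtPrime q)) := by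
    rw [RingHom.comp_assoc, ← IsScalarTower.algebraMap_eq]
  rw [h3, ← Ideal.map_map, h1]
  exact (map_ringEquiv_maximalIdeal e).symm

end LocalRings

end CoxModel

namespace CoxModel

/-! ### Local rings of smooth surfaces and their prime ideals. -/

section Stalks

open IsLocalRing

variable {X : Scheme.{u}}

/-- The maximal ideals of the local rings of a smooth surface over a field are generated by two
elements. -/
lemma exists_maximalIdeal_stalk_eq_span_pair {k : Type u} [Field k] (p : X ⟶ Spec (.of k))
    [SmoothOfRelativeDimension 2 p] (x : X) :
    ∃ a b : X.presheaf.stalk x, maximalIdeal (X.presheaf.stalk x) = Ideal.span {a, b} := by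
  obtain ⟨U, hU, V, hV, hxV, e, hf⟩ :=
    SmoothOfRelativeDimension.exists_isStandardSmoothOfRelativeDimension (n := 2) (f := p) x
  have hUtop : U = ⊤ := by
    ext y
    refine ⟨fun _ ↦ trivial, fun _ ↦ ?_⟩
    have h1 : p x ∈ U := e hxV
    have : Subsingleton (Spec (.of k)) := inferInstanceAs (Subsingleton (PrimeSpectrum k))
    rwa [Subsingleton.elim y (p x)]
  subst hUtop
  let ψ : k ≃+* Γ(Spec (.of k), ⊤) :=
    (Scheme.ΓSpecIso (.of k)).commRingCatIsoToRingEquiv.symm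
  obtain ⟨g, -, hg⟩ := hf.exists_etale_mvPolynomial
  -- The base ring of the étale chart is a copy of k, so it is a field.
  let _ : Field Γ(Spec (.of k), ⊤) := (ψ.symm.toMulEquiv.isField (Field.toIsField k)).toField
  let := X.presheaf.algebra_section_stalk ⟨x, hxV⟩
  have := hV.isLocalization_stalk ⟨x, hxV⟩
  exact exists_maximalIdeal_eq_span_pair_of_etale (O := X.presheaf.stalk x)
    (hV.primeIdealOf ⟨x, hxV⟩).asIdeal g hg

/-- The prime ideal of the local ring at `x` of a generization `z` of `x`. -/
noncomputable def primeOfGenerization {x z : X} (h : z ⤳ x) : Ideal (X.presheaf.stalk x) :=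
  (maximalIdeal (X.presheaf.stalk z)).comap (X.presheaf.stalkSpecializes h).hom

instance {x z : X} (h : z ⤳ x) : (primeOfGenerization h).IsPrime :=
  inferInstanceAs (Ideal.IsPrime (Ideal.comap _ _))

lemma fromSpecStalk_primeOfGenerization {x z : X} (h : z ⤳ x) :
    X.fromSpecStalk x ⟨primeOfGenerization h, inferInstance⟩ = z := by
  have := congr($(Scheme.SpecMap_stalkSpecializes_fromSpecStalk h)
    (IsLocalRing.closedPoint (X.presheaf.stalk z)))
  rw [Scheme.fromSpecStalk_closedPoint] at this
  exact this

lemma exists_primeOfGenerization_eq (x : X) (P : Ideal (X.presheaf.stalk x)) [hP : P.IsPrime] :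
    ∃ (z : X) (h : z ⤳ x), primeOfGenerization h = P := by
  have hz : X.fromSpecStalk x ⟨P, hP⟩ ⤳ x := by
    have : X.fromSpecStalk x ⟨P, hP⟩ ∈ Set.range (X.fromSpecStalk x) := ⟨_, rfl⟩
    rwa [Scheme.range_fromSpecStalk] at this
  refine ⟨_, hz, ?_⟩
  have := (X.fromSpecStalk x).isEmbedding.injective (fromSpecStalk_primeOfGenerization hz)
  exact congr(PrimeSpectrum.asIdeal $this)

lemma eq_of_primeOfGenerization_eq {x z z' : X} (h : z ⤳ x) (h' : z' ⤳ x)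
    (e : primeOfGenerization h = primeOfGenerization h') : z = z' := by
  rw [← fromSpecStalk_primeOfGenerization h, ← fromSpecStalk_primeOfGenerization h']
  congr 1
  exact PrimeSpectrum.ext e

/-- Both stalks are localizations of the sections over a common affine neighborhood, and
localization can be done in two steps. -/
lemma isLocalization_stalkSpecializes {x z : X} (h : z ⤳ x) :
    letI := (X.presheaf.stalkSpecializes h).hom.toAlgebra
    IsLocalization.AtPrime (X.presheaf.stalk z) (primeOfGenerization h) := by
  obtain ⟨V, hV, hxV, -⟩ := X.isBasis_affineOpens.exists_subset_of_mem_open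
    (show x ∈ (⊤ : X.Opens) from trivial) isOpen_univ
  obtain ⟨V, hV, rfl⟩ := hV
  have hzV : z ∈ V := h.mem_open V.isOpen hxV
  let _ := (X.presheaf.stalkSpecializes h).hom.toAlgebra
  let _ : Algebra Γ(X, V) (X.presheaf.stalk x) := X.presheaf.algebra_section_stalk ⟨x, hxV⟩
  let _ : Algebra Γ(X, V) (X.presheaf.stalk z) := X.presheaf.algebra_section_stalk ⟨z, hzV⟩
  have h1 : IsLocalization.AtPrime (X.presheaf.stalk x) (hV.primeIdealOf ⟨x, hxV⟩).asIdeal :=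
    hV.isLocalization_stalk ⟨x, hxV⟩
  have h2 : IsLocalization.AtPrime (X.presheaf.stalk z) (hV.primeIdealOf ⟨z, hzV⟩).asIdeal :=
    hV.isLocalization_stalk ⟨z, hzV⟩
  have : IsScalarTower Γ(X, V) (X.presheaf.stalk x) (X.presheaf.stalk z) :=
    .of_algebraMap_eq' (congrArg CommRingCat.Hom.hom
      (X.presheaf.germ_stalkSpecializes hxV h)).symm
  have hle : (hV.primeIdealOf ⟨x, hxV⟩).asIdeal.primeCompl ≤
      (hV.primeIdealOf ⟨z, hzV⟩).asIdeal.primeCompl := by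
    intro r hr
    rw [← IsLocalization.AtPrime.isUnit_to_map_iff (X.presheaf.stalk z),
      IsScalarTower.algebraMap_apply _ (X.presheaf.stalk x)]
    exact ((IsLocalization.AtPrime.isUnit_to_map_iff (X.presheaf.stalk x)
      (hV.primeIdealOf ⟨x, hxV⟩).asIdeal r).mpr hr).map _
  have h3 := IsLocalization.isLocalization_of_submonoid_le (X.presheaf.stalk x)
    (X.presheaf.stalk z) _ _ hle
  refine IsLocalization.of_le ((hV.primeIdealOf ⟨z, hzV⟩).asIdeal.primeCompl.map
    (algebraMap Γ(X, V) (X.presheaf.stalk x))) (primeOfGenerization h).primeCompl ?_ ?_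
  · rintro r hr hr'
    exact (mem_maximalIdeal _).mp hr' (IsLocalization.map_units (X.presheaf.stalk z) ⟨r, hr⟩)
  · intro r hr
    by_contra hc
    exact hr ((mem_maximalIdeal _).mpr hc)

end Stalks

end CoxModel

namespace CoxModel

/-! ### Orders of rational functions along prime divisors. -/

section Orders

open IsLocalRing

lemma isDiscreteValuationRing_of_maximalIdeal_eq {O : Type*} [CommRing O] [IsDomain O]
    [IsNoetherianRing O] [IsLocalRing O] {y : O} (hy : y ≠ 0)
    (h : maximalIdeal O = Ideal.span {y}) : IsDiscreteValuationRing O := by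
  have h1 : ¬ IsField O := by
    rwa [isField_iff_maximalIdeal_eq, h, Ideal.span_singleton_eq_bot]
  have h2 := (IsDiscreteValuationRing.TFAE O h1).out 0 4
  exact h2.mpr ⟨y, h⟩

variable {X : Scheme.{u}} [IsIntegral X]

/-- The inclusion of a local ring in the function field. -/
noncomputable abbrev toFunctionField (x : X) : X.presheaf.stalk x →+* X.functionField :=
  algebraMap (X.presheaf.stalk x) X.functionField

lemma toFunctionField_injective (x : X) : Function.Injective (toFunctionField x) :=
  IsFractionRing.injective _ _

lemma toFunctionField_stalkSpecializes {x z : X} (h : z ⤳ x) (y : X.presheaf.stalk x) :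
    toFunctionField z ((X.presheaf.stalkSpecializes h).hom y) = toFunctionField x y := by
  simp only [toFunctionField, RingHom.algebraMap_toAlgebra, ← CommRingCat.comp_apply]
  rw [X.presheaf.stalkSpecializes_comp]

lemma krullDimLE_one_stalk {X : Scheme.{u}} {z : X} (hz : Order.coheight z = 1) :
    Ring.KrullDimLE 1 (X.presheaf.stalk z) := krullDimLE_of_coheight_le hz.le

section Generization

variable {x z : X} (h : z ⤳ x)

lemma maximalIdeal_eq_map_primeOfGenerization {X : Scheme.{u}} {x z : X} (h : z ⤳ x) :
    (primeOfGenerization h).map (X.presheaf.stalkSpecializes h).hom =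
      maximalIdeal (X.presheaf.stalk z) := by
  let _ := (X.presheaf.stalkSpecializes h).hom.toAlgebra
  have := isLocalization_stalkSpecializes h
  exact IsLocalization.AtPrime.map_eq_maximalIdeal (primeOfGenerization h) (X.presheaf.stalk z)

lemma stalkSpecializes_injective : Function.Injective (X.presheaf.stalkSpecializes h).hom := by
  intro a b hab
  apply toFunctionField_injective x
  rw [← toFunctionField_stalkSpecializes h, hab, toFunctionField_stalkSpecializes h]

lemma primeOfGenerization_ne_bot {X : Scheme.{u}} {x z : X} (h : z ⤳ x) (hz : Order.coheight z = 1) : primeOfGenerization h ≠ ⊥ := by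
  intro h0
  have h1 := maximalIdeal_eq_map_primeOfGenerization h
  rw [h0, Ideal.map_bot] at h1
  have h2 := ringKrullDim_eq_zero_of_isField (isField_iff_maximalIdeal_eq.mpr h1.symm)
  rw [ringKrullDim_stalk_eq_coheight, hz] at h2
  exact absurd h2 (by simp)

/-- If a prime element of the local ring at `x` lies in the prime ideal of a point `z` of
codimension one, then it generates this ideal and the maximal ideal of the local ring at `z`. -/
lemma span_eq_of_mem_primeOfGenerization (hz : Order.coheight z = 1) {π : X.presheaf.stalk x}
    (hπ : Prime π) (hmem : π ∈ primeOfGenerization h) :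
    primeOfGenerization h = Ideal.span {π} ∧
      maximalIdeal (X.presheaf.stalk z) =
        Ideal.span {(X.presheaf.stalkSpecializes h).hom π} := by
  let _ := (X.presheaf.stalkSpecializes h).hom.toAlgebra
  have := isLocalization_stalkSpecializes h
  have hP : (Ideal.span {π}).IsPrime := (Ideal.span_singleton_prime hπ.ne_zero).mpr hπ
  have hle : Ideal.span {π} ≤ primeOfGenerization h := by
    rwa [Ideal.span_singleton_le_iff_mem]
  have hd : Disjoint ((primeOfGenerization h).primeCompl : Set (X.presheaf.stalk x))
      (Ideal.span {π} : Ideal (X.presheaf.stalk x)) :=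
    Set.disjoint_left.mpr fun r hr hr' ↦ hr (hle hr')
  have h1 := IsLocalization.isPrime_of_isPrime_disjoint _ (X.presheaf.stalk z) _ hP hd
  have h2 := IsLocalization.under_map_of_isPrime_disjoint _ (X.presheaf.stalk z) hP hd
  have h3 : (Ideal.span {π}).map (algebraMap (X.presheaf.stalk x) (X.presheaf.stalk z)) =
      Ideal.span {(X.presheaf.stalkSpecializes h).hom π} := by
    rw [Ideal.map_span, Set.image_singleton]; rfl
  -- The local ring at z has dimension at most one, so the nonzero prime ideal generated by π is
  -- maximal there. Contracting it to the stalk at x gives the first equality.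
  have h4 := (Ring.krullDimLE_one_iff_of_noZeroDivisors.mp (krullDimLE_one_stalk hz)) _ (by
    rw [h3, Ne, Ideal.span_singleton_eq_bot, map_eq_zero_iff _ (stalkSpecializes_injective h)]
    exact hπ.ne_zero) h1
  have h5 := eq_maximalIdeal h4
  refine ⟨?_, by rw [← h5, h3]⟩
  rw [h5] at h2
  exact h2

lemma maximalIdeal_eq_span_of_primeOfGenerization {X : Scheme.{u}} {x z : X} (h : z ⤳ x) {π : X.presheaf.stalk x}
    (hπ : primeOfGenerization h = Ideal.span {π}) :
    maximalIdeal (X.presheaf.stalk z) =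
        Ideal.span {(X.presheaf.stalkSpecializes h).hom π} := by
  rw [← maximalIdeal_eq_map_primeOfGenerization h, hπ, Ideal.map_span, Set.image_singleton]

lemma coheight_eq_one_of_maximalIdeal_eq [IsLocallyNoetherian X] {z : X}
    {y : X.presheaf.stalk z} (hy : y ≠ 0)
    (h : maximalIdeal (X.presheaf.stalk z) = Ideal.span {y}) : Order.coheight z = 1 := by
  have := isDiscreteValuationRing_of_maximalIdeal_eq hy h
  have h1 := IsPrincipalIdealRing.ringKrullDim_eq_one (X.presheaf.stalk z)
    (IsDiscreteValuationRing.not_isField _)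
  rw [ringKrullDim_stalk_eq_coheight] at h1
  exact_mod_cast h1

end Generization

variable [IsLocallyNoetherian X]

lemma ord_toFunctionField_of_isUnit {z : X} {y : X.presheaf.stalk z}
    (hy : IsUnit y) : Scheme.ord (toFunctionField z y) z = 0 := by
  by_cases hz : Order.coheight z = 1
  · have := krullDimLE_one_stalk hz
    rw [Scheme.ord_eq_iff hz ((hy.map _).ne_zero)]
    exact Ring.ordFrac_of_isUnit hy
  · exact Scheme.ord_eq_zero_of_coheight_neq_one hz _

lemma ord_toFunctionField_nonneg {z : X} {y : X.presheaf.stalk z} (hy : y ≠ 0) :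
    0 ≤ Scheme.ord (toFunctionField z y) z := by
  by_cases hz : Order.coheight z = 1
  · have := krullDimLE_one_stalk hz
    rw [Scheme.le_ord_iff hz ((map_ne_zero_iff _ (toFunctionField_injective z)).mpr hy)]
    exact Ring.ordFrac_ge_one_of_ne_zero hy
  · rw [Scheme.ord_eq_zero_of_coheight_neq_one hz]

lemma ord_toFunctionField_of_maximalIdeal_eq {z : X} (hz : Order.coheight z = 1)
    {y : X.presheaf.stalk z} (hy : y ≠ 0)
    (h : maximalIdeal (X.presheaf.stalk z) = Ideal.span {y}) :
    Scheme.ord (toFunctionField z y) z = 1 := by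
  have := krullDimLE_one_stalk hz
  have hy' : Prime y := (Ideal.span_singleton_prime hy).mp (h ▸ inferInstance)
  rw [Scheme.ord_eq_iff hz ((map_ne_zero_iff _ (toFunctionField_injective z)).mpr hy)]
  have : IsDiscreteValuationRing (X.presheaf.stalk z) :=
    isDiscreteValuationRing_of_maximalIdeal_eq hy h
  exact Ring.ordFrac_irreducible hy'.irreducible

lemma ord_inv {φ : X.functionField} (hφ : φ ≠ 0) (z : X) :
    Scheme.ord φ⁻¹ z = - Scheme.ord φ z := by
  have h : Scheme.ord (1 : X.functionField) z = 0 := by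
    rw [← map_one (toFunctionField z)]
    exact ord_toFunctionField_of_isUnit isUnit_one
  have := Scheme.ord_mul (x := z) hφ (inv_ne_zero hφ)
  rw [mul_inv_cancel₀ hφ, h] at this
  omega

lemma ord_eq_zero_of_notMem {x z : X} (h : z ⤳ x) {y : X.presheaf.stalk x} (hy : y ∉ primeOfGenerization h) :
    Scheme.ord (toFunctionField x y) z = 0 := by
  rw [← toFunctionField_stalkSpecializes h]
  exact ord_toFunctionField_of_isUnit (by_contra fun hc ↦ hy ((mem_maximalIdeal _).mpr hc))

/-- Every prime divisor on a scheme has a local equation at a factorial point. -/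
theorem exists_localEquation (x : X) [UniqueFactorizationMonoid (X.presheaf.stalk x)]
    {z₀ : X} (hz₀ : Order.coheight z₀ = 1) :
    ∃ y : X.presheaf.stalk x, y ≠ 0 ∧ ∀ z : X, Order.coheight z = 1 → z ⤳ x →
      Scheme.ord (toFunctionField x y) z = Finsupp.single z₀ (1 : ℤ) z := by
  by_cases h₀ : z₀ ⤳ x
  · obtain ⟨π, hπ, hπ'⟩ := (UniqueFactorizationMonoid.iff_exists_prime_mem_of_isPrime.mp ‹_›) _
      (primeOfGenerization_ne_bot h₀ hz₀) inferInstance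
    obtain ⟨h1, h2⟩ := span_eq_of_mem_primeOfGenerization h₀ hz₀ hπ' hπ
    refine ⟨π, hπ'.ne_zero, fun z hz h ↦ ?_⟩
    obtain rfl | hne := eq_or_ne z z₀
    · rw [Finsupp.single_eq_same, ← toFunctionField_stalkSpecializes h]
      refine ord_toFunctionField_of_maximalIdeal_eq hz ?_ h2
      rw [Ne, map_eq_zero_iff _ (stalkSpecializes_injective h)]
      exact hπ'.ne_zero
    · rw [Finsupp.single_eq_of_ne hne]
      refine ord_eq_zero_of_notMem h fun hmem ↦ hne (eq_of_primeOfGenerization_eq h h₀ ?_)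
      rw [h1, (span_eq_of_mem_primeOfGenerization h hz hπ' hmem).1]
  · refine ⟨1, one_ne_zero, fun z hz h ↦ ?_⟩
    rw [Finsupp.single_eq_of_ne (by rintro rfl; exact h₀ h), ← toFunctionField_stalkSpecializes h,
      map_one]
    exact ord_toFunctionField_of_isUnit isUnit_one

/-- A rational function without poles near a factorial point is regular at this point. -/
theorem exists_toFunctionField_eq (x : X) [UniqueFactorizationMonoid (X.presheaf.stalk x)]
    {φ : X.functionField} (hφ : φ ≠ 0)
    (h : ∀ z : X, Order.coheight z = 1 → z ⤳ x → 0 ≤ Scheme.ord φ z) :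
    ∃ y, toFunctionField x y = φ := by
  obtain ⟨a, d, had, rfl⟩ := IsFractionRing.exists_reduced_fraction (A := X.presheaf.stalk x) φ
  have hinj := toFunctionField_injective x
  have hd0 : (d : X.presheaf.stalk x) ≠ 0 := nonZeroDivisors.ne_zero d.2
  have ha0 : a ≠ 0 := by
    rintro rfl
    simp at hφ
  rw [IsFractionRing.mk'_eq_div] at h ⊢
  suffices hd : IsUnit (d : X.presheaf.stalk x) by
    obtain ⟨e, he⟩ := hd.exists_right_inv
    refine ⟨a * e, ?_⟩
    rw [eq_div_iff (by simp), ← map_mul, mul_assoc, mul_comm e, he, mul_one]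
  by_contra hd
  -- A prime factor of the denominator of the reduced fraction defines a point of codimension one,
  -- at which the numerator is a unit; so φ would have a pole there.
  obtain ⟨π, hπ, c, hc⟩ := WfDvdMonoid.exists_irreducible_factor hd hd0
  have hπ : Prime π := UniqueFactorizationMonoid.irreducible_iff_prime.mp hπ
  have hc0 : c ≠ 0 := by
    rintro rfl
    simp at hc
  have : (Ideal.span {π}).IsPrime := (Ideal.span_singleton_prime hπ.ne_zero).mpr hπ
  obtain ⟨z, hz, hzπ⟩ := exists_primeOfGenerization_eq x (Ideal.span {π})
  have hm := maximalIdeal_eq_span_of_primeOfGenerization hz hzπ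
  have h0 : (X.presheaf.stalkSpecializes hz).hom π ≠ 0 := by
    rw [Ne, map_eq_zero_iff _ (stalkSpecializes_injective hz)]
    exact hπ.ne_zero
  have hz1 := coheight_eq_one_of_maximalIdeal_eq h0 hm
  have h1 := ord_toFunctionField_of_maximalIdeal_eq hz1 h0 hm
  rw [toFunctionField_stalkSpecializes] at h1
  have h2 : Scheme.ord (toFunctionField x a) z = 0 := by
    refine ord_eq_zero_of_notMem hz fun hmem ↦ ?_
    rw [hzπ, Ideal.mem_span_singleton] at hmem
    exact hπ.not_isUnit (had hmem ⟨c, hc⟩)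
  have h3 : 0 ≤ Scheme.ord (toFunctionField x c) z := by
    rw [← toFunctionField_stalkSpecializes hz]
    refine ord_toFunctionField_nonneg ?_
    rwa [Ne, map_eq_zero_iff _ (stalkSpecializes_injective hz)]
  have h4 := h z hz1 hz
  have n1 : toFunctionField x a ≠ 0 := (map_ne_zero_iff _ hinj).mpr ha0
  have n2 : toFunctionField x π ≠ 0 := (map_ne_zero_iff _ hinj).mpr hπ.ne_zero
  have n3 : toFunctionField x c ≠ 0 := (map_ne_zero_iff _ hinj).mpr hc0
  rw [div_eq_mul_inv, hc, map_mul, Scheme.ord_mul n1 (inv_ne_zero (mul_ne_zero n2 n3)),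
    ord_inv (mul_ne_zero n2 n3), Scheme.ord_mul n2 n3] at h4
  omega

end Orders

end CoxModel

namespace CoxModel

/-! ### Orders and rational functions under local isomorphisms. -/

section OrdIso

lemma ord_map_of_bijective {R R' : Type*} [CommRing R] [CommRing R'] (σ : R →+* R')
    (hσ : Function.Bijective σ) (a : R) : Ring.ord R' (σ a) = Ring.ord R a := by
  algebraize [σ]
  let e : R ≃ₐ[R] R' := AlgEquiv.ofBijective (Algebra.ofId R R') hσ
  have h : Ideal.span {σ a} = (Ideal.span {a}).map (e : R →+* R') := by
    rw [Ideal.map_span, Set.image_singleton]; rfl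
  rw [Ring.ord, Ring.ord, ← Module.length_eq_of_surjective (S := R) (R := R') hσ.2]
  exact (Ideal.quotientEquivAlg _ _ e h).symm.toLinearEquiv.length_eq

end OrdIso

section FunctionFieldMap

variable {X Y : Scheme.{u}} [IsIntegral X] [IsIntegral Y] {f : X ⟶ Y}
  (hf : f (genericPoint X) = genericPoint Y)

/-- The pull-back of rational functions along a dominant morphism of integral schemes. -/
noncomputable def functionFieldMap : Y.functionField →+* X.functionField :=
  (f.stalkMap (genericPoint X)).hom.comp
    (Y.presheaf.stalkSpecializes (specializes_of_eq hf)).hom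

lemma functionFieldMap_toFunctionField (z : X) (y : Y.presheaf.stalk (f z)) :
    functionFieldMap hf (toFunctionField (f z) y) = toFunctionField z ((f.stalkMap z).hom y) := by
  have h : genericPoint X ⤳ z := (genericPoint_spec X).specializes trivial
  have h1 := Scheme.Hom.stalkSpecializes_stalkMap_apply f _ _ h y
  have h2 : (Y.presheaf.stalkSpecializes (specializes_of_eq hf)).hom (toFunctionField (f z) y) =
      (Y.presheaf.stalkSpecializes (f.base.hom.map_specializes h)).hom y := by
    simp only [toFunctionField, RingHom.algebraMap_toAlgebra, ← CommRingCat.comp_apply]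
    rw [Y.presheaf.stalkSpecializes_comp]
  rw [functionFieldMap, RingHom.comp_apply, h2]
  exact h1

lemma functionFieldMap_surjective (h : Function.Bijective (f.stalkMap (genericPoint X)).hom) :
    Function.Surjective (functionFieldMap hf) := by
  intro φ
  obtain ⟨y, rfl⟩ := h.2 φ
  refine ⟨toFunctionField _ y, ?_⟩
  rw [functionFieldMap_toFunctionField]
  simp only [toFunctionField, RingHom.algebraMap_toAlgebra]
  rw [X.presheaf.stalkSpecializes_refl]
  rfl

lemma coheight_eq_of_stalkMap_bijective {X Y : Scheme.{u}} {f : X ⟶ Y} (z : X) (h : Function.Bijective (f.stalkMap z).hom) :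
    Order.coheight (f z) = Order.coheight z := by
  have := ringKrullDim_eq_of_ringEquiv (RingEquiv.ofBijective (f.stalkMap z).hom h)
  rw [ringKrullDim_stalk_eq_coheight, ringKrullDim_stalk_eq_coheight] at this
  exact_mod_cast this

variable [IsLocallyNoetherian X] [IsLocallyNoetherian Y]

/-- Orders are computed from lengths over the local ring at z, which is isomorphic to the one at f
z. -/
lemma ord_functionFieldMap (z : X) (h : Function.Bijective (f.stalkMap z).hom)
    (φ : Y.functionField) :
    Scheme.ord (functionFieldMap hf φ) z = Scheme.ord φ (f z) := by
  have hc := coheight_eq_of_stalkMap_bijective z h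
  by_cases hz : Order.coheight z = 1
  swap
  · rw [Scheme.ord_eq_zero_of_coheight_neq_one hz, Scheme.ord_eq_zero_of_coheight_neq_one (hc ▸ hz)]
  have key : ∀ y : Y.presheaf.stalk (f z), y ≠ 0 →
      Scheme.ord (toFunctionField z ((f.stalkMap z).hom y)) z =
        Scheme.ord (toFunctionField (f z) y) (f z) := by
    intro y hy
    have hy' : (f.stalkMap z).hom y ≠ 0 := (map_ne_zero_iff _ h.1).mpr hy
    have := krullDimLE_one_stalk hz
    have := krullDimLE_one_stalk (hc.trans hz)
    rw [Scheme.ord_eq_iff hz ((map_ne_zero_iff _ (toFunctionField_injective z)).mpr hy')]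
    have h1 := (Scheme.ord_eq_iff (hc.trans hz)
      ((map_ne_zero_iff _ (toFunctionField_injective (f z))).mpr hy)).mp rfl
    rw [← h1]
    change Ring.ordFrac (X.presheaf.stalk z) (algebraMap (X.presheaf.stalk z) X.functionField
      ((f.stalkMap z).hom y)) = Ring.ordFrac (Y.presheaf.stalk (f z))
        (algebraMap (Y.presheaf.stalk (f z)) Y.functionField y)
    rw [Ring.ordFrac_eq_ord _ hy', Ring.ordFrac_eq_ord _ hy,
      Ring.ordMonoidWithZeroHom_eq_ord (mem_nonZeroDivisors_iff_ne_zero.mpr hy'),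
      Ring.ordMonoidWithZeroHom_eq_ord (mem_nonZeroDivisors_iff_ne_zero.mpr hy),
      ord_map_of_bijective _ h]
  obtain rfl | hφ := eq_or_ne φ 0
  · simp
  obtain ⟨a, d, hd, rfl⟩ := IsFractionRing.div_surjective (A := Y.presheaf.stalk (f z)) φ
  have hd := nonZeroDivisors.ne_zero hd
  have ha : a ≠ 0 := by
    rintro rfl
    simp at hφ
  have n1 : toFunctionField (f z) a ≠ 0 :=
    (map_ne_zero_iff _ (toFunctionField_injective _)).mpr ha
  have n2 : toFunctionField (f z) d ≠ 0 :=
    (map_ne_zero_iff _ (toFunctionField_injective _)).mpr hd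
  rw [div_eq_mul_inv, map_mul, map_inv₀, Scheme.ord_mul n1 (inv_ne_zero n2), ord_inv n2,
    Scheme.ord_mul ((map_ne_zero _).mpr n1) (inv_ne_zero ((map_ne_zero _).mpr n2)),
    ord_inv ((map_ne_zero _).mpr n2), functionFieldMap_toFunctionField,
    functionFieldMap_toFunctionField, key a ha, key d hd]

end FunctionFieldMap

/-! ### Contractions away from the exceptional curve. -/

section Contraction

variable {Y X : Scheme.{u}} {b : Y ⟶ X} {E : Y} {x : X}

/-- A morphism that avoids Z pulls its ideal back to the unit ideal. -/
lemma isEffectiveCartier_comap_vanishingIdeal {T : Scheme.{u}} (Z : TopologicalSpace.Closeds X)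
    (t : T ⟶ X) (h : ∀ y, t y ∉ Z) :
    IsEffectiveCartier ((Scheme.IdealSheafData.vanishingIdeal Z).comap t) := by
  have : (Scheme.IdealSheafData.vanishingIdeal Z).comap t = ⊤ := by
    rw [← Scheme.IdealSheafData.support_eq_bot_iff, Scheme.IdealSheafData.support_comap]
    ext y
    simp only [TopologicalSpace.Closeds.coe_preimage, Set.mem_preimage,
      Scheme.IdealSheafData.coe_support_vanishingIdeal]
    simpa using h y
  rw [this]
  exact isEffectiveCartier_top

/-- A contraction is an isomorphism outside the exceptional curve. -/
lemma IsContraction.isIso_restrict (H : IsContraction b E x) (U : X.Opens) (hU : x ∉ U) :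
    IsIso (b ∣_ U) := by
  have hU' : ∀ y : U.toScheme, U.ι y ∉ (⟨{x}, H.isClosed⟩ : TopologicalSpace.Closeds X) := by
    intro y hy
    have hy : U.ι y = x := hy
    exact hU (hy ▸ y.2)
  -- The universal property over U gives a section of b, and its uniqueness part over the preimage
  -- of U shows that this section is inverse to b there.
  obtain ⟨h, hh, -⟩ := H.isBlowup.existsUnique_lift _ U.ι
    (isEffectiveCartier_comap_vanishingIdeal _ _ hU')
  obtain ⟨h', -, huniq⟩ := H.isBlowup.existsUnique_lift _ ((b ⁻¹ᵁ U).ι ≫ b)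
    (isEffectiveCartier_comap_vanishingIdeal _ _ fun y hy ↦ by
      have hy : b y.1 = x := hy
      have hyU : b y.1 ∈ U := y.2
      exact hU (hy ▸ hyU))
  have h1 : b ∣_ U ≫ h = (b ⁻¹ᵁ U).ι := by
    refine (huniq (b ∣_ U ≫ h) ?_).trans (huniq _ rfl).symm
    change (b ∣_ U ≫ h) ≫ b = _
    rw [Category.assoc, hh, morphismRestrict_ι]
  have hr : Set.range h ⊆ Set.range (b ⁻¹ᵁ U).ι := by
    rintro _ ⟨y, rfl⟩
    rw [Scheme.Opens.range_ι]
    have : b (h y) = U.ι y := by rw [← hh]; rfl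
    change b (h y) ∈ U
    rw [this]
    exact y.2
  refine ⟨IsOpenImmersion.lift (b ⁻¹ᵁ U).ι h hr, ?_, ?_⟩
  · rw [← cancel_mono (b ⁻¹ᵁ U).ι, Category.assoc, IsOpenImmersion.lift_fac, h1,
      Category.id_comp]
  · rw [← cancel_mono U.ι, Category.assoc, morphismRestrict_ι, IsOpenImmersion.lift_fac_assoc,
      hh, Category.id_comp]

lemma isIso_stalkMap_of_isIso_restrict (f : Y ⟶ X) (U : X.Opens) [IsIso (f ∣_ U)]
    (z : (f ⁻¹ᵁ U).toScheme) : IsIso (f.stalkMap z.1) := by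
  have h1 : IsIso ((f ∣_ U).stalkMap z) := inferInstance
  exact ((MorphismProperty.isomorphisms _).arrow_mk_iso_iff
    (morphismRestrictStalkMap f U z)).mp h1

lemma IsContraction.map_eq (H : IsContraction b E x) : b E = x := by
  have : E ∈ b ⁻¹' {x} := H.preimage ▸ subset_closure rfl
  exact this

lemma IsContraction.map_eq_iff (H : IsContraction b E x) {z : Y} : b z = x ↔ E ⤳ z := by
  rw [specializes_iff_mem_closure, ← H.preimage]
  rfl

lemma IsContraction.stalkMap_bijective (H : IsContraction b E x) {z : Y} (hz : b z ≠ x) :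
    Function.Bijective (b.stalkMap z).hom := by
  let U : X.Opens := ⟨{x}ᶜ, H.isClosed.isOpen_compl⟩
  have h0 := H.isIso_restrict U (by simp [U])
  have := isIso_stalkMap_of_isIso_restrict b U ⟨z, hz⟩
  exact ConcreteCategory.bijective_of_isIso (b.stalkMap z)

lemma IsContraction.existsUnique_map_eq (H : IsContraction b E x) {y : X} (hy : y ≠ x) : ∃! z, b z = y := by
  let U : X.Opens := ⟨{x}ᶜ, H.isClosed.isOpen_compl⟩
  have := H.isIso_restrict U (by simp [U])
  have hb : Function.Bijective (b ∣_ U) := (b ∣_ U).homeomorph.bijective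
  obtain ⟨⟨z, hz⟩, hzy⟩ := hb.2 ⟨y, hy⟩
  have h1 : ∀ w, ((b ∣_ U) w).1 = b w.1 := morphismRestrict_base_coe b U
  refine ⟨z, ?_, fun w hw ↦ ?_⟩
  · exact (h1 ⟨z, hz⟩).symm.trans (congrArg Subtype.val hzy)
  · have hw' : w ∈ b ⁻¹ᵁ U := by
      change b w ≠ x
      rwa [hw]
    have : (⟨w, hw'⟩ : (b ⁻¹ᵁ U : Y.Opens)) = ⟨z, hz⟩ := by
      apply hb.1
      refine Subtype.ext ((h1 _).trans (hw.trans ?_))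
      exact (congrArg Subtype.val hzy).symm
    exact congrArg Subtype.val this

/-- The generic point of X differs from x, so it is in the image of b; hence the image of the
generic point of Y specializes to it. -/
lemma IsContraction.map_genericPoint (H : IsContraction b E x) [IsIntegral X] [IsIntegral Y] (hx : genericPoint X ≠ x) :
    b (genericPoint Y) = genericPoint X := by
  obtain ⟨z, hz, -⟩ := H.existsUnique_map_eq hx
  have h1 : b (genericPoint Y) ⤳ genericPoint X := by
    rw [← hz]
    exact ((genericPoint_spec Y).specializes trivial).map b.continuous
  exact (h1.antisymm ((genericPoint_spec X).specializes trivial)).eq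

end Contraction

end CoxModel

namespace CoxModel

/-! ### Weil divisors, local equations and relations between degrees. -/

section Divisors

open IsLocalRing

lemma single_primeDivisor_apply {X : Scheme.{u}} (E z : PrimeDivisor X) (n : ℤ) :
    Finsupp.single E n z = Finsupp.single E.1 n z.1 := by
  classical
  rw [Finsupp.single_apply, Finsupp.single_apply]
  have he : E = z ↔ E.1 = z.1 := ⟨congrArg Subtype.val, Subtype.ext⟩
  simp [he]

lemma combination_apply {X : Scheme.{u}} {r : ℕ} {D : Fin r → WeilDivisor X} (m : Fin r → ℤ) (z : PrimeDivisor X) :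
    combination D m z = ∑ i, m i * D i z := by
  simp [combination, Finsupp.finsetSum_apply]

lemma combination_zero {X : Scheme.{u}} {r : ℕ} {D : Fin r → WeilDivisor X} : combination D 0 = 0 := by
  simp [combination]

lemma combination_sum_smul {X : Scheme.{u}} {r : ℕ} {D : Fin r → WeilDivisor X} {σ : Type*} [Fintype σ] (c : σ → ℤ) (w : σ → Fin r → ℤ)
    (z : PrimeDivisor X) :
    combination D (∑ i, c i • w i) z = ∑ i, c i * combination D (w i) z := by
  simp only [combination_apply, Finset.sum_apply, Pi.smul_apply, smul_eq_mul, Finset.sum_mul,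
    Finset.mul_sum]
  rw [Finset.sum_comm]
  simp [mul_assoc]

variable {X : Scheme.{u}} [IsIntegral X] [IsLocallyNoetherian X]

lemma ord_one (z : X) : Scheme.ord (1 : X.functionField) z = 0 := by
  rw [← map_one (toFunctionField z)]
  exact ord_toFunctionField_of_isUnit isUnit_one

lemma ord_zpow {φ : X.functionField} (hφ : φ ≠ 0) (n : ℤ) (z : X) :
    Scheme.ord (φ ^ n) z = n * Scheme.ord φ z := by
  have h : ∀ k : ℕ, Scheme.ord (φ ^ k) z = k * Scheme.ord φ z := by
    intro k
    induction k with
    | zero => simp [ord_one]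
    | succ k ih =>
      rw [pow_succ, Scheme.ord_mul (pow_ne_zero k hφ) hφ, ih]
      push_cast
      ring
  obtain ⟨k, rfl | rfl⟩ := n.eq_nat_or_neg
  · rw [zpow_natCast, h]
  · rw [zpow_neg, zpow_natCast, ord_inv (pow_ne_zero k hφ), h]
    ring

lemma ord_prod_zpow {σ : Type*} (t : Finset σ) {φ : σ → X.functionField} (hφ : ∀ i, φ i ≠ 0)
    (c : σ → ℤ) (z : X) :
    Scheme.ord (∏ i ∈ t, φ i ^ c i) z = ∑ i ∈ t, c i * Scheme.ord (φ i) z := by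
  classical
  induction t using Finset.induction_on with
  | empty => simp [ord_one]
  | insert i t hi ih =>
    rw [Finset.prod_insert hi, Finset.sum_insert hi, Scheme.ord_mul (zpow_ne_zero _ (hφ i))
      (Finset.prod_ne_zero_iff.mpr fun j _ ↦ zpow_ne_zero _ (hφ j)), ord_zpow (hφ i), ih]

/-- Every Weil divisor has a local equation at a factorial point. -/
lemma exists_localEquation_weilDivisor (x : X) [UniqueFactorizationMonoid (X.presheaf.stalk x)]
    (E : WeilDivisor X) :
    ∃ d : X.functionField, d ≠ 0 ∧ ∀ z : PrimeDivisor X, z.1 ⤳ x → Scheme.ord d z.1 = E z := by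
  induction E using Finsupp.induction_linear with
  | zero => exact ⟨1, one_ne_zero, fun z _ ↦ ord_one _⟩
  | add E F hE hF =>
    obtain ⟨d, hd, h⟩ := hE
    obtain ⟨d', hd', h'⟩ := hF
    refine ⟨d * d', mul_ne_zero hd hd', fun z hz ↦ ?_⟩
    rw [Scheme.ord_mul hd hd', h z hz, h' z hz, Finsupp.add_apply]
  | single E n =>
    obtain ⟨y, hy, h⟩ := exists_localEquation x E.2
    have hy' : toFunctionField x y ≠ 0 :=
      (map_ne_zero_iff _ (toFunctionField_injective x)).mpr hy
    refine ⟨toFunctionField x y ^ n, zpow_ne_zero _ hy', fun z hz ↦ ?_⟩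
    rw [ord_zpow hy', h z.1 z.2 hz, ← single_primeDivisor_apply, ← smul_eq_mul,
      ← Finsupp.smul_apply, Finsupp.smul_single, smul_eq_mul, mul_one]

variable {r : ℕ} {D : Fin r → WeilDivisor X}

section

variable {σ : Type} [Fintype σ] (s : σ → PrimeSection D) (c : σ → ℤ)

lemma ord_prod_fn (z : PrimeDivisor X) :
    Scheme.ord (∏ i, (s i).fn ^ c i) z.1 = ∑ i, c i * Finsupp.single (s i).curve (1 : ℤ) z -
      combination D (∑ i, c i • (s i).deg) z := by
  rw [ord_prod_zpow _ fun i ↦ (s i).fn_ne_zero, combination_sum_smul, ← Finset.sum_sub_distrib]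
  refine Finset.sum_congr rfl fun i _ ↦ ?_
  rw [← (s i).div_eq]
  ring

/-- A relation between the degrees is given by a rational function. -/
lemma exists_ord_eq_of_sum_smul_deg_eq_zero (h : ∑ i, c i • (s i).deg = 0) :
    ∃ φ : X.functionField, φ ≠ 0 ∧ ∀ z : PrimeDivisor X,
      Scheme.ord φ z.1 = ∑ i, c i * Finsupp.single (s i).curve (1 : ℤ) z :=
  ⟨∏ i, (s i).fn ^ c i, Finset.prod_ne_zero_iff.mpr fun i _ ↦ zpow_ne_zero _ (s i).fn_ne_zero,
    fun z ↦ by rw [ord_prod_fn, h, combination_zero, Finsupp.zero_apply, sub_zero]⟩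

/-- A rational function gives a relation between the degrees. -/
lemma sum_smul_deg_eq_zero_of_ord_eq (hD : IsPicardBasis D) {φ : X.functionField} (hφ : φ ≠ 0)
    (h : ∀ z : PrimeDivisor X,
      Scheme.ord φ z.1 = ∑ i, c i * Finsupp.single (s i).curve (1 : ℤ) z) :
    ∑ i, c i • (s i).deg = 0 := by
  have hψ : ∏ i, (s i).fn ^ c i ≠ 0 :=
    Finset.prod_ne_zero_iff.mpr fun i _ ↦ zpow_ne_zero _ (s i).fn_ne_zero
  -- The divisor with coefficients ∑ c_i deg s_i is linearly equivalent to itself and, by φ, to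
  -- zero; uniqueness of coefficients in a basis identifies the two.
  refine (hD (combination D (∑ i, c i • (s i).deg))).unique
    ⟨1, one_ne_zero, fun z ↦ by rw [sub_self, ord_one]⟩
    ⟨φ * (∏ i, (s i).fn ^ c i)⁻¹, mul_ne_zero hφ (inv_ne_zero hψ), fun z ↦ ?_⟩
  rw [Scheme.ord_mul hφ (inv_ne_zero hψ), ord_inv hψ, ord_prod_fn, h, combination_zero,
    Finsupp.zero_apply]
  ring

end

section Evaluation

variable (D) (q : X) [UniqueFactorizationMonoid (X.presheaf.stalk q)]

/-- Local equations of the divisors `D i` at a factorial point give a trivialization of the Cox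
sheaf near this point, and an evaluation homomorphism. -/
lemma exists_evaluation : ∃ ev : AddMonoidAlgebra X.functionField (Fin r → ℤ) →+* X.functionField,
    (∀ m φ, φ ≠ 0 → ∀ z : PrimeDivisor X, z.1 ⤳ q →
      Scheme.ord (ev (AddMonoidAlgebra.single m φ)) z.1 =
        Scheme.ord φ z.1 + combination D m z) ∧
    ∀ m φ, φ ≠ 0 → ev (AddMonoidAlgebra.single m φ) ≠ 0 := by
  choose d hd0 hd using fun i ↦ exists_localEquation_weilDivisor q (D i)
  -- Evaluation substitutes the local equation of D i at q for the i-th Laurent variable.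
  let δ : Multiplicative (Fin r → ℤ) →* X.functionField :=
    { toFun m := ∏ i, d i ^ (m.toAdd i)
      map_one' := by simp
      map_mul' m m' := by
        rw [← Finset.prod_mul_distrib]
        exact Finset.prod_congr rfl fun i _ ↦ zpow_add₀ (hd0 i) _ _ }
  let ev := AddMonoidAlgebra.lift X.functionField X.functionField (Fin r → ℤ) δ
  have hev : ∀ m φ, ev (AddMonoidAlgebra.single m φ) = φ * ∏ i, d i ^ m i := fun m φ ↦ by
    simp [ev, AddMonoidAlgebra.lift_single, δ]
  have hδ : ∀ m : Fin r → ℤ, ∏ i, d i ^ m i ≠ 0 := fun m ↦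
    Finset.prod_ne_zero_iff.mpr fun i _ ↦ zpow_ne_zero _ (hd0 i)
  refine ⟨ev.toRingHom, fun m φ hφ z hz ↦ ?_, fun m φ hφ ↦ ?_⟩
  · change Scheme.ord (ev _) _ = _
    rw [hev, Scheme.ord_mul hφ (hδ m), ord_prod_zpow _ hd0, combination_apply]
    congr 1
    exact Finset.sum_congr rfl fun i _ ↦ by rw [hd i z hz]
  · change ev _ ≠ 0
    rw [hev]
    exact mul_ne_zero hφ (hδ m)

end Evaluation

end Divisors

end CoxModel

namespace CoxModel

/-! ### Evaluating the Cox ring at a point of the surface. -/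

section LocalTriviality

open IsLocalRing

lemma exists_ringHom_of_mem_range {S : Type*} [CommRing S] {X : Scheme.{u}} [IsIntegral X]
    {q : X} (g : S →+* X.functionField)
    (h : ∀ x, g x ∈ (toFunctionField q).range) :
    ∃ θ : S →+* X.presheaf.stalk q, ∀ x, toFunctionField q (θ x) = g x := by
  have hinj := toFunctionField_injective q
  choose θ hθ using h
  exact ⟨{ toFun := θ
           map_zero' := hinj (by rw [hθ, map_zero, map_zero])
           map_one' := hinj (by rw [hθ, map_one, map_one])
           map_add' x y := hinj (by rw [hθ, map_add, map_add, hθ, hθ])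
           map_mul' x y := hinj (by rw [hθ, map_mul, map_mul, hθ, hθ]) }, hθ⟩

variable {X : Scheme.{u}} [IsIntegral X] [IsLocallyNoetherian X] {r : ℕ}
  {D : Fin r → WeilDivisor X}

/-- A homomorphism `ev` as in `exists_evaluation` maps the sections over a neighborhood of `q` to
the local ring at `q`. -/
lemma map_mem_range_of_mem_coxRing {q : X} [UniqueFactorizationMonoid (X.presheaf.stalk q)]
    {ev : AddMonoidAlgebra X.functionField (Fin r → ℤ) →+* X.functionField}
    (hev : ∀ m φ, φ ≠ 0 → ∀ z : PrimeDivisor X, z.1 ⤳ q →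
      Scheme.ord (ev (AddMonoidAlgebra.single m φ)) z.1 = Scheme.ord φ z.1 + combination D m z)
    (hev0 : ∀ m φ, φ ≠ 0 → ev (AddMonoidAlgebra.single m φ) ≠ 0) {U : X.Opens} (hU : q ∈ U)
    {f : AddMonoidAlgebra X.functionField (Fin r → ℤ)} (hf : f ∈ coxRing D U) :
    ev f ∈ (toFunctionField q).range := by
  induction hf using Subring.closure_induction with
  | mem f hf =>
    obtain ⟨m, φ, hφ, rfl⟩ := hf
    obtain rfl | h0 := eq_or_ne φ 0
    · rw [AddMonoidAlgebra.single_zero, map_zero]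
      exact zero_mem _
    · obtain ⟨y, hy⟩ := exists_toFunctionField_eq q (hev0 m φ h0) fun z hz hzq ↦ by
        rw [hev m φ h0 ⟨z, hz⟩ hzq]
        exact hφ h0 ⟨z, hz⟩ (hzq.mem_open U.isOpen hU)
      rw [← hy]
      exact RingHom.mem_range_self _ y
  | zero => rw [map_zero]; exact zero_mem _
  | one => rw [map_one]; exact one_mem _
  | add f g _ _ hf hg => rw [map_add]; exact add_mem hf hg
  | neg f _ hf => rw [map_neg]; exact neg_mem hf
  | mul f g _ _ hf hg => rw [map_mul]; exact mul_mem hf hg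

/-- The evaluation factors through the sections of the Cox sheaf over an affine neighborhood of q,
whose spectrum is part of the characteristic space. -/
lemma comap_closedPoint_mem_characteristicSpace {q : X}
    {θ : coxRing D ⊤ →+* X.presheaf.stalk q}
    (hθ : ∀ U : X.Opens, q ∈ U → ∃ θ' : coxRing D U →+* X.presheaf.stalk q,
      θ'.comp (Subring.inclusion (coxRing_top_le D U)) = θ) :
    PrimeSpectrum.comap θ (closedPoint (X.presheaf.stalk q)) ∈ characteristicSpace D := by
  obtain ⟨_, ⟨V, hV, rfl⟩, hqV, -⟩ := X.isBasis_affineOpens.exists_subset_of_mem_open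
    (show q ∈ (⊤ : X.Opens) from trivial) isOpen_univ
  obtain ⟨θ', rfl⟩ := hθ V hqV
  rw [PrimeSpectrum.comap_comp_apply]
  exact Set.mem_iUnion₂.mpr ⟨V, ⟨hV, q, hqV⟩, Set.mem_range_self _⟩

/-- A homomorphism from the Cox ring to the local ring at a point `q` whose kernel over the
residue field lies in the characteristic space, and which maps the section of a prime divisor
through `q` to the maximal ideal. -/
lemma exists_coxRing_evaluation {σ : Type} (s : σ → PrimeSection D) (q : X)
    [UniqueFactorizationMonoid (X.presheaf.stalk q)] :
    ∃ θ : coxRing D ⊤ →+* X.presheaf.stalk q,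
      PrimeSpectrum.comap θ (closedPoint (X.presheaf.stalk q)) ∈ characteristicSpace D ∧
      ∀ i, (s i).curve.1 ⤳ q → θ (s i).toCox ∈ maximalIdeal (X.presheaf.stalk q) := by
  obtain ⟨ev, hev, hev0⟩ := exists_evaluation D q
  have hinj := toFunctionField_injective q
  have hθ : ∀ U : X.Opens, q ∈ U → ∃ θ : coxRing D U →+* X.presheaf.stalk q,
      ∀ f : coxRing D U, toFunctionField q (θ f) = ev f := fun U hU ↦
    exists_ringHom_of_mem_range (ev.comp (coxRing D U).subtype) fun f ↦
      map_mem_range_of_mem_coxRing hev hev0 hU f.2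
  choose θ hθ using hθ
  have htop : q ∈ (⊤ : X.Opens) := trivial
  refine ⟨θ ⊤ htop, comap_closedPoint_mem_characteristicSpace fun U hU ↦ ⟨θ U hU, ?_⟩,
    fun i hi ↦ ?_⟩
  · refine RingHom.ext fun f ↦ hinj ?_
    rw [RingHom.comp_apply, hθ, hθ, Subring.coe_inclusion]
  · refine (mem_maximalIdeal _).mpr fun hu ↦ ?_
    -- A unit has order zero along the curve of s i, but the evaluated section has order one there.
    have h1 : Scheme.ord (toFunctionField q (θ ⊤ htop (s i).toCox)) (s i).curve.1 = 0 :=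
      ord_eq_zero_of_notMem hi fun h ↦ Ideal.IsPrime.ne_top'
        (Ideal.eq_top_of_isUnit_mem (primeOfGenerization hi) h hu)
    have h : ((s i).toCox : AddMonoidAlgebra X.functionField (Fin r → ℤ)) =
        AddMonoidAlgebra.single (s i).deg (s i).fn := rfl
    rw [hθ, h] at h1
    have h2 := hev (s i).deg (s i).fn (s i).fn_ne_zero (s i).curve hi
    rw [(s i).div_eq, Finsupp.single_eq_same] at h2
    rw [h1] at h2
    exact zero_ne_one h2

end LocalTriviality

/-! ### Degrees of the variables that are units at a point. -/

section Degrees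

open IsLocalRing

variable {A : Type u} [CommRing A] {σ : Type} [Fintype σ] {r : ℕ}

/-- Let `Φ` be a homomorphism from `A[η]`, with kernel containing `G`, to a local ring. If a monomial
is mapped to a unit, and the localization of `A[η] ⧸ G` at this monomial has a homogeneous unit
of degree `e`, then `e` is a combination of the degrees of the variables mapped to units. -/
lemma exists_sum_smul_eq_of_hasHomogeneousUnit {w : σ → Fin r → ℤ} {G : Ideal (MvPolynomial σ A)}
    {O : Type*} [CommRing O] [IsLocalRing O] (Φ : MvPolynomial σ A →+* O)
    (hΦ : ∀ g ∈ G, Φ g = 0) (a : σ →₀ ℕ) (ha : IsUnit (Φ (monomial a 1))) {e : Fin r → ℤ}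
    (h : (monomialElement w G a).HasHomogeneousUnit e) :
    ∃ c : σ → ℤ, ∑ i, c i • w i = e ∧ ∀ i, Φ (X i) ∈ maximalIdeal O → c i = 0 := by
  have key : ∀ (b : σ →₀ ℕ) (y : A), IsUnit (Φ (monomial b y)) →
      ∀ i, Φ (X i) ∈ maximalIdeal O → b i = 0 := by
    intro b y hb i hi
    by_contra h0
    have h1 : (X i : MvPolynomial σ A) ∣ monomial b y := by
      rw [X_dvd_monomial]
      exact Or.inr h0
    exact (mem_maximalIdeal _).mp hi (isUnit_of_dvd_unit (map_dvd Φ h1) hb)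
  obtain ⟨u, ⟨k, c, ⟨P, hP, rfl⟩, hc⟩, v, -, huv⟩ := h
  let ψ := Ideal.Quotient.lift G Φ hΦ
  let χ := IsLocalization.Away.lift (S := Localization.Away (monomialElement w G a).val)
    (monomialElement w G a).val (g := ψ) (by simpa [ψ, monomialElement] using ha)
  have hχ : ∀ f, χ (algebraMap _ _ f) = ψ f := fun f ↦ IsLocalization.Away.lift_eq _ _ f
  have hu : IsUnit (χ u) := (IsUnit.of_mul_eq_one _ huv).map χ
  have hPu : IsUnit (Φ P) := by
    have h1 := congrArg χ hc
    rw [map_mul, hχ, hχ, map_pow] at h1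
    have h2 : Φ P = χ u * Φ (monomial a 1) ^ k := h1.symm
    rw [h2]
    exact hu.mul (ha.pow k)
  -- In a local ring, a sum that is a unit has a summand that is a unit. This monomial and f involve
  -- only variables that become units, and their exponents give the combination for e.
  obtain ⟨b, hb, hbu⟩ : ∃ b ∈ P.support, IsUnit (Φ (monomial b (coeff b P))) := by
    by_contra! hcon
    rw [P.as_sum, map_sum] at hPu
    exact (mem_maximalIdeal _).mp (sum_mem fun b hb ↦ (mem_maximalIdeal _).mpr (hcon b hb)) hPu
  have hw : Finsupp.weight w b = e + k • Finsupp.weight w a := hP (mem_support_iff.mp hb)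
  refine ⟨fun i ↦ b i - k * a i, ?_, fun i hi ↦ ?_⟩
  · rw [eq_sub_of_add_eq hw.symm, weight_eq_sum, weight_eq_sum, Finset.smul_sum,
      ← Finset.sum_sub_distrib]
    refine Finset.sum_congr rfl fun i _ ↦ ?_
    rw [sub_smul, mul_smul, natCast_zsmul _ k]
  · change (b i : ℤ) - k * a i = 0
    rw [key b _ hbu i hi, key a _ ha i hi]
    simp

end Degrees

end CoxModel

namespace CoxModel

/-! ### Consequences of the presentation of the Cox ring. -/

section CoxPresentation

open IsLocalRing

variable {A k : Type u} [CommRing A] [Field k] [Algebra A k] {Y : Scheme.{u}} [IsIntegral Y]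
  [IsLocallyNoetherian Y] {p : Y ⟶ Spec (.of k)} {r : ℕ} {D : Fin r → WeilDivisor Y} {σ : Type}
  {s : σ → PrimeSection D} {G : Ideal (MvPolynomial σ A)}

variable (A p s) in
/-- The homomorphism from `A[η]` to the Cox ring. -/
noncomputable def coxHomBase :
    MvPolynomial σ A →+* AddMonoidAlgebra Y.functionField (Fin r → ℤ) :=
  (coxHom p s).comp (MvPolynomial.map (algebraMap A k))

lemma coxHomBase_X (i : σ) :
    coxHomBase A p s (X i) = AddMonoidAlgebra.single (s i).deg (s i).fn := by
  simp [coxHomBase, coxHom, PrimeSection.toCox]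

lemma coxHomBase_monomial_one (b : σ →₀ ℕ) :
    coxHomBase A p s (monomial b 1) = coxMonomial s b := by
  simp [coxHomBase, coxHom, coxMonomial, eval₂_monomial, Finsupp.prod,
    ← AddMonoidAlgebra.one_def]

lemma exists_coxHomBase_monomial_eq (b : σ →₀ ℕ) (y : A) :
    ∃ φ, coxHomBase A p s (monomial b y) =
      AddMonoidAlgebra.single (Finsupp.weight (fun i ↦ (s i).deg) b) φ := by
  induction b using Finsupp.induction_linear generalizing y with
  | zero =>
    exact ⟨constants p (algebraMap A k y), by simp [coxHomBase, coxHom]⟩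
  | add b c hb hc =>
    obtain ⟨φ, hφ⟩ := hb y
    obtain ⟨ψ, hψ⟩ := hc 1
    refine ⟨φ * ψ, ?_⟩
    rw [← mul_one y, ← monomial_mul, map_mul, hφ, hψ, AddMonoidAlgebra.single_mul_single, map_add]
  | single i n =>
    refine ⟨constants p (algebraMap A k y) * (s i).fn ^ n, ?_⟩
    simp [coxHomBase, coxHom, eval₂_monomial, PrimeSection.toCox, AddMonoidAlgebra.single_pow,
      AddMonoidAlgebra.single_mul_single, Finsupp.weight_single]

/-- The homomorphism to the Cox ring respects degrees, so its kernel G is homogeneous. -/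
lemma coxHomBase_weightedHomogeneousComponent (P : MvPolynomial σ A) (d : Fin r → ℤ) :
    coxHomBase A p s (weightedHomogeneousComponent (fun i ↦ (s i).deg) d P) =
      AddMonoidAlgebra.single d ((coxHomBase A p s P).coeff d) := by
  induction P using MvPolynomial.induction_on' with
  | monomial b y =>
    obtain ⟨φ, hφ⟩ := exists_coxHomBase_monomial_eq (p := p) (s := s) b y
    have hb := isWeightedHomogeneous_monomial (fun i ↦ (s i).deg) b y rfl
    by_cases h : Finsupp.weight (fun i ↦ (s i).deg) b = d
    · subst h
      rw [hb.weightedHomogeneousComponent_same, hφ, AddMonoidAlgebra.coeff_single,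
        Finsupp.single_eq_same]
    · rw [hb.weightedHomogeneousComponent_ne _ (Ne.symm h), hφ, AddMonoidAlgebra.coeff_single,
        Finsupp.single_eq_of_ne (Ne.symm h), map_zero, AddMonoidAlgebra.single_zero]
  | add P Q hP hQ =>
    rw [map_add, map_add, map_add, hP, hQ, AddMonoidAlgebra.coeff_add, Finsupp.add_apply,
      AddMonoidAlgebra.single_add]

lemma IsCoxPresentation.ker_coxHomBase (hs : IsCoxPresentation p s G) :
    RingHom.ker (coxHomBase A p s) = G := by
  rw [coxHomBase, ← RingHom.comap_ker, hs.ker_eq, hs.comap_map]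

lemma IsCoxPresentation.isPrime (hs : IsCoxPresentation p s G) : G.IsPrime := by
  rw [← hs.ker_coxHomBase]
  exact RingHom.ker_isPrime _

lemma IsCoxPresentation.X_notMem (hs : IsCoxPresentation p s G) (i : σ) : X i ∉ G := by
  rw [← hs.ker_coxHomBase, RingHom.mem_ker, coxHomBase_X, AddMonoidAlgebra.single_eq_zero]
  exact (s i).fn_ne_zero

lemma IsCoxPresentation.component_mem (hs : IsCoxPresentation p s G) {P : MvPolynomial σ A}
    (hP : P ∈ G) (d : Fin r → ℤ) :
    weightedHomogeneousComponent (fun i ↦ (s i).deg) d P ∈ G := by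
  rw [← hs.ker_coxHomBase, RingHom.mem_ker] at hP ⊢
  rw [coxHomBase_weightedHomogeneousComponent, hP]
  simp

/-- If the monomials with exponent vectors `a j` define the complement of the characteristic space,
then at least one of them does not vanish over a given factorial point `q`, and the degree group
is generated by the degrees of the sections which do not vanish at `q`. -/
theorem IsCoxPresentation.exists_sum_smul_deg_eq [Fintype σ] (hs : IsCoxPresentation p s G)
    {ι : Type} {a : ι → σ →₀ ℕ} (ha : DefinesComplement s a)
    (hunits : HasAllUnits (generators (fun i ↦ (s i).deg) G a))
    (q : Y) [UniqueFactorizationMonoid (Y.presheaf.stalk q)] :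
    Nonempty ι ∧ ∀ e, ∃ c : σ → ℤ, ∑ i, c i • (s i).deg = e ∧
      ∀ i, (s i).curve.1 ⤳ q → c i = 0 := by
  obtain ⟨θ, hθ, hθ'⟩ := exists_coxRing_evaluation s q
  have hmem : ∀ P, coxHomBase A p s P ∈ coxRing D ⊤ := fun P ↦ by
    rw [← hs.range_eq]
    exact ⟨_, rfl⟩
  let γ := (coxHomBase A p s).codRestrict (coxRing D ⊤) hmem
  have hγ : ∀ b, γ (monomial b 1) = coxMonomial s b := fun b ↦
    Subtype.ext (coxHomBase_monomial_one b)
  have hγX : ∀ i, γ (X i) = (s i).toCox := fun i ↦ Subtype.ext (coxHomBase_X i)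
  -- The evaluation at q gives a point of the characteristic space, where not all of the defining
  -- monomials vanish.
  obtain ⟨j, hj⟩ : ∃ j, IsUnit (θ (coxMonomial s (a j))) := by
    by_contra! hc
    have h1 : PrimeSpectrum.comap θ (closedPoint (Y.presheaf.stalk q)) ∈
        PrimeSpectrum.zeroLocus (Set.range fun j ↦ coxMonomial s (a j)) := by
      rintro _ ⟨j, rfl⟩
      exact (mem_maximalIdeal _).mpr (hc j)
    rw [ha] at h1
    exact h1 hθ
  refine ⟨⟨j⟩, fun e ↦ ?_⟩
  obtain ⟨c, hc, hc'⟩ := exists_sum_smul_eq_of_hasHomogeneousUnit (θ.comp γ) (fun g hg ↦ by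
    have : γ g = 0 := Subtype.ext (by
      rw [← hs.ker_coxHomBase] at hg
      exact hg)
    rw [RingHom.comp_apply, this, map_zero]) (a j) (by
      rwa [RingHom.comp_apply, hγ]) (hunits j e)
  refine ⟨c, hc, fun i hi ↦ hc' i ?_⟩
  rw [RingHom.comp_apply, hγX]
  exact hθ' i hi

end CoxPresentation

end CoxModel

namespace CoxModel

/-! ### Points of codimension at least two. -/

section Codimension

open IsLocalRing

variable {X : Scheme.{u}}

lemma coheight_add_one_le_of_specializes {z x : X} (h : z ⤳ x) (hne : z ≠ x) :
    Order.coheight z + 1 ≤ Order.coheight x :=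
  Order.coheight_add_one_le ⟨h, fun h' ↦ hne (h.antisymm h').eq⟩

lemma eq_of_specializes_of_coheight_eq_one {z x : X} (h : z ⤳ x) (hz : Order.coheight z = 1)
    (hx : Order.coheight x = 1) : z = x := by
  by_contra hne
  have := coheight_add_one_le_of_specializes h hne
  rw [hz, hx] at this
  exact absurd this (by decide)

/-- The points of codimension at least two of a smooth surface are factorial. -/
lemma uniqueFactorizationMonoid_stalk {k : Type u} [Field k] (p : X ⟶ Spec (.of k))
    [SmoothOfRelativeDimension 2 p] [IsIntegral X] [IsLocallyNoetherian X] {z x : X} (h : z ⤳ x)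
    (hne : z ≠ x) (hz : Order.coheight z = 1) :
    UniqueFactorizationMonoid (X.presheaf.stalk x) := by
  obtain ⟨a, b, hab⟩ := exists_maximalIdeal_stalk_eq_span_pair p x
  refine uniqueFactorizationMonoid_of_maximalIdeal_eq_span_pair hab fun hd ↦ ?_
  have h1 := coheight_add_one_le_of_specializes h hne
  rw [Ring.krullDimLE_iff, ringKrullDim_stalk_eq_coheight] at hd
  have h2 : Order.coheight x ≤ 1 := by exact_mod_cast hd
  rw [hz] at h1
  exact absurd (h1.trans h2) (by decide)

end Codimension

/-! ### Multiplicities along the exceptional curve. -/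

section Exceptional

open IsLocalRing

variable {S S' : Scheme.{u}} {b : S ⟶ S'} {E : PrimeDivisor S} {x : S'}

/-- Prime divisors other than the exceptional curve are not contracted. -/
lemma IsContraction.map_ne (H : IsContraction b E.1 x) {z : PrimeDivisor S} (hz : z ≠ E) :
    b z.1 ≠ x := fun h ↦
  hz (Subtype.ext (eq_of_specializes_of_coheight_eq_one (H.map_eq_iff.mp h) E.2 z.2).symm)

lemma IsContraction.exists_primeDivisor (H : IsContraction b E.1 x)
    (hx : Order.coheight x ≠ 1) (z' : PrimeDivisor S') :
    ∃ z : PrimeDivisor S, z ≠ E ∧ b z.1 = z'.1 := by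
  have hne : z'.1 ≠ x := fun h ↦ hx (h ▸ z'.2)
  obtain ⟨z, hz, -⟩ := H.existsUnique_map_eq hne
  have hz' : b z ≠ x := hz ▸ hne
  refine ⟨⟨z, ?_⟩, ?_, hz⟩
  · rw [← coheight_eq_of_stalkMap_bijective _ (H.stalkMap_bijective hz'), hz, z'.2]
  · intro h
    exact hz' ((congrArg (fun w : PrimeDivisor S ↦ b w.1) h).trans H.map_eq)

variable {n : ℕ} {C : Fin (n + 2) → PrimeDivisor S} {C' : Fin (n + 2) → PrimeDivisor S'}

/-- The situation of the contraction of a curve `E` to a point `x` through which two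
of the images of given curves pass, where the curves themselves are disjoint. -/
structure IsContractionOfCurves (b : S ⟶ S') (E : PrimeDivisor S) (x : S')
    (C : Fin (n + 2) → PrimeDivisor S) (C' : Fin (n + 2) → PrimeDivisor S') : Prop where
  isContraction : IsContraction b E.1 x
  map_eq : ∀ i, b (C i).1 = (C' i).1
  specializes_iff : ∀ i, (C' i).1 ⤳ x ↔ i = 0 ∨ i = 1
  not_specializes : ∀ q, (C 0).1 ⤳ q → ¬ (C 1).1 ⤳ q

namespace IsContractionOfCurves

variable (H : IsContractionOfCurves b E x C C')
include H

/-- If x had codimension one, the first two curves C' i would have x as generic point, so that C 0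
and C 1 would both be the exceptional curve; but they are disjoint. -/
lemma coheight_ne : Order.coheight x ≠ 1 := by
  intro hx
  have h : ∀ i, i = 0 ∨ i = 1 → C i = E := fun i hi ↦ by
    by_contra hne
    refine H.isContraction.map_ne hne ?_
    rw [H.map_eq]
    exact eq_of_specializes_of_coheight_eq_one ((H.specializes_iff i).mpr hi) (C' i).2 hx
  refine H.not_specializes E.1 ?_ ?_
  · rw [h 0 (.inl rfl)]
  · rw [h 1 (.inr rfl)]

lemma ne_point (i) : (C' i).1 ≠ x := fun h ↦ H.coheight_ne (h ▸ (C' i).2)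

lemma ne_exceptional (i) : C i ≠ E := by
  intro h
  refine H.ne_point i ?_
  rw [← H.map_eq, h, H.isContraction.map_eq]

lemma single_eq (i) {z : PrimeDivisor S} (hz : z ≠ E) {z' : PrimeDivisor S'} (h : b z.1 = z'.1) :
    Finsupp.single (C i) (1 : ℤ) z = Finsupp.single (C' i) (1 : ℤ) z' := by
  classical
  rw [Finsupp.single_apply, Finsupp.single_apply]
  congr 1
  refine propext ⟨?_, ?_⟩
  · rintro rfl
    exact Subtype.ext ((H.map_eq i).symm.trans h)
  · rintro rfl
    exact Subtype.ext ((H.isContraction.existsUnique_map_eq (H.ne_point i)).unique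
      (H.map_eq i) h)

variable [IsIntegral S] [IsIntegral S']

lemma map_genericPoint : b (genericPoint S) = genericPoint S' := by
  refine H.isContraction.map_genericPoint fun h ↦ H.ne_point 0 ?_
  have h1 : genericPoint S' ⤳ (C' 0).1 := (genericPoint_spec S').specializes trivial
  rw [h] at h1
  exact (((H.specializes_iff 0).mpr (.inl rfl)).antisymm h1).eq

lemma functionFieldMap_surjective : Function.Surjective (functionFieldMap H.map_genericPoint) := by
  refine CoxModel.functionFieldMap_surjective _ (H.isContraction.stalkMap_bijective ?_)
  rw [H.map_genericPoint]
  intro h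
  have h1 : genericPoint S' ⤳ (C' 0).1 := (genericPoint_spec S').specializes trivial
  rw [h] at h1
  exact H.ne_point 0 (((H.specializes_iff 0).mpr (.inl rfl)).antisymm h1).eq

variable [IsLocallyNoetherian S]

lemma zero_le_ord_exceptional {y : S'.presheaf.stalk x} (hy : y ≠ 0) :
    0 ≤ Scheme.ord (functionFieldMap H.map_genericPoint (toFunctionField x y)) E.1 := by
  obtain rfl := H.isContraction.map_eq
  rw [functionFieldMap_toFunctionField]
  refine ord_toFunctionField_nonneg fun h0 ↦ ?_
  have h1 := functionFieldMap_toFunctionField H.map_genericPoint E.1 y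
  rw [h0, map_zero, map_eq_zero_iff _ (RingHom.injective _),
    map_eq_zero_iff _ (toFunctionField_injective _)] at h1
  exact hy h1

lemma ord_exceptional_of_isUnit {y : S'.presheaf.stalk x} (hy : IsUnit y) :
    Scheme.ord (functionFieldMap H.map_genericPoint (toFunctionField x y)) E.1 = 0 := by
  obtain rfl := H.isContraction.map_eq
  rw [functionFieldMap_toFunctionField]
  exact ord_toFunctionField_of_isUnit (hy.map _)

variable [IsLocallyNoetherian S']

lemma ord_functionFieldMap {z : PrimeDivisor S} (hz : z ≠ E) (φ : S'.functionField) :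
    Scheme.ord (functionFieldMap H.map_genericPoint φ) z.1 = Scheme.ord φ (b z.1) :=
  CoxModel.ord_functionFieldMap _ _ (H.isContraction.stalkMap_bijective (H.isContraction.map_ne hz)) φ

/-- The multiplicity of the exceptional curve in the pull-back of the divisor of a rational
function. -/
lemma exists_multiplicities [UniqueFactorizationMonoid (S'.presheaf.stalk x)] :
    ∃ v₀ v₁ : ℤ, 0 ≤ v₀ ∧ 0 ≤ v₁ ∧ ∀ (c : Fin (n + 2) → ℤ) (φ : S'.functionField), φ ≠ 0 →
      (∀ z : PrimeDivisor S', Scheme.ord φ z.1 = ∑ i, c i * Finsupp.single (C' i) (1 : ℤ) z) →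
      Scheme.ord (functionFieldMap H.map_genericPoint φ) E.1 = c 0 * v₀ + c 1 * v₁ := by
  obtain ⟨y₀, hy₀, h₀⟩ := exists_localEquation x (C' 0).2
  obtain ⟨y₁, hy₁, h₁⟩ := exists_localEquation x (C' 1).2
  -- The numbers v₀, v₁ are the orders along E of the pulled-back local equations at x of the two
  -- curves through x.
  refine ⟨_, _, H.zero_le_ord_exceptional hy₀, H.zero_le_ord_exceptional hy₁, fun c φ hφ h ↦ ?_⟩
  have n₀ := (map_ne_zero_iff _ (toFunctionField_injective x)).mpr hy₀
  have n₁ := (map_ne_zero_iff _ (toFunctionField_injective x)).mpr hy₁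
  set Y₀ := toFunctionField x y₀
  set Y₁ := toFunctionField x y₁
  have n : Y₀ ^ c 0 * Y₁ ^ c 1 ≠ 0 := mul_ne_zero (zpow_ne_zero _ n₀) (zpow_ne_zero _ n₁)
  have hψ : φ * (Y₀ ^ c 0 * Y₁ ^ c 1)⁻¹ ≠ 0 := mul_ne_zero hφ (inv_ne_zero n)
  -- Only the first two curves pass through x, so φ divided by the powers of their local equations
  -- has neither zeros nor poles near x. It is therefore a unit at x, and its pull-back has order
  -- zero along E.
  have hord : ∀ z : PrimeDivisor S', z.1 ⤳ x →
      Scheme.ord (φ * (Y₀ ^ c 0 * Y₁ ^ c 1)⁻¹) z.1 = 0 := by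
    intro z hzx
    have hsum : ∑ i, c i * Finsupp.single (C' i) (1 : ℤ) z =
        c 0 * Finsupp.single (C' 0).1 (1 : ℤ) z.1 + c 1 * Finsupp.single (C' 1).1 (1 : ℤ) z.1 := by
      rw [← single_primeDivisor_apply, ← single_primeDivisor_apply]
      refine Fintype.sum_eq_add 0 1 (by simp) fun i hi ↦ ?_
      rw [Finsupp.single_eq_of_ne, mul_zero]
      rintro rfl
      exact ((H.specializes_iff i).mp hzx).elim hi.1 hi.2
    rw [Scheme.ord_mul hφ (inv_ne_zero n), ord_inv n,
      Scheme.ord_mul (zpow_ne_zero _ n₀) (zpow_ne_zero _ n₁), ord_zpow n₀, ord_zpow n₁,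
      h z, h₀ z.1 z.2 hzx, h₁ z.1 z.2 hzx, hsum, add_neg_cancel]
  obtain ⟨y, hy⟩ := exists_toFunctionField_eq x hψ fun z hz hzx ↦ (hord ⟨z, hz⟩ hzx).ge
  obtain ⟨y', hy'⟩ := exists_toFunctionField_eq x (inv_ne_zero hψ) fun z hz hzx ↦ by
    rw [ord_inv hψ, hord ⟨z, hz⟩ hzx, neg_zero]
  have hu : IsUnit y := by
    refine IsUnit.of_mul_eq_one y' (toFunctionField_injective x ?_)
    rw [map_mul, hy, hy', mul_inv_cancel₀ hψ, map_one]
  have hφ' : φ = toFunctionField x y * (Y₀ ^ c 0 * Y₁ ^ c 1) := by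
    rw [hy, mul_assoc, inv_mul_cancel₀ n, mul_one]
  have inj := (functionFieldMap H.map_genericPoint).injective
  have m₀ := (map_ne_zero_iff _ inj).mpr n₀
  have m₁ := (map_ne_zero_iff _ inj).mpr n₁
  have m := (map_ne_zero_iff _ inj).mpr ((map_ne_zero_iff _ (toFunctionField_injective x)).mpr
    hu.ne_zero)
  rw [hφ', map_mul, map_mul, map_zpow₀, map_zpow₀, Scheme.ord_mul m
    (mul_ne_zero (zpow_ne_zero _ m₀) (zpow_ne_zero _ m₁)),
    Scheme.ord_mul (zpow_ne_zero _ m₀) (zpow_ne_zero _ m₁), ord_zpow m₀, ord_zpow m₁,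
    H.ord_exceptional_of_isUnit hu, zero_add]

/-- A relation between the curves `C i` and the exceptional curve descends. -/
lemma descend {φ : S'.functionField}
    {c : Fin (n + 2) → ℤ}
    (h : ∀ z : PrimeDivisor S, z ≠ E →
      Scheme.ord (functionFieldMap H.map_genericPoint φ) z.1 =
        ∑ i, c i * Finsupp.single (C i) (1 : ℤ) z) (z' : PrimeDivisor S') :
    Scheme.ord φ z'.1 = ∑ i, c i * Finsupp.single (C' i) (1 : ℤ) z' := by
  obtain ⟨z, hz, hzz'⟩ := H.isContraction.exists_primeDivisor H.coheight_ne z'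
  rw [← hzz', ← H.ord_functionFieldMap hz, h z hz]
  exact Finset.sum_congr rfl fun i _ ↦ by rw [H.single_eq i hz hzz']

end IsContractionOfCurves

end Exceptional

end CoxModel

namespace CoxModel

/-! ### Relations between the degrees on both surfaces. -/

section ContractionGrading

lemma sum_single_of_ne {X : Scheme.{u}} {n : ℕ} {C : Fin (n + 3) → PrimeDivisor X}
    (c : Fin (n + 3) → ℤ) {z : PrimeDivisor X} (hz : z ≠ C (Fin.last (n + 2))) :
    ∑ i, c i * Finsupp.single (C i) (1 : ℤ) z =
      ∑ i : Fin (n + 2), c i.castSucc * Finsupp.single (C i.castSucc) (1 : ℤ) z := by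
  rw [Fin.sum_univ_castSucc, Finsupp.single_eq_of_ne hz, mul_zero, add_zero]

namespace IsContractionOfCurves

section

variable {S S' : Scheme.{u}} {b : S ⟶ S'} {E : PrimeDivisor S} {x : S'} {n : ℕ}
  {C : Fin (n + 2) → PrimeDivisor S} {C' : Fin (n + 2) → PrimeDivisor S'}
  (H : IsContractionOfCurves b E x C C')
include H

/-- The curves whose images pass through `x` meet the exceptional curve. -/
lemma exists_intersection_point [IsProper b] (i : Fin (n + 2)) (hi : i = 0 ∨ i = 1) :
    ∃ q, (C i).1 ⤳ q ∧ E.1 ⤳ q := by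
  -- As b is closed, the image of the curve contains x with the generic point of the image.
  have h1 : IsClosed (b '' closure {(C i).1}) := b.isClosedMap _ isClosed_closure
  have h2 : x ∈ b '' closure {(C i).1} := by
    refine h1.stableUnderSpecialization ((H.specializes_iff i).mpr hi) ?_
    exact ⟨_, subset_closure rfl, H.map_eq i⟩
  obtain ⟨q, hq, hqx⟩ := h2
  exact ⟨q, specializes_iff_mem_closure.mpr hq, H.isContraction.map_eq_iff.mp hqx⟩

lemma ne_intersection_point (i : Fin (n + 2)) {q : S} (h : (C i).1 ⤳ q) (h' : E.1 ⤳ q) :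
    E.1 ≠ q := by
  rintro rfl
  exact H.ne_exceptional i (Subtype.ext (eq_of_specializes_of_coheight_eq_one h (C i).2 E.2))

end

variable {A k : Type u} [CommRing A] [Field k] [Algebra A k]
  {S S' : Scheme.{u}} [IsIntegral S] [IsLocallyNoetherian S]
  [IsIntegral S'] [IsLocallyNoetherian S'] {b : S ⟶ S'} {x : S'} {n r r' : ℕ}
  {D : Fin r → WeilDivisor S} {D' : Fin r' → WeilDivisor S'}
  {s : Fin (n + 3) → PrimeSection D} {s' : Fin (n + 2) → PrimeSection D'}
  (H : IsContractionOfCurves b (s (Fin.last (n + 2))).curve x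
    (fun i ↦ (s i.castSucc).curve) fun i ↦ (s' i).curve)
include H

lemma sum_single_exceptional (c : Fin (n + 3) → ℤ) :
    ∑ i, c i * Finsupp.single (s i).curve (1 : ℤ) (s (Fin.last (n + 2))).curve =
      c (Fin.last (n + 2)) := by
  rw [Fin.sum_univ_castSucc, Finsupp.single_eq_same, mul_one, Finset.sum_eq_zero, zero_add]
  intro i _
  rw [Finsupp.single_eq_of_ne (H.ne_exceptional i).symm, mul_zero]

/-- A relation between the degrees on the contracted surface comes from a rational function. -/
lemma exists_descent {c : Fin (n + 3) → ℤ} (hc : ∑ i, c i • (s i).deg = 0) :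
    ∃ φ : S'.functionField, φ ≠ 0 ∧
      (∀ z : PrimeDivisor S', Scheme.ord φ z.1 =
        ∑ i, c (Fin.castSucc i) * Finsupp.single (s' i).curve (1 : ℤ) z) ∧
      Scheme.ord (functionFieldMap H.map_genericPoint φ) (s (Fin.last (n + 2))).curve.1 =
        c (Fin.last (n + 2)) := by
  obtain ⟨ψ, hψ, h⟩ := exists_ord_eq_of_sum_smul_deg_eq_zero s c hc
  obtain ⟨φ, rfl⟩ := H.functionFieldMap_surjective ψ
  refine ⟨φ, fun h0 ↦ hψ (by rw [h0, map_zero]), ?_, ?_⟩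
  · exact H.descend fun z hz ↦ by rw [h z, sum_single_of_ne (C := fun i ↦ (s i).curve) c hz]
  · rw [h, H.sum_single_exceptional]

variable {p : S ⟶ Spec (.of k)} [SmoothOfRelativeDimension 2 p]
  {G : Ideal (MvPolynomial (Fin (n + 3)) A)}

/-- The exceptional curve is a relation of the sections not passing through a given point of it. -/
lemma exists_exceptional_relation [IsProper b] (hs : IsCoxPresentation p s G)
    {ι : Type} {a : ι → Fin (n + 3) →₀ ℕ} (ha : DefinesComplement s a)
    (hunits : HasAllUnits (generators (fun i ↦ (s i).deg) G a)) (i : Fin (n + 2))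
    (hi : i = 0 ∨ i = 1) :
    Nonempty ι ∧ (∀ e, ∃ c : Fin (n + 3) → ℤ, ∑ i, c i • (s i).deg = e) ∧
    ∃ c : Fin (n + 3) → ℤ, ∑ i, c i • (s i).deg = 0 ∧ c (Fin.last (n + 2)) = -1 ∧
      c i.castSucc = 0 := by
  obtain ⟨q, h1, h2⟩ := H.exists_intersection_point i hi
  have hne := H.ne_intersection_point i h1 h2
  have := uniqueFactorizationMonoid_stalk p h2 hne (s (Fin.last (n + 2))).curve.2
  obtain ⟨hι, h⟩ := hs.exists_sum_smul_deg_eq ha hunits q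
  refine ⟨hι, fun e ↦ (h e).imp fun c hc ↦ hc.1, ?_⟩
  -- Neither E nor C i contributes to this expression of e_N, as both pass through q; subtracting
  -- e_N leaves the coefficient -1 there.
  obtain ⟨c, hc, hc'⟩ := h (s (Fin.last (n + 2))).deg
  refine ⟨c - Pi.single (Fin.last (n + 2)) 1, ?_, ?_, ?_⟩
  · simp only [Pi.sub_apply, sub_smul, Finset.sum_sub_distrib, hc, Pi.single_apply, ite_smul,
      one_smul, zero_smul, Finset.sum_ite_eq', Finset.mem_univ, if_true, sub_self]
  · simp [hc' _ h2]
  · simp [hc' _ h1, (Fin.castSucc_lt_last i).ne]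

/-- The degrees of the sections on a surface and its contraction. -/
theorem isContractionGrading [IsProper b] {l : ℕ} {g : Fin l → MvPolynomial (Fin (n + 3)) A}
    (p' : S' ⟶ Spec (.of k)) [SmoothOfRelativeDimension 2 p']
    (hD : IsPicardBasis D) (hD' : IsPicardBasis D')
    (hs : IsCoxPresentation p s (Ideal.span (Set.range g)))
    {ι : Type} {a : ι → Fin (n + 3) →₀ ℕ} (ha : DefinesComplement s a)
    (hunits : HasAllUnits (generators (fun i ↦ (s i).deg) (Ideal.span (Set.range g)) a)) :
    Nonempty ι ∧ IsContractionGrading (fun i ↦ (s i).deg) (fun i ↦ (s' i).deg) g := by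
  have := uniqueFactorizationMonoid_stalk p' ((H.specializes_iff 0).mpr (.inl rfl))
    (H.ne_point 0) (s' 0).curve.2
  obtain ⟨v₀, v₁, hv₀, hv₁, hv⟩ := H.exists_multiplicities
  obtain ⟨hι, hgen, c₀, hc₀, hc₀', hc₀''⟩ := H.exists_exceptional_relation hs ha hunits 0 (.inl rfl)
  obtain ⟨-, -, c₁, hc₁, hc₁', hc₁''⟩ := H.exists_exceptional_relation hs ha hunits 1 (.inr rfl)
  have hlast : ∀ {c : Fin (n + 3) → ℤ}, ∑ i, c i • (s i).deg = 0 →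
      c (Fin.last (n + 2)) = c (Fin.castSucc 0) * v₀ + c (Fin.castSucc 1) * v₁ := by
    intro c hc
    obtain ⟨φ, hφ, h, h'⟩ := H.exists_descent hc
    rw [← h', hv _ φ hφ h]
  -- The relation with c_N = -1 and without the first curve reads -1 = c_2 v₁, so the nonnegative
  -- integer v₁ divides 1.
  have e₁ : v₁ = 1 := by
    have := hlast hc₀
    rw [hc₀', hc₀'', zero_mul, zero_add] at this
    have h3 : v₁ ∣ 1 := ⟨-c₀ (Fin.castSucc 1), by linarith⟩
    exact Int.eq_one_of_dvd_one hv₁ h3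
  have e₀ : v₀ = 1 := by
    have := hlast hc₁
    rw [hc₁', hc₁'', zero_mul, add_zero] at this
    have h3 : v₀ ∣ 1 := ⟨-c₁ (Fin.castSucc 0), by linarith⟩
    exact Int.eq_one_of_dvd_one hv₀ h3
  subst e₀ e₁
  refine ⟨hι, ⟨hs.isPrime, fun P hP d ↦ hs.component_mem hP d, hs.X_notMem, fun c hc ↦ ?_,
    fun c hc ↦ ?_, hgen⟩⟩
  · obtain ⟨φ, hφ, h, -⟩ := H.exists_descent hc
    exact ⟨by simpa using hlast hc, sum_smul_deg_eq_zero_of_ord_eq s' _ hD' hφ h⟩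
  · obtain ⟨φ, hφ, h⟩ := exists_ord_eq_of_sum_smul_deg_eq_zero s' c hc
    have h1 := hv c φ hφ h
    -- Conversely, a relation on the contracted surface pulls back, with order c_1 + c_2 along the
    -- exceptional curve since both multiplicities are one.
    have h2 := sum_smul_deg_eq_zero_of_ord_eq s
      (Fin.snoc (α := fun _ ↦ ℤ) c (c 0 + c 1)) hD
      (φ := functionFieldMap H.map_genericPoint φ) ((map_ne_zero _).mpr hφ) fun z ↦ by
        by_cases hz : z = (s (Fin.last (n + 2))).curve
        · subst hz
          rw [h1, H.sum_single_exceptional, Fin.snoc_last, mul_one, mul_one]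
        · rw [sum_single_of_ne (C := fun i ↦ (s i).curve) _ hz, H.ord_functionFieldMap hz]
          simp only [Fin.snoc_castSucc]
          have hbz : Order.coheight (b z.1) = 1 :=
            (coheight_eq_of_stalkMap_bijective _ (H.isContraction.stalkMap_bijective
              (H.isContraction.map_ne hz))).trans z.2
          rw [h ⟨b z.1, hbz⟩]
          exact Finset.sum_congr rfl fun i _ ↦ by
            rw [H.single_eq i hz (z' := ⟨b z.1, hbz⟩) rfl]
    rw [Fin.sum_univ_castSucc] at h2
    simpa only [Fin.snoc_castSucc, Fin.snoc_last] using h2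

end IsContractionOfCurves

end ContractionGrading

end CoxModel

theorem proposition3p8 {A K Kbar : Type u}
    [CommRing A] [IsDomain A] [IsNoetherianRing A]
    [Field K] [Algebra A K] [IsFractionRing A K] [CharZero K]
    [Field Kbar] [Algebra K Kbar] [IsAlgClosure K Kbar] [Algebra A Kbar] [IsScalarTower A K Kbar]
    -- the surface, its Cox ring, and the complement of its characteristic space
    {S : Scheme.{u}} (p : S ⟶ Spec (.of Kbar)) [IsIntegral S] [IsLocallyNoetherian S]
    [IsProper p] [SmoothOfRelativeDimension 2 p]
    {r : ℕ} (D : Fin r → WeilDivisor S) (hD : IsPicardBasis D)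
    {n : ℕ} (s : Fin (n + 3) → PrimeSection D)
    {l : ℕ} (g : Fin l → MvPolynomial (Fin (n + 3)) A)
    (hs : IsCoxPresentation p s (Ideal.span (Set.range g)))
    {m : ℕ} (a : Fin m → Fin (n + 3) →₀ ℕ) (ha : DefinesComplement s a)
    -- the contracted surface
    {S' : Scheme.{u}} (p' : S' ⟶ Spec (.of Kbar)) [IsIntegral S'] [IsLocallyNoetherian S']
    [IsProper p'] [SmoothOfRelativeDimension 2 p']
    (b : S ⟶ S') (hb : b ≫ p' = p)
    (x : S') (hx : IsContraction b (s (Fin.last (n + 2))).curve.1 x)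
    {r' : ℕ} (D' : Fin r' → WeilDivisor S') (hD' : IsPicardBasis D')
    (s' : Fin (n + 2) → PrimeSection D')
    (hs' : ∀ i, b (s i.castSucc).curve.1 = (s' i).curve.1)
    (hxs' : ∀ i, x ∈ closure {(s' i).curve.1} ↔ i = 0 ∨ i = 1)
    (hdisj : Disjoint (closure {(s 0).curve.1}) (closure {(s 1).curve.1}))
    {m' : ℕ} (a' : Fin m' → Fin (n + 2) →₀ ℕ) (ha' : DefinesComplement s' a')
    (hprime : (Ideal.span {(s' 0).toCox, (s' 1).toCox}).IsPrime)
    (hcontr : ((contractedIdeal g).map (MvPolynomial.map (algebraMap A Kbar))).comap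
      (MvPolynomial.map (algebraMap A Kbar)) = contractedIdeal g)
    (hrad : (idealC a g).radical = (idealC' a' g).radical)
    (hunits : HasAllUnits (generators (fun i ↦ (s i).deg) (Ideal.span (Set.range g)) a))
    (hunits' : HasAllUnits (generators (contractedDegrees fun i ↦ (s' i).deg) (contractedIdeal g)
      fun j ↦ (a' j).mapDomain Fin.castSucc)) :
    IsBlowupAlong hunits.hasUnits hunits'.hasUnits
      {Ideal.Quotient.mk (contractedIdeal g) (MvPolynomial.X 0),
        Ideal.Quotient.mk (contractedIdeal g) (MvPolynomial.X 1)} := by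
  have H : IsContractionOfCurves b (s (Fin.last (n + 2))).curve x
      (fun i ↦ (s i.castSucc).curve) fun i ↦ (s' i).curve :=
    { isContraction := hx
      map_eq := hs'
      specializes_iff := fun i ↦ specializes_iff_mem_closure.trans (hxs' i)
      not_specializes := fun q h0 h1 ↦ Set.disjoint_left.mp hdisj
        (specializes_iff_mem_closure.mp h0) (specializes_iff_mem_closure.mp h1) }
  have : IsProper b := by
    have : IsProper (b ≫ p') := hb ▸ inferInstance
    exact IsProper.of_comp b p'
  obtain ⟨_, H⟩ := H.isContractionGrading p' hD hD' hs ha hunits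
  exact H.isBlowupAlong hrad hunits hunits'
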